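/- Work with formal series in $q$ and put $D_\tau = q\frac{d}{dq}$. For even $k>0$ let $$G_k = -\frac{B_k}{2k} + \sum_{n\ge 1}\sum_{d\mid n} d^{k-1} q^n \in \mathbb{Q}[[q]],$$ where $B_k$ are the Bernoulli numbers, and let $\mathsf{QMod} = \mathbb{Q}[G_2,G_4,G_6] = \bigoplus_k \mathsf{QMod}_k \subset \mathbb{Q}[[q]]$ be the algebra of quasi-modular forms, where $\mathsf{QMod}_k$ is the $\mathbb{Q}$-span of the monomials $G_2^a G_4^b G_6^c$ with $2a+4b+6c=k$. Let $\Theta = \vartheta_1/\eta^3$, where $$\vartheta_1 = \sum_{\nu\in\mathbb{Z}+\frac12} (-1)^{\lfloor \nu\rfloor} p^{\nu} q^{\nu^2/2}, \qquad \eta = q^{1/24}\prod_{n\ge1}(1-q^n),$$ so that $\Theta \in \mathbb{Q}[p^{\pm 1/2}][[q]]$, and let $F = D_\tau^2\Theta/\Theta$, which lies in $\mathbb{Q}[p^{\pm1/2}][[q]]$ and has vanishing constant term in $q$. For every $m\in\mathbb{Z}$ let $\phi_m\in\mathbb{Q}[p^{\pm1/2}][[q]]$ be the unique series with $$D_\tau^2\phi_m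 = m^2 F\phi_m, \qquad \phi_m = (p^{m/2}-p^{-m/2}) + O(q).$$ Expand $\phi_m$ as a power series in $z$ with coefficients in $\mathbb{Q}[[q]]$ through the substitution $p=e^z$ (that is, $p^{1/2}=e^{z/2}$). Then for every $k\ge 1$ there is an odd polynomial $P_k(u)$ of degree $\le k$ with coefficients in $\mathsf{QMod}_{k-1}$ such that for all $m\in\mathbb{Z}$ $$\phi_m = \sum_{\text{odd } k\ge 1} z^k P_k(m).$$ Moreover, these polynomials satisfy $P_1(u)=u$ and $u^3 \mid P_k(u)$ for all $k\ge2$. -/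

import Mathlib

namespace KanekoZagierJacobi

open Finset PowerSeries

noncomputable section

/-! ### Formal series in `q`, and the half-power variable `s = p^{1/2}`

The ring `ℚ[p^{±1/2}]` is the ring of Laurent polynomials in `s = p^{1/2}`, so that
`LaurentPolynomial.T j` stands for `s^j = p^{j/2}`.  In `R⟦X⟧` with `R = ℚ` or
`R = ℚ[p^{±1/2}]` the variable is `q`. -/

/-- `ℚ[p^{±1/2}]`. -/
abbrev HalfLaurent : Type := LaurentPolynomial ℚ

/-- The operator `D_τ = q d/dq` on formal power series in `q`. -/
def Dtau {R : Type*} [CommRing R] (f : R⟦X⟧) : R⟦X⟧ := X * derivative R f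

theorem coeff_Dtau {R : Type*} [CommRing R] (f : R⟦X⟧) (n : ℕ) :
    coeff n (Dtau f) = (n : R) * coeff n f := by
  unfold Dtau
  cases n with
  | zero => simp
  | succ n => rw [coeff_succ_X_mul, coeff_derivative]; push_cast; ring

/-- `∏_{n ≥ 1} (1 - q^n)`, which is `q^{-1/24} η`.  Only the factors with `n ≤ N` contribute to
the coefficient of `q^N`. -/
def eulerProduct (R : Type*) [CommRing R] : R⟦X⟧ :=
  PowerSeries.mk fun N => coeff N (∏ i ∈ range N, (1 - X ^ (i + 1) : R⟦X⟧))

theorem constantCoeff_eulerProduct (R : Type*) [CommRing R] :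
    constantCoeff (eulerProduct R) = 1 := by
  rw [← coeff_zero_eq_constantCoeff_apply]; simp [eulerProduct]

/-- `q^{-1/8} ϑ₁`, where `ϑ₁ = ∑_{ν ∈ ℤ + 1/2} (-1)^{⌊ν⌋} p^ν q^{ν²/2}`: for `ν = n + 1/2` one has
`⌊ν⌋ = n`, `p^ν = s^{2n+1}` and `ν²/2 = n(n+1)/2 + 1/8`.  All integers `n` with `n(n+1)/2 = N`
lie in the interval `[-(N+1), N]`. -/
def thetaOne : HalfLaurent⟦X⟧ :=
  PowerSeries.mk fun N =>
    ∑ n ∈ (Icc (-((N : ℤ) + 1)) (N : ℤ)).filter (fun n : ℤ => n * (n + 1) = 2 * (N : ℤ)),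
      LaurentPolynomial.C ((-1 : ℚ) ^ n) * LaurentPolynomial.T (2 * n + 1)

/-- `Θ = ϑ₁ / η³`; the powers `q^{1/8}` of numerator and denominator cancel. -/
def Theta : HalfLaurent⟦X⟧ := thetaOne * invOfUnit (eulerProduct HalfLaurent ^ 3) 1

/-! ### The quotient `F = D_τ² Θ / Θ` -/

theorem s_sub_inv_ne_zero :
    (LaurentPolynomial.T 1 - LaurentPolynomial.T (-1) : HalfLaurent) ≠ 0 := by
  intro h
  have h1 : (LaurentPolynomial.T 1 : HalfLaurent) = LaurentPolynomial.T (-1) := sub_eq_zero.1 h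
  have h2 := congrArg LaurentPolynomial.degree h1
  rw [LaurentPolynomial.degree_T, LaurentPolynomial.degree_T] at h2
  exact absurd (WithBot.coe_inj.1 h2) (by norm_num)

theorem constantCoeff_Theta :
    constantCoeff Theta = LaurentPolynomial.T 1 - LaurentPolynomial.T (-1) := by
  have h0 : (Icc (-1 : ℤ) 0).filter (fun n : ℤ => n = 0 ∨ n + 1 = 0) = {-1, 0} := by decide
  rw [Theta, map_mul, constantCoeff_invOfUnit, ← coeff_zero_eq_constantCoeff_apply]
  simp [thetaOne, h0]
  ring

theorem Theta_ne_zero : Theta ≠ 0 := by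
  intro h
  have := constantCoeff_Theta
  rw [h, map_zero] at this
  exact s_sub_inv_ne_zero this.symm

/-- `s^k - s^{-k}` is divisible by `s - s^{-1}`. -/
theorem s_sub_inv_dvd (k : ℤ) :
    (LaurentPolynomial.T 1 - LaurentPolynomial.T (-1) : HalfLaurent) ∣
      LaurentPolynomial.T (2 * k + 1) - LaurentPolynomial.T (-(2 * k + 1)) := by
  have step : ∀ j : ℤ,
      (LaurentPolynomial.T (2 * (j + 1) + 1) - LaurentPolynomial.T (-(2 * (j + 1) + 1))
        : HalfLaurent) =
      (LaurentPolynomial.T 1 - LaurentPolynomial.T (-1)) *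
        (LaurentPolynomial.T (2 * j + 2) + LaurentPolynomial.T (-(2 * j + 2))) +
      (LaurentPolynomial.T (2 * j + 1) - LaurentPolynomial.T (-(2 * j + 1))) := by
    intro j
    simp only [sub_mul, mul_add, ← LaurentPolynomial.T_add]
    ring_nf
  induction k using Int.induction_on with
  | zero => simp
  | succ i ih => rw [step]; exact dvd_add (Dvd.intro _ rfl) ih
  | pred i ih =>
    have h := step (-(i : ℤ) - 1)
    rw [sub_add_cancel] at h
    rw [h] at ih
    exact (dvd_add_right (Dvd.intro _ rfl)).1 ih

/-- An element `c` of a commutative ring divides a power series if it divides its coefficients. -/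
theorem C_dvd_of_coeff {R : Type*} [CommRing R] (c : R) (f : R⟦X⟧)
    (h : ∀ n, c ∣ coeff n f) : C c ∣ f := by
  choose g hg using h
  refine ⟨PowerSeries.mk g, ?_⟩
  ext n
  rw [coeff_C_mul, coeff_mk, hg]

theorem s_sub_inv_dvd_thetaOne :
    C (LaurentPolynomial.T 1 - LaurentPolynomial.T (-1) : HalfLaurent) ∣ thetaOne := by
  apply C_dvd_of_coeff
  intro N
  rw [thetaOne, coeff_mk]
  set S := (Icc (-((N : ℤ) + 1)) (N : ℤ)).filter (fun n : ℤ => n * (n + 1) = 2 * (N : ℤ)) with hS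
  set g : ℤ → HalfLaurent := fun n =>
    LaurentPolynomial.C ((-1 : ℚ) ^ n) * LaurentPolynomial.T (2 * n + 1) with hg
  have hrefl : ∑ n ∈ S, g n = ∑ n ∈ S, g (-1 - n) := by
    refine Finset.sum_bij' (fun n _ => -1 - n) (fun n _ => -1 - n) ?_ ?_ ?_ ?_ ?_
    · intro n hn
      simp only [hS, mem_filter, Finset.mem_Icc] at hn ⊢
      exact ⟨by omega, by rw [← hn.2]; ring⟩
    · intro n hn
      simp only [hS, mem_filter, Finset.mem_Icc] at hn ⊢
      exact ⟨by omega, by rw [← hn.2]; ring⟩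
    · intro n _; ring
    · intro n _; ring
    · intro n _; congr 1; ring
  have hdouble : ∑ n ∈ S, g n = LaurentPolynomial.C (1 / 2 : ℚ) * ∑ n ∈ S, (g n + g (-1 - n)) := by
    rw [sum_add_distrib, ← hrefl, ← two_mul, ← mul_assoc]
    have : (LaurentPolynomial.C (1 / 2 : ℚ) * 2 : HalfLaurent) = 1 := by
      rw [show (2 : HalfLaurent) = LaurentPolynomial.C (2 : ℚ) from
        (map_ofNat LaurentPolynomial.C 2).symm, ← map_mul]
      norm_num
    rw [this, one_mul]
  rw [hdouble]
  refine Dvd.dvd.mul_left (Finset.dvd_sum fun n _ => ?_) _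
  have hsign : ((-1 : ℚ) ^ (-1 - n)) = -((-1 : ℚ) ^ n) := by
    rw [zpow_sub₀ (by norm_num)]
    rcases Int.even_or_odd n with h | h
    · rw [h.neg_one_zpow]; norm_num
    · rw [h.neg_one_zpow]; norm_num
  have : g n + g (-1 - n) = LaurentPolynomial.C ((-1 : ℚ) ^ n) *
      (LaurentPolynomial.T (2 * n + 1) - LaurentPolynomial.T (-(2 * n + 1))) := by
    simp only [hg, hsign, map_neg]
    rw [show 2 * (-1 - n) + 1 = -(2 * n + 1) by ring]
    ring
  rw [this]
  exact (s_sub_inv_dvd n).mul_left _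

theorem Theta_dvd_Dtau_Dtau_Theta : Theta ∣ Dtau (Dtau Theta) := by
  set c : HalfLaurent := LaurentPolynomial.T 1 - LaurentPolynomial.T (-1) with hc
  obtain ⟨U, hU⟩ : C c ∣ Theta := s_sub_inv_dvd_thetaOne.mul_right _
  have hU0 : constantCoeff U = 1 := by
    have h := constantCoeff_Theta
    rw [hU, map_mul, constantCoeff_C] at h
    exact mul_left_cancel₀ s_sub_inv_ne_zero (by rw [mul_one]; exact h)
  have hD : Dtau (Dtau Theta) = C c * Dtau (Dtau U) := by
    ext n
    simp only [hU, coeff_Dtau, coeff_C_mul]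
    ring_nf
  refine ⟨invOfUnit U 1 * Dtau (Dtau U), ?_⟩
  rw [hD, hU, mul_assoc, ← mul_assoc U, mul_invOfUnit U 1 (by simpa using hU0), one_mul]

theorem existsUnique_F : ∃! F : HalfLaurent⟦X⟧, F * Theta = Dtau (Dtau Theta) := by
  obtain ⟨F, hF⟩ := Theta_dvd_Dtau_Dtau_Theta
  refine ⟨F, by rw [hF]; exact mul_comm _ _, fun G hG => ?_⟩
  refine mul_right_cancel₀ Theta_ne_zero ?_
  rw [hG, hF]; exact mul_comm _ _

/-- `F = D_τ² Θ / Θ`, the unique element of `ℚ[p^{±1/2}]⟦q⟧` with `F Θ = D_τ² Θ`. -/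
def F : HalfLaurent⟦X⟧ := existsUnique_F.choose

theorem F_mul_Theta : F * Theta = Dtau (Dtau Theta) := existsUnique_F.choose_spec.1

theorem constantCoeff_F : constantCoeff F = 0 := by
  have h := congrArg (coeff 0) F_mul_Theta
  rw [coeff_Dtau, coeff_zero_eq_constantCoeff_apply, map_mul, constantCoeff_Theta] at h
  rcases mul_eq_zero.1 (h.trans (by simp)) with h | h
  · exact h
  · exact absurd h s_sub_inv_ne_zero

/-! ### The functions `φ_m` -/

/-- `f` satisfies `D_τ² f = m² F f` and has constant term `p^{m/2} - p^{-m/2}` in `q`. -/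
def IsSolution (m : ℤ) (f : HalfLaurent⟦X⟧) : Prop :=
  Dtau (Dtau f) = (m : HalfLaurent⟦X⟧) ^ 2 * F * f ∧
    constantCoeff f = LaurentPolynomial.T m - LaurentPolynomial.T (-m)

/-- The recursion satisfied by the coefficients of a solution. -/
def solCoeff (m : ℤ) : ℕ → HalfLaurent
  | 0 => LaurentPolynomial.T m - LaurentPolynomial.T (-m)
  | n + 1 => LaurentPolynomial.C ((m : ℚ) ^ 2 / ((n : ℚ) + 1) ^ 2) *
      ∑ i : Fin (n + 1), coeff (n + 1 - i) F * solCoeff m i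

theorem isSolution_iff (m : ℤ) (f : HalfLaurent⟦X⟧) :
    IsSolution m f ↔ ∀ n, coeff n f = solCoeff m n := by
  have key : ∀ n, coeff (n + 1) ((m : HalfLaurent⟦X⟧) ^ 2 * F * f) =
      (m : HalfLaurent) ^ 2 * ∑ i : Fin (n + 1), coeff (n + 1 - i) F * coeff (i : ℕ) f := by
    intro n
    rw [mul_assoc, show (m : HalfLaurent⟦X⟧) ^ 2 = C ((m : HalfLaurent) ^ 2) by simp,
      coeff_C_mul, mul_comm F f, coeff_mul,
      Nat.sum_antidiagonal_eq_sum_range_succ (fun i j => coeff i f * coeff j F),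
      Finset.sum_range_succ, Nat.sub_self, coeff_zero_eq_constantCoeff_apply F,
      constantCoeff_F, mul_zero, add_zero, Finset.sum_range]
    simp only [mul_comm]
  have hmn : ∀ (n : ℕ) (a b : HalfLaurent),
      ((n + 1 : ℕ) : HalfLaurent) * (((n + 1 : ℕ) : HalfLaurent) * a) = (m : HalfLaurent) ^ 2 * b ↔
      a = LaurentPolynomial.C ((m : ℚ) ^ 2 / ((n : ℚ) + 1) ^ 2) * b := by
    intro n a b
    have e1 : ((n + 1 : ℕ) : HalfLaurent) = LaurentPolynomial.C ((n : ℚ) + 1) := by simp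
    have e2 : (m : HalfLaurent) = LaurentPolynomial.C (m : ℚ) := by simp
    have hn : ((n : ℚ) + 1) ≠ 0 := by positivity
    rw [e1, e2, ← mul_assoc, ← map_mul, ← map_pow]
    constructor
    · intro h
      have h' := congrArg (fun t => LaurentPolynomial.C (1 / ((n : ℚ) + 1) ^ 2) * t) h
      simp only [← mul_assoc, ← map_mul] at h'
      rw [show 1 / ((n : ℚ) + 1) ^ 2 * ((n : ℚ) + 1) * ((n : ℚ) + 1) = 1 by field_simp,
        map_one, one_mul] at h'
      rw [h']
      congr 2
      field_simp
    · rintro rfl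
      rw [← mul_assoc, ← map_mul]
      congr 2
      field_simp
  constructor
  · rintro ⟨hode, h0⟩ n
    induction n using Nat.strong_induction_on with
    | _ n ih =>
      cases n with
      | zero => rw [solCoeff, ← h0, coeff_zero_eq_constantCoeff_apply]
      | succ n =>
        have h := congrArg (coeff (n + 1)) hode
        rw [coeff_Dtau, coeff_Dtau, key, hmn] at h
        rw [h, solCoeff]
        congr 1
        refine Finset.sum_congr rfl fun i _ => ?_
        rw [ih i i.2]
  · intro h
    refine ⟨?_, ?_⟩
    · ext1 n
      cases n with
      | zero =>
        rw [coeff_Dtau, coeff_zero_eq_constantCoeff_apply, coeff_zero_eq_constantCoeff_apply,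
          map_mul, map_mul, constantCoeff_F]
        simp
      | succ n =>
        rw [coeff_Dtau, coeff_Dtau, key, hmn, h, solCoeff]
        congr 1
        refine Finset.sum_congr rfl fun i _ => ?_
        rw [h]
    · rw [← coeff_zero_eq_constantCoeff_apply, h, solCoeff]

theorem existsUnique_phi (m : ℤ) : ∃! f : HalfLaurent⟦X⟧, IsSolution m f := by
  refine ⟨PowerSeries.mk (solCoeff m), (isSolution_iff m _).2 fun n => coeff_mk _ _, ?_⟩
  intro g hg
  ext1 n
  rw [(isSolution_iff m g).1 hg n, coeff_mk]

/-- `φ_m ∈ ℚ[p^{±1/2}]⟦q⟧`, the unique series with `D_τ² φ_m = m² F φ_m` and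
`φ_m = (p^{m/2} - p^{-m/2}) + O(q)`. -/
def phi (m : ℤ) : HalfLaurent⟦X⟧ := (existsUnique_phi m).choose

theorem phi_isSolution (m : ℤ) : IsSolution m (phi m) := (existsUnique_phi m).choose_spec.1

theorem eq_phi {m : ℤ} {f : HalfLaurent⟦X⟧} (h : IsSolution m f) : f = phi m :=
  (existsUnique_phi m).unique h (phi_isSolution m)

/-! ### Expansion in the elliptic variable `z`, where `p = e^z` -/

theorem exp_half_mul (a : ℚ) :
    rescale a (PowerSeries.exp ℚ) * rescale (-a) (PowerSeries.exp ℚ) = 1 := by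
  rw [exp_mul_exp_eq_exp_add, add_neg_cancel]
  simp

/-- `s = p^{1/2} = e^{z/2}` as an invertible power series in `z`. -/
def expHalf : ℚ⟦X⟧ˣ where
  val := rescale (1 / 2) (PowerSeries.exp ℚ)
  inv := rescale (-(1 / 2)) (PowerSeries.exp ℚ)
  val_inv := exp_half_mul _
  inv_val := by rw [mul_comm]; exact exp_half_mul _

/-- The ring homomorphism `ℚ[p^{±1/2}] → ℚ⟦z⟧`, `p^{1/2} ↦ e^{z/2}`. -/
def substExp : HalfLaurent →+* ℚ⟦X⟧ := LaurentPolynomial.eval₂ (C (R := ℚ)) expHalf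

/-- The expansion of `f ∈ ℚ[p^{±1/2}]⟦q⟧` as a power series in `z` with coefficients in `ℚ⟦q⟧`,
under `p = e^z`: the outer variable is `z`, the inner one is `q`. -/
def zExpansion (f : HalfLaurent⟦X⟧) : ℚ⟦X⟧⟦X⟧ :=
  PowerSeries.mk fun k => PowerSeries.mk fun n => coeff k (substExp (coeff n f))

/-! ### Quasi-modular forms, through their `q`-expansions -/

/-- `G_k = -B_k/(2k) + ∑_{n ≥ 1} ∑_{d ∣ n} d^{k-1} q^n`, for even `k > 0`. -/
def G (k : ℕ) : ℚ⟦X⟧ :=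
  PowerSeries.mk fun n =>
    if n = 0 then -(bernoulli k) / (2 * k) else ∑ d ∈ n.divisors, (d : ℚ) ^ (k - 1)

/-- `QMod_k`, the weight `k` part of `QMod = ℚ[G₂, G₄, G₆]`, where `G_j` has weight `j`. -/
def QMod (k : ℕ) : Submodule ℚ ℚ⟦X⟧ :=
  Submodule.span ℚ
    {f | ∃ a b c : ℕ, 2 * a + 4 * b + 6 * c = k ∧ f = G 2 ^ a * G 4 ^ b * G 6 ^ c}

end

end KanekoZagierJacobi

/-! For m = n + 1 > 0 the solution has a closed form: `phi m`, expanded in z, is the residue at x =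
0 of y^m, where y = Θ(x+z)/Θ(x). Since `gz` is x·y, this residue is the coefficient of x^n in `gz ^
(n + 1)`, called `residue n`.

The differential equation comes from an exact term. Put L = DΘ/Θ, so that D log y = L(x+z) − L(x),
and M = (2/3) DΘ'/Θ, whose z-derivative is DL up to a series in q alone (`dX_Mz`). With R = M(x+z) −
M(x) − M(z), `residue_identity` says R·∂_x log y = (L(x+z) − L(x))² − F(z). Hence D²(y^m) = m² F(z)
y^m + m ∂_x(R y^m), and residues of derivatives vanish. At q = 0 one has y = e^{z/2} + (e^{z/2} −
e^{−z/2})/(e^x − 1), and a binomial expansion gives the residue e^{mz/2} − e^{−mz/2}. Uniqueness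
then identifies `residue n` with the solution (`zHom_phi_eq_residue`).

Give x and z weight −1. The z-coefficients of Θ are quasi-modular and Θ has total weight −1, so the
residue has weight −1 whatever m is: its z^k coefficient lies in QMod_{k−1} (`residue_mem`).

The polynomials come from comparing z^k in the differential equation and inverting D². This
recursion (`polyP`) holds for all integers m and shows oddness, the degree bound and divisibility by
u³, but only gives coefficients in ℚ⟦q⟧. Their values at positive integers lie in QMod_{k−1}, and
interpolation forces the coefficients into it as well (`coeff_mem_of_eval_mem`).

The facts about Θ come from its two descriptions. The Jacobi triple product makes the z-coefficients
of L derivatives of Eisenstein series; the sum gives the heat equation `heat_Th`. Moreover Θ² and P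
= Θ'² − ΘΘ'' lie in a rank two module of theta series stable under the heat operator, whence
`heatOp_Pz`. That relation serves three times: for the quartic equation of Θ (a Weierstrass equation
for −(log Θ)''), through it for the Ramanujan identity for G₆, and for the addition formula. -/

namespace KanekoZagierJacobi

open Finset PowerSeries

noncomputable section

/-! ### Iterated power series: exchange of variables and coefficientwise derivations -/

section Iterated

variable {A : Type*} [CommRing A]

/-- Exchange of the two variables of an iterated power series ring. -/
def swapHom : A⟦X⟧⟦X⟧ →+* A⟦X⟧⟦X⟧ where
  toFun f := PowerSeries.mk fun k => PowerSeries.mk fun n => coeff k (coeff n f)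
  map_one' := by
    ext k n
    simp only [coeff_mk, coeff_one]
    split_ifs <;> simp [coeff_one, *]
  map_zero' := by ext k n; simp
  map_add' f g := by ext k n; simp
  map_mul' f g := by
    ext k n
    simp only [coeff_mk, coeff_mul, map_sum]
    rw [Finset.sum_comm]

theorem coeff_coeff_swapHom (f : A⟦X⟧⟦X⟧) (k n : ℕ) :
    coeff n (coeff k (swapHom f)) = coeff k (coeff n f) := by
  simp [swapHom]

theorem swapHom_map_C (f : A⟦X⟧) : swapHom (PowerSeries.map (C (R := A)) f) = C f := by
  ext k n
  rw [coeff_coeff_swapHom, coeff_map, coeff_C, coeff_C]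
  split_ifs <;> simp

theorem swapHom_C (f : A⟦X⟧) : swapHom (C f) = PowerSeries.map (C (R := A)) f := by
  ext k n
  rw [coeff_coeff_swapHom, coeff_map, coeff_C, coeff_C]
  split_ifs <;> simp

variable [Algebra ℚ A]

/-- A derivation applied to every coefficient of a power series. -/
def coeffDer (d : Derivation ℚ A A) : Derivation ℚ A⟦X⟧ A⟦X⟧ :=
  Derivation.mk'
    { toFun := fun f => PowerSeries.mk fun n => d (coeff n f)
      map_add' := fun f g => by ext n; simp
      map_smul' := fun c f => by ext n; simp }
    (by
      intro f g
      ext n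
      simp only [LinearMap.coe_mk, AddHom.coe_mk, coeff_mk, coeff_mul, map_sum, map_add,
        Derivation.leibniz, smul_eq_mul, Finset.sum_add_distrib]
      congr 1
      rw [← Finset.Nat.sum_antidiagonal_swap]
      rfl)

@[simp]
theorem coeff_coeffDer (d : Derivation ℚ A A) (f : A⟦X⟧) (n : ℕ) :
    coeff n (coeffDer d f) = d (coeff n f) := by
  simp [coeffDer]

theorem coeffDer_C (d : Derivation ℚ A A) (a : A) : coeffDer d (C a) = C (d a) := by
  ext n
  rw [coeff_coeffDer, coeff_C, coeff_C]
  split_ifs <;> simp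

theorem coeffDer_X (d : Derivation ℚ A A) : coeffDer d (X : A⟦X⟧) = 0 := by
  ext n
  rw [coeff_coeffDer, coeff_X]
  split_ifs <;> simp

theorem coeffDer_map {B : Type*} [CommRing B] [Algebra ℚ B] (d : Derivation ℚ A A)
    (e : Derivation ℚ B B) (φ : A →+* B) (h : ∀ a, e (φ a) = φ (d a)) (f : A⟦X⟧) :
    coeffDer e (PowerSeries.map φ f) = PowerSeries.map φ (coeffDer d f) := by
  ext n
  simp [h]

/-- The derivation with respect to the outer variable. -/
def dX : Derivation ℚ A⟦X⟧ A⟦X⟧ := (PowerSeries.derivative A).restrictScalars ℚ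

theorem coeff_dX (f : A⟦X⟧) (n : ℕ) : coeff n (dX f) = coeff (n + 1) f * (n + 1) :=
  coeff_derivative f n

theorem dX_C (a : A) : dX (C a) = 0 := derivative_C

theorem dX_X : dX (X : A⟦X⟧) = 1 := derivative_X

theorem dX_coeffDer (d : Derivation ℚ A A) (f : A⟦X⟧) :
    dX (coeffDer d f) = coeffDer d (dX f) := by
  ext n
  rw [coeff_dX, coeff_coeffDer, coeff_coeffDer, coeff_dX, Derivation.leibniz]
  have : d ((n : A) + 1) = 0 := by simp
  rw [this, smul_zero, zero_add, smul_eq_mul, mul_comm]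

theorem dX_map {B : Type*} [CommRing B] [Algebra ℚ B] (φ : A →+* B) (f : A⟦X⟧) :
    dX (PowerSeries.map φ f) = PowerSeries.map φ (dX f) := by
  ext n
  simp [coeff_dX]

/-- `X d/dX` for the outer variable, as a derivation. -/
def eulerDer : Derivation ℚ A⟦X⟧ A⟦X⟧ := (X : A⟦X⟧) • dX

theorem eulerDer_eq_Dtau (f : A⟦X⟧) : eulerDer f = Dtau f := rfl

theorem coeff_eulerDer (f : A⟦X⟧) (n : ℕ) : coeff n (eulerDer f) = (n : A) * coeff n f :=
  coeff_Dtau f n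

theorem Dtau_mul (f g : A⟦X⟧) : Dtau (f * g) = f * Dtau g + g * Dtau f := by
  simp only [← eulerDer_eq_Dtau, Derivation.leibniz, smul_eq_mul]

theorem swapHom_eulerDer (f : A⟦X⟧⟦X⟧) :
    swapHom (eulerDer f) = coeffDer eulerDer (swapHom f) := by
  ext k n
  rw [coeff_coeff_swapHom, coeff_coeffDer, coeff_eulerDer, coeff_eulerDer, coeff_coeff_swapHom]
  have : (n : A⟦X⟧) = C (n : A) := by simp
  rw [this, coeff_C_mul]

theorem swapHom_coeffDer_dX (f : A⟦X⟧⟦X⟧) :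
    swapHom (coeffDer dX f) = dX (swapHom f) := by
  ext k n
  rw [coeff_coeff_swapHom, coeff_coeffDer, coeff_dX, coeff_dX,
    show ((k : A⟦X⟧) + 1) = C ((k : A) + 1) by simp, coeff_mul_C, coeff_coeff_swapHom]

end Iterated

/-! ### Infinite products `∏ (1 - a q^i)` -/

section Products

variable {A : Type*} [CommRing A]

/-- Identities between infinite products are reduced to finite truncations through this criterion.
-/
theorem eq_of_forall_X_pow_dvd_sub {f g : A⟦X⟧} (h : ∀ n, (X : A⟦X⟧) ^ (n + 1) ∣ f - g) :
    f = g := by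
  ext n
  have := (X_pow_dvd_iff.1 (h n)) n (Nat.lt_succ_self n)
  rwa [map_sub, sub_eq_zero] at this

/-- `∏_{i=1}^N (1 - a q^i)`. -/
def finProd (a : A) (N : ℕ) : A⟦X⟧ := ∏ i ∈ range N, (1 - C a * X ^ (i + 1))

theorem finProd_succ (a : A) (N : ℕ) :
    finProd a (N + 1) = finProd a N * (1 - C a * X ^ (N + 1)) := prod_range_succ _ _

/-- `∏_{i ≥ 1} (1 - a q^i)`. -/
def infProd (a : A) : A⟦X⟧ := PowerSeries.mk fun N => coeff N (finProd a N)

theorem eulerProduct_eq_infProd : eulerProduct A = infProd (1 : A) := by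
  simp [eulerProduct, infProd, finProd]

theorem X_pow_dvd_finProd_sub (a : A) {M N : ℕ} (h : M ≤ N) :
    (X : A⟦X⟧) ^ (M + 1) ∣ finProd a N - finProd a M := by
  induction N, h using Nat.le_induction with
  | base => simp
  | succ N hN ih =>
    rw [finProd_succ]
    have : finProd a N * (1 - C a * X ^ (N + 1)) - finProd a M =
      (finProd a N - finProd a M) - X ^ (N + 1) * (finProd a N * C a) := by ring
    rw [this]
    exact dvd_sub ih ((pow_dvd_pow _ (by omega)).mul_right _)

theorem X_pow_dvd_infProd_sub (a : A) (N : ℕ) :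
    (X : A⟦X⟧) ^ (N + 1) ∣ infProd a - finProd a N := by
  rw [X_pow_dvd_iff]
  intro m hm
  have := X_pow_dvd_iff.1 (X_pow_dvd_finProd_sub a (show m ≤ N by omega)) m (Nat.lt_succ_self m)
  rw [map_sub] at this ⊢
  rw [infProd, coeff_mk, ← neg_eq_zero, neg_sub]
  exact this

theorem constantCoeff_infProd (a : A) : constantCoeff (infProd a) = 1 := by
  rw [← coeff_zero_eq_constantCoeff_apply]; simp [infProd, finProd]

theorem map_infProd {B : Type*} [CommRing B] (φ : A →+* B) (a : A) :
    PowerSeries.map φ (infProd a) = infProd (φ a) := by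
  ext n
  rw [coeff_map, infProd, infProd, coeff_mk, coeff_mk, ← coeff_map, finProd, finProd, map_prod]
  simp

/-- `∑_n ∑_{d ∣ n} (n/d) a^d q^n`. -/
def lambertSeries (a : A) : A⟦X⟧ :=
  PowerSeries.mk fun n => ∑ d ∈ n.divisors, ((n / d : ℕ) : A) * a ^ d

/-- A truncation of the Lambert series. -/
def lambertTrunc (a : A) (M N : ℕ) : A⟦X⟧ :=
  ∑ i ∈ range N, ∑ r ∈ range M, C (((i + 1 : ℕ) : A) * a ^ (r + 1)) * X ^ ((i + 1) * (r + 1))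

theorem X_pow_dvd_lambertSeries_sub (a : A) (N : ℕ) :
    (X : A⟦X⟧) ^ (N + 1) ∣ lambertSeries a - lambertTrunc a N N := by
  rw [X_pow_dvd_iff]
  intro m hm
  rw [map_sub, sub_eq_zero, lambertSeries, coeff_mk, lambertTrunc]
  simp only [map_sum, coeff_C_mul, coeff_X_pow, mul_ite, mul_one, mul_zero]
  rw [← Finset.sum_product', ← Finset.sum_filter]
  -- A divisor d of m is matched with the factorisation m = (i + 1)(r + 1), r + 1 = d; the
  -- truncation at N loses nothing because m ≤ N.
  refine Finset.sum_bij' (fun d _ => (m / d - 1, d - 1)) (fun p _ => p.2 + 1) ?_ ?_ ?_ ?_ ?_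
  · intro d hd
    obtain ⟨⟨e, rfl⟩, h0⟩ := Nat.mem_divisors.1 hd
    have hd0 : 0 < d := Nat.pos_of_ne_zero (by rintro rfl; simp at h0)
    have he0 : 0 < e := Nat.pos_of_ne_zero (by rintro rfl; simp at h0)
    rw [Nat.mul_div_cancel_left _ hd0]
    simp only [mem_filter, mem_product, Finset.mem_range]
    have h1 : d ≤ d * e := Nat.le_mul_of_pos_right _ he0
    have h2 : e ≤ d * e := Nat.le_mul_of_pos_left _ hd0
    refine ⟨⟨by omega, by omega⟩, ?_⟩
    rw [Nat.sub_add_cancel he0, Nat.sub_add_cancel hd0, mul_comm]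
  · rintro ⟨i, r⟩ hp
    simp only [mem_filter] at hp
    rw [Nat.mem_divisors]
    exact ⟨⟨i + 1, by rw [hp.2, mul_comm]⟩, by rw [hp.2]; positivity⟩
  · intro d hd
    have := Nat.pos_of_mem_divisors hd
    simp only
    omega
  · rintro ⟨i, r⟩ hp
    simp only [mem_filter] at hp
    simp [hp.2]
  · intro d hd
    obtain ⟨⟨e, rfl⟩, h0⟩ := Nat.mem_divisors.1 hd
    have hd0 : 0 < d := Nat.pos_of_ne_zero (by rintro rfl; simp at h0)
    have he0 : 0 < e := Nat.pos_of_ne_zero (by rintro rfl; simp at h0)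
    simp only
    rw [Nat.mul_div_cancel_left _ hd0, Nat.sub_add_cancel he0, Nat.sub_add_cancel hd0]

theorem Dtau_C_mul_X_pow (a : A) (n : ℕ) :
    Dtau (C a * X ^ n : A⟦X⟧) = C ((n : A) * a) * X ^ n := by
  ext m
  rw [coeff_Dtau, coeff_C_mul, coeff_C_mul, coeff_X_pow]
  split_ifs with h
  · rw [h]; ring
  · simp

/-- The factor 1 − a q^i has logarithmic derivative −i a q^i/(1 − a q^i). Cutting its geometric
series after M terms leaves a tail divisible by q^{i(M+1)}, hence by q^{M+1}. -/
theorem X_pow_dvd_Dtau_finProd (a : A) (M N : ℕ) :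
    (X : A⟦X⟧) ^ (M + 1) ∣ Dtau (finProd a N) + lambertTrunc a M N * finProd a N := by
  induction N with
  | zero => simp [finProd, lambertTrunc, Dtau]
  | succ N ih =>
    have hgeom : ∀ M : ℕ, C (((N + 1 : ℕ) : A) * a) * X ^ (N + 1) =
        (1 - C a * X ^ (N + 1)) *
          ∑ r ∈ range M, C (((N + 1 : ℕ) : A) * a ^ (r + 1)) * X ^ ((N + 1) * (r + 1)) +
        C (((N + 1 : ℕ) : A) * a ^ (M + 1)) * X ^ ((N + 1) * (M + 1)) := by
      intro M
      induction M with
      | zero => simp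
      | succ M ih =>
        rw [ih, sum_range_succ]
        simp only [map_mul, map_pow, pow_succ, pow_mul]
        ring
    have hD : Dtau (1 - C a * X ^ (N + 1) : A⟦X⟧) =
        - (C (((N + 1 : ℕ) : A) * a) * X ^ (N + 1)) := by
      rw [← Dtau_C_mul_X_pow]
      simp [Dtau]
    have hsucc : lambertTrunc a M (N + 1) = lambertTrunc a M N +
        ∑ r ∈ range M, C (((N + 1 : ℕ) : A) * a ^ (r + 1)) * X ^ ((N + 1) * (r + 1)) :=
      sum_range_succ _ _
    rw [finProd_succ]
    have hmul : Dtau (finProd a N * (1 - C a * X ^ (N + 1))) =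
        Dtau (finProd a N) * (1 - C a * X ^ (N + 1)) +
          finProd a N * Dtau (1 - C a * X ^ (N + 1) : A⟦X⟧) := by
      simp only [Dtau, Derivation.leibniz, smul_eq_mul]; ring
    rw [hmul, hD, hgeom M, hsucc]
    have : ∀ (d p l u s t : A⟦X⟧), d * u + p * -(u * s + t) + (l + s) * (p * u) =
        (d + l * p) * u - t * p := by intros; ring
    rw [this]
    refine dvd_sub (ih.mul_right _) (Dvd.dvd.mul_right (Dvd.dvd.mul_left (pow_dvd_pow _ ?_) _) _)
    nlinarith

/-- The logarithmic derivative of `∏ (1 - a q^i)`. -/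
theorem Dtau_infProd (a : A) : Dtau (infProd a) = -(lambertSeries a) * infProd a := by
  refine eq_of_forall_X_pow_dvd_sub fun N => ?_
  have h1 := X_pow_dvd_infProd_sub a N
  have h2 := X_pow_dvd_lambertSeries_sub a N
  have h3 := X_pow_dvd_Dtau_finProd a N N
  have h4 : (X : A⟦X⟧) ^ (N + 1) ∣ Dtau (infProd a) - Dtau (finProd a N) := by
    rw [X_pow_dvd_iff] at h1 ⊢
    intro m hm
    have := h1 m hm
    rw [map_sub] at this ⊢
    rw [coeff_Dtau, coeff_Dtau, ← mul_sub, this, mul_zero]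
  have key : Dtau (infProd a) - -(lambertSeries a) * infProd a =
      (Dtau (infProd a) - Dtau (finProd a N)) +
      (Dtau (finProd a N) + lambertTrunc a N N * finProd a N) +
      (lambertSeries a - lambertTrunc a N N) * finProd a N +
      lambertSeries a * (infProd a - finProd a N) := by ring
  rw [key]
  exact dvd_add (dvd_add (dvd_add h4 h3) (h2.mul_right _)) (h1.mul_left _)

end Products

/-! ### The Jacobi triple product -/

/-- The coefficient of `s^j`, as a power series in `q`. -/
def row (j : ℤ) : HalfLaurent⟦X⟧ →+ ℚ⟦X⟧ where
  toFun f := PowerSeries.mk fun n => (coeff n f).coeff j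
  map_zero' := by ext n; simp
  map_add' f g := by ext n; simp

@[simp]
theorem coeff_row (j : ℤ) (f : HalfLaurent⟦X⟧) (n : ℕ) :
    coeff n (row j f) = (coeff n f).coeff j := by
  simp [row]

theorem row_ext {f g : HalfLaurent⟦X⟧} (h : ∀ j, row j f = row j g) : f = g := by
  ext n j
  rw [← coeff_row, h, coeff_row]

theorem laurent_coeff_C_mul (r : ℚ) (p : HalfLaurent) (j : ℤ) :
    (LaurentPolynomial.C r * p).coeff j = r * p.coeff j := by
  rw [← LaurentPolynomial.smul_eq_C_mul]; simp

theorem laurent_coeff_T_mul (n : ℤ) (p : HalfLaurent) (j : ℤ) :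
    (LaurentPolynomial.T n * p).coeff j = p.coeff (j - n) := by
  have := AddMonoidAlgebra.coeff_single_mul_eq_mul_coeff (R := ℚ) (r := 1) (x := p) (m := n)
    (m₁ := j) (j - n) (fun m' _ => by omega)
  rw [one_mul] at this
  exact this

theorem row_C_T_mul (j n : ℤ) (f : HalfLaurent⟦X⟧) :
    row j (C (LaurentPolynomial.T n) * f) = row (j - n) f := by
  ext k
  rw [coeff_row, coeff_row, coeff_C_mul, laurent_coeff_T_mul]

theorem row_map_mul (j : ℤ) (e : ℚ⟦X⟧) (f : HalfLaurent⟦X⟧) :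
    row j (PowerSeries.map LaurentPolynomial.C e * f) = e * row j f := by
  ext k
  rw [coeff_row, coeff_mul, coeff_mul]
  simp only [AddMonoidAlgebra.coeff_sum, Finsupp.coe_finsetSum, Finset.sum_apply, coeff_map,
    laurent_coeff_C_mul, coeff_row]

theorem row_X_pow_mul (j : ℤ) (k : ℕ) (f : HalfLaurent⟦X⟧) :
    row j (X ^ k * f) = X ^ k * row j f := by
  have := row_map_mul j (X ^ k) f
  rwa [map_pow, map_X] at this

theorem X_pow_dvd_row (j : ℤ) {k : ℕ} {f : HalfLaurent⟦X⟧} (h : X ^ k ∣ f) :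
    X ^ k ∣ row j f := by
  obtain ⟨g, rfl⟩ := h
  rw [row_X_pow_mul]
  exact Dvd.intro _ rfl

/-- `i (i + 1) / 2`. -/
def tri (i : ℤ) : ℕ := (i * (i + 1) / 2).toNat

theorem two_mul_tri (i : ℤ) : 2 * (tri i : ℤ) = i * (i + 1) := by
  have h1 : 0 ≤ i * (i + 1) := by
    rcases le_or_gt 0 i with h | h
    · positivity
    · nlinarith
  have h2 : 2 ∣ i * (i + 1) := (Int.even_mul_succ_self i).two_dvd
  rw [tri]
  omega

/-- `1 / ∏_{i=1}^n (1 - q^i)`, extended by `0` to negative `n`. -/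
def invQ (n : ℤ) : ℚ⟦X⟧ := if n < 0 then 0 else invOfUnit (finProd 1 n.toNat) 1

theorem constantCoeff_finProd (N : ℕ) (a : ℚ) : constantCoeff (finProd a N) = 1 := by
  simp [finProd]

theorem finProd_mul_invQ {n : ℤ} (h : 0 ≤ n) : finProd 1 n.toNat * invQ n = 1 := by
  rw [invQ, if_neg (by omega), mul_invOfUnit _ _ (by simp [constantCoeff_finProd])]

theorem invQ_sub_one (n : ℤ) : invQ (n - 1) = (1 - X ^ n.toNat) * invQ n := by
  rcases lt_trichotomy n 0 with h | rfl | h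
  · rw [invQ, invQ, if_pos (by omega), if_pos h, mul_zero]
  · simp [invQ]
  · obtain ⟨m, rfl⟩ : ∃ m : ℕ, n = (m : ℤ) + 1 := ⟨(n - 1).toNat, by omega⟩
    have h1 := finProd_mul_invQ (show (0 : ℤ) ≤ (m : ℤ) + 1 by omega)
    have h2 := finProd_mul_invQ (show (0 : ℤ) ≤ (m : ℤ) by omega)
    rw [show ((m : ℤ) + 1).toNat = m + 1 by omega, finProd_succ] at h1
    rw [show ((m : ℤ)).toNat = m by omega] at h2
    rw [show (m : ℤ) + 1 - 1 = m by ring, show ((m : ℤ) + 1).toNat = m + 1 by omega]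
    rw [map_one, one_mul] at h1
    linear_combination (invQ m) * (-h1) + (1 - X ^ (m + 1)) * invQ (m + 1) * h2

/-- The coefficients in the finite form of the triple product. -/
def tripleCoeff (N : ℕ) (i : ℤ) : ℚ⟦X⟧ :=
  C ((-1 : ℚ) ^ i) * X ^ tri i * finProd 1 (2 * N + 1) * invQ (N - i) * invQ (N + 1 + i)

theorem neg_one_zpow_add_one (i : ℤ) : (-1 : ℚ) ^ (i + 1) = -(-1 : ℚ) ^ i := by
  rw [zpow_add₀ (by norm_num)]; simp

theorem neg_one_zpow_sub_one (i : ℤ) : (-1 : ℚ) ^ (i - 1) = -(-1 : ℚ) ^ i := by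
  have := neg_one_zpow_add_one (i - 1)
  rw [sub_add_cancel] at this
  rw [this, neg_neg]

/-- This is the recursion `tripleCoeff_succ` after cancelling common factors, with m = N + 1 − i, l
= N + 2 + i and k = 2N + 2. The truncated m − 1 and l − 1 are harmless: at m = 0 or l = 0 the
neighbouring factor 1 − X^0 is zero. -/
theorem tripleCoeff_identity (m l k : ℕ) (h : m + l = k + 1) :
    (1 - X ^ k) * (1 - X ^ (k + 1)) = ((1 + X ^ k) * ((1 - X ^ m) * (1 - X ^ l)) +
      X ^ m * ((1 - X ^ (l - 1)) * (1 - X ^ l)) +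
      X ^ l * ((1 - X ^ (m - 1)) * (1 - X ^ m)) : ℚ⟦X⟧) := by
  rcases m with _ | m
  · obtain rfl : l = k + 1 := by omega
    simp
  rcases l with _ | l
  · obtain rfl : m = k := by omega
    simp
  obtain rfl : k = m + l + 1 := by omega
  simp only [Nat.add_sub_cancel]
  ring

/-- The recursion mirrors multiplication by the new factors (1 − p q^{N+1})(1 − p⁻¹ q^{N+1}) = 1 +
q^{2N+2} − q^{N+1}(p + p⁻¹). -/
theorem tripleCoeff_succ (N : ℕ) (i : ℤ) :
    tripleCoeff (N + 1) i = (1 + X ^ (2 * N + 2)) * tripleCoeff N i -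
      X ^ (N + 1) * (tripleCoeff N (i - 1) + tripleCoeff N (i + 1)) := by
  have t0 := two_mul_tri i
  have t1 := two_mul_tri (i - 1)
  have t2 := two_mul_tri (i + 1)
  simp only [tripleCoeff, neg_one_zpow_add_one, neg_one_zpow_sub_one, map_neg]
  set e := C ((-1 : ℚ) ^ i) (R := ℚ)
  have m1 : ((N + 1 : ℕ) : ℤ) - i = N + 1 - i := by push_cast; ring
  have l1 : ((N + 1 : ℕ) : ℤ) + 1 + i = N + 2 + i := by push_cast; ring
  have m2 : invQ ((N : ℤ) - i) = (1 - X ^ (N + 1 - i).toNat) * invQ (N + 1 - i) := by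
    rw [← invQ_sub_one]; congr 1; ring
  have l2 : invQ ((N : ℤ) + 1 + i) = (1 - X ^ (N + 2 + i).toNat) * invQ (N + 2 + i) := by
    rw [← invQ_sub_one]; congr 1; ring
  have m3 : invQ ((N : ℤ) - (i + 1)) = (1 - X ^ ((N : ℤ) - i).toNat) * invQ (N - i) := by
    rw [← invQ_sub_one]; congr 1; ring
  have l3 : invQ ((N : ℤ) + 1 + (i - 1)) =
      (1 - X ^ ((N : ℤ) + 1 + i).toNat) * invQ (N + 1 + i) := by
    rw [← invQ_sub_one]; congr 1; ring
  have m4 : (N : ℤ) - (i - 1) = N + 1 - i := by ring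
  have l4 : (N : ℤ) + 1 + (i + 1) = N + 2 + i := by ring
  rw [m1, l1, m3, l3, m4, l4, m2, l2]
  -- For i outside [−(N+2), N+1] every term vanishes, since `invQ` is zero at negative arguments.
  rcases lt_or_ge (N + 1 - i) 0 with hm | hm
  · simp [invQ, hm]
  rcases lt_or_ge (N + 2 + i) 0 with hl | hl
  · simp [invQ, hl]
  obtain ⟨m, hm⟩ := Int.eq_ofNat_of_zero_le hm
  obtain ⟨l, hl⟩ := Int.eq_ofNat_of_zero_le hl
  rw [hm, hl, show ((N : ℤ) - i).toNat = m - 1 by omega,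
    show ((N : ℤ) + 1 + i).toNat = l - 1 by omega, Int.toNat_natCast, Int.toNat_natCast]
  have e1 : (X : ℚ⟦X⟧) ^ (N + 1) * X ^ tri (i - 1) = X ^ tri i * X ^ m := by
    rw [← pow_add, ← pow_add]; congr 1; nlinarith
  have e2 : (X : ℚ⟦X⟧) ^ (N + 1) * X ^ tri (i + 1) = X ^ tri i * X ^ l := by
    rw [← pow_add, ← pow_add]; congr 1; nlinarith
  have key := tripleCoeff_identity m l (2 * N + 2) (by omega)
  rw [show 2 * (N + 1) + 1 = 2 * N + 1 + 1 + 1 by ring, finProd_succ, finProd_succ]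
  simp only [map_one, one_mul]
  rw [show 2 * N + 1 + 1 = 2 * N + 2 by ring]
  linear_combination (e * X ^ tri i * finProd 1 (2 * N + 1) * invQ m * invQ l) * key -
    e * finProd 1 (2 * N + 1) * invQ m * invQ l * (1 - X ^ (l - 1)) * (1 - X ^ l) * e1 -
    e * finProd 1 (2 * N + 1) * invQ m * invQ l * (1 - X ^ (m - 1)) * (1 - X ^ m) * e2

/-- `(s - s⁻¹) ∏_{i=1}^N (1 - p q^i)(1 - p⁻¹ q^i)`. -/
def finTriple (N : ℕ) : HalfLaurent⟦X⟧ :=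
  C (LaurentPolynomial.T 1 - LaurentPolynomial.T (-1)) *
    (finProd (LaurentPolynomial.T 2) N * finProd (LaurentPolynomial.T (-2)) N)

theorem finTriple_succ (N : ℕ) : finTriple (N + 1) = finTriple N + X ^ (2 * N + 2) * finTriple N -
    X ^ (N + 1) * (C (LaurentPolynomial.T 2) * finTriple N +
      C (LaurentPolynomial.T (-2)) * finTriple N) := by
  have h : (C (LaurentPolynomial.T 2) * C (LaurentPolynomial.T (-2)) : HalfLaurent⟦X⟧) = 1 := by
    rw [← map_mul, ← LaurentPolynomial.T_add]; simp
  rw [finTriple, finTriple, finProd_succ, finProd_succ]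
  linear_combination (C (LaurentPolynomial.T 1 - LaurentPolynomial.T (-1)) *
    (finProd (LaurentPolynomial.T 2) N * finProd (LaurentPolynomial.T (-2)) N) *
    X ^ (2 * N + 2)) * h

/-- Finite form of the triple product: both sides satisfy the same recursion in N, and N = 0 is s −
s⁻¹. -/
theorem row_finTriple (N : ℕ) (i : ℤ) :
    row (2 * i + 1) (finTriple N) = tripleCoeff N i ∧ row (2 * i) (finTriple N) = 0 := by
  induction N generalizing i with
  | zero =>
    have hz : finTriple 0 = C (LaurentPolynomial.T 1) * 1 - C (LaurentPolynomial.T (-1)) * 1 := by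
      simp [finTriple, finProd]
    have h1 : ∀ j : ℤ, row j 1 = if j = 0 then 1 else 0 := by
      intro j
      ext n
      rw [coeff_row, coeff_one]
      by_cases hn : n = 0
      · subst hn
        simp only [if_true]
        rw [← LaurentPolynomial.T_zero, LaurentPolynomial.T_apply]
        rcases eq_or_ne j 0 with rfl | hj
        · simp
        · simp [hj, hj.symm]
      · split_ifs <;> simp [coeff_one, hn]
    rw [hz, map_sub, map_sub]
    simp only [row_C_T_mul, h1]
    refine ⟨?_, ?_⟩
    · rcases eq_or_ne i 0 with rfl | h0
      · have := finProd_mul_invQ (show (0 : ℤ) ≤ 1 by norm_num)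
        have h' := finProd_mul_invQ (show (0 : ℤ) ≤ 0 by norm_num)
        simp [finProd] at this h'
        simp [tripleCoeff, finProd, tri, h', this]
      rcases eq_or_ne i (-1) with rfl | h1
      · have := finProd_mul_invQ (show (0 : ℤ) ≤ 1 by norm_num)
        have h' := finProd_mul_invQ (show (0 : ℤ) ≤ 0 by norm_num)
        simp [finProd] at this h'
        simp [tripleCoeff, finProd, tri, h']
        linear_combination this
      · rw [if_neg (by omega), if_neg (by omega), tripleCoeff]
        have : ((0 : ℕ) : ℤ) - i < 0 ∨ ((0 : ℕ) : ℤ) + 1 + i < 0 := by omega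
        rcases this with h | h
        · rw [invQ, if_pos h]; ring
        · rw [invQ, invQ, if_pos h]; ring
    · rw [if_neg (by omega), if_neg (by omega), sub_zero]
  | succ N ih =>
    rw [finTriple_succ]
    simp only [map_sub, map_add, row_X_pow_mul, row_C_T_mul, mul_add]
    refine ⟨?_, ?_⟩
    · rw [tripleCoeff_succ, show 2 * i + 1 - 2 = 2 * (i - 1) + 1 by ring,
        show 2 * i + 1 - -2 = 2 * (i + 1) + 1 by ring, (ih _).1, (ih _).1, (ih _).1]
      ring
    · rw [show 2 * i - 2 = 2 * (i - 1) by ring,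
        show 2 * i - -2 = 2 * (i + 1) by ring, (ih _).2, (ih _).2, (ih _).2]
      ring

theorem row_thetaOne (i : ℤ) :
    row (2 * i + 1) thetaOne = C ((-1 : ℚ) ^ i) * X ^ tri i ∧ row (2 * i) thetaOne = 0 := by
  have h : ∀ j : ℤ, ∀ N : ℕ, coeff N (row j thetaOne) =
      ∑ n ∈ (Icc (-((N : ℤ) + 1)) (N : ℤ)).filter (fun n : ℤ => n * (n + 1) = 2 * (N : ℤ)),
        (if j = 2 * n + 1 then (-1 : ℚ) ^ n else 0) := by
    intro j N
    rw [coeff_row, thetaOne, coeff_mk, AddMonoidAlgebra.coeff_sum, Finsupp.coe_finsetSum,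
      Finset.sum_apply]
    refine Finset.sum_congr rfl fun n _ => ?_
    rw [laurent_coeff_C_mul, LaurentPolynomial.T_apply]
    split_ifs with h1 h2 h2
    · simp
    · exact absurd h1.symm h2
    · exact absurd h2.symm h1
    · simp
  refine ⟨?_, ?_⟩
  · ext N
    rw [h, coeff_C_mul, coeff_X_pow]
    have : ∀ n : ℤ, (2 * i + 1 = 2 * n + 1) ↔ n = i := fun n => by omega
    simp only [this]
    rw [Finset.sum_ite_eq']
    have ht := two_mul_tri i
    simp only [mem_filter, Finset.mem_Icc]
    split_ifs with h1 h2 h2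
    · simp
    · omega
    · exfalso
      apply h1
      subst h2
      refine ⟨⟨?_, ?_⟩, ht.symm⟩ <;> nlinarith
    · simp
  · ext N
    rw [h, map_zero]
    exact Finset.sum_eq_zero fun n _ => if_neg (by omega)

/-- Limit of the finite form: modulo q^{n+1} all long enough products ∏(1 − q^j) coincide, so two
numerators cancel the two denominators. -/
theorem X_pow_dvd_tripleCoeff (i : ℤ) (n : ℕ) :
    (X : ℚ⟦X⟧) ^ (n + 1) ∣ infProd 1 * tripleCoeff (2 * n + 2) i - C ((-1 : ℚ) ^ i) * X ^ tri i := by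
  have ht := two_mul_tri i
  rcases lt_or_ge n (tri i) with h | h
  · have h' : (X : ℚ⟦X⟧) ^ (n + 1) ∣ X ^ tri i := pow_dvd_pow _ h
    rw [tripleCoeff]
    refine dvd_sub ?_ (h'.mul_left _)
    refine Dvd.dvd.mul_left (Dvd.dvd.mul_right (Dvd.dvd.mul_right (Dvd.dvd.mul_right ?_ _) _) _) _
    exact h'.mul_left _
  -- tri i ≤ n bounds i, so that with N = 2n + 2 both N − i and N + 1 + i are at least n.
  · have hi1 : i ≤ n := by nlinarith
    have hi2 : -((n : ℤ) + 1) ≤ i := by nlinarith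
    have ha : (0 : ℤ) ≤ ((2 * n + 2 : ℕ) : ℤ) - i := by push_cast; omega
    have hc : (0 : ℤ) ≤ ((2 * n + 2 : ℕ) : ℤ) + 1 + i := by push_cast; omega
    have h1 := finProd_mul_invQ ha
    have h2 := finProd_mul_invQ hc
    rw [tripleCoeff]
    set a := (((2 * n + 2 : ℕ) : ℤ) - i).toNat with hadef
    set c := (((2 * n + 2 : ℕ) : ℤ) + 1 + i).toNat with hcdef
    have d1 := (X_pow_dvd_finProd_sub (1 : ℚ) (show n ≤ a by omega))
    have d2 := (X_pow_dvd_finProd_sub (1 : ℚ) (show n ≤ c by omega))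
    have d3 := (X_pow_dvd_finProd_sub (1 : ℚ) (show n ≤ 2 * (2 * n + 2) + 1 by omega))
    have d4 := X_pow_dvd_infProd_sub (1 : ℚ) n
    have d5 := dvd_sub d4 d1
    have d6 := dvd_sub d3 d2
    rw [sub_sub_sub_cancel_right] at d5 d6
    set ia := invQ (((2 * n + 2 : ℕ) : ℤ) - i)
    set ic := invQ (((2 * n + 2 : ℕ) : ℤ) + 1 + i)
    set e := C ((-1 : ℚ) ^ i) * (X : ℚ⟦X⟧) ^ tri i
    have key : infProd 1 * (e * finProd 1 (2 * (2 * n + 2) + 1) * ia * ic) - e =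
        (infProd 1 - finProd 1 a) * (e * finProd 1 (2 * (2 * n + 2) + 1) * ia * ic) +
        (finProd 1 (2 * (2 * n + 2) + 1) - finProd 1 c) * (e * ic) := by
      linear_combination (e * finProd 1 (2 * (2 * n + 2) + 1) * ic) * h1 + e * h2
    rw [key]
    exact dvd_add (d5.mul_right _) (d6.mul_right _)

/-- The Jacobi triple product. -/
theorem thetaOne_eq : thetaOne =
    C (LaurentPolynomial.T 1 - LaurentPolynomial.T (-1)) *
      (infProd (LaurentPolynomial.T 2) * infProd (LaurentPolynomial.T (-2))) *
      eulerProduct HalfLaurent := by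
  have hE : eulerProduct HalfLaurent = PowerSeries.map LaurentPolynomial.C (infProd (1 : ℚ)) := by
    rw [map_infProd, map_one, eulerProduct_eq_infProd]
  refine row_ext fun j => (eq_of_forall_X_pow_dvd_sub fun n => ?_).symm
  -- The finite product with 2n + 2 factors of each kind stands between the infinite product and the
  -- theta sum.
  have h1 : (X : ℚ⟦X⟧) ^ (n + 1) ∣
      row j (C (LaurentPolynomial.T 1 - LaurentPolynomial.T (-1)) *
      (infProd (LaurentPolynomial.T 2) * infProd (LaurentPolynomial.T (-2))) *
      eulerProduct HalfLaurent) - row j (finTriple (2 * n + 2) * eulerProduct HalfLaurent) := by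
    rw [← map_sub]
    refine X_pow_dvd_row j ?_
    have d : ∀ a : HalfLaurent, X ^ (n + 1) ∣ infProd a - finProd a (2 * n + 2) := fun a =>
      (pow_dvd_pow _ (by omega)).trans (X_pow_dvd_infProd_sub a (2 * n + 2))
    have key : ∀ c p p' r r' e : HalfLaurent⟦X⟧, c * (p * r) * e - c * (p' * r') * e =
        (p - p') * (c * r * e) + (r - r') * (c * p' * e) := by intros; ring
    rw [finTriple, key]
    exact dvd_add ((d _).mul_right _) ((d _).mul_right _)
  have h2 : (X : ℚ⟦X⟧) ^ (n + 1) ∣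
      row j (finTriple (2 * n + 2) * eulerProduct HalfLaurent) - row j thetaOne := by
    rw [mul_comm, hE, row_map_mul]
    rcases Int.even_or_odd' j with ⟨i, rfl | rfl⟩
    · rw [(row_finTriple _ i).2, (row_thetaOne i).2]; simp
    · rw [(row_finTriple _ i).1, (row_thetaOne i).1]
      exact X_pow_dvd_tripleCoeff i n
  have := dvd_add h1 h2
  rwa [sub_add_sub_cancel] at this

/-! ### Theta series -/

section ThetaSeries

variable {A : Type*} [CommRing A] {ι κ : Type*}

/-- `∑_i w_i q^{N_i}` for a family of exponents with finite fibres. -/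
def thetaSer (N : ι → ℕ) (h : ∀ n, {i | N i = n}.Finite) (w : ι → A) : A⟦X⟧ :=
  PowerSeries.mk fun n => ∑ i ∈ (h n).toFinset, w i

theorem thetaSer_congr {N N' : ι → ℕ} {h : ∀ n, {i | N i = n}.Finite}
    {h' : ∀ n, {i | N' i = n}.Finite} {w w' : ι → A} (hN : ∀ i, N i = N' i)
    (hw : ∀ i, w i = w' i) : thetaSer N h w = thetaSer N' h' w' := by
  obtain rfl : N = N' := funext hN
  obtain rfl : w = w' := funext hw
  rfl

theorem finite_fibre_add {N : ι → ℕ} {N' : κ → ℕ} (h : ∀ n, {i | N i = n}.Finite)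
    (h' : ∀ n, {i | N' i = n}.Finite) (n : ℕ) :
    {p : ι × κ | N p.1 + N' p.2 = n}.Finite := by
  refine (((Set.finite_Iic n).biUnion fun a _ => h a).prod
    ((Set.finite_Iic n).biUnion fun a _ => h' a)).subset ?_
  rintro ⟨i, j⟩ hp
  have hp' : N i + N' j = n := hp
  simp only [Set.mem_prod, Set.mem_iUnion, Set.mem_Iic, Set.mem_ofPred_eq]
  exact ⟨⟨N i, by omega, rfl⟩, ⟨N' j, by omega, rfl⟩⟩

theorem thetaSer_mul {N : ι → ℕ} {N' : κ → ℕ} (h : ∀ n, {i | N i = n}.Finite)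
    (h' : ∀ n, {i | N' i = n}.Finite) (w : ι → A) (w' : κ → A) :
    thetaSer N h w * thetaSer N' h' w' =
      thetaSer (fun p : ι × κ => N p.1 + N' p.2) (finite_fibre_add h h')
        (fun p => w p.1 * w' p.2) := by
  classical
  ext n
  rw [coeff_mul]
  simp only [thetaSer, coeff_mk]
  rw [← Finset.sum_fiberwise_of_maps_to (s := (finite_fibre_add h h' n).toFinset)
    (t := antidiagonal n) (g := fun p => (N p.1, N' p.2))]
  · refine Finset.sum_congr rfl fun ab hab => ?_
    rw [Finset.sum_mul_sum, ← Finset.sum_product']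
    refine Finset.sum_congr ?_ fun _ _ => rfl
    ext ⟨i, j⟩
    simp only [mem_product, Set.Finite.mem_toFinset, Set.mem_ofPred_eq, mem_filter, Prod.ext_iff]
    rw [HasAntidiagonal.mem_antidiagonal] at hab
    constructor
    · rintro ⟨h1, h2⟩; exact ⟨by omega, h1, h2⟩
    · rintro ⟨_, h1, h2⟩; exact ⟨h1, h2⟩
  · intro p hp
    rw [HasAntidiagonal.mem_antidiagonal]
    simpa using hp

theorem thetaSer_reindex {N : ι → ℕ} (h : ∀ n, {i | N i = n}.Finite) (w : ι → A) (e : κ ≃ ι)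
    (h' : ∀ n, {i | N (e i) = n}.Finite) :
    thetaSer N h w = thetaSer (fun i => N (e i)) h' (fun i => w (e i)) := by
  ext n
  simp only [thetaSer, coeff_mk]
  refine Finset.sum_equiv e.symm ?_ ?_
  · intro i; simp
  · intro i _; simp

theorem thetaSer_sum {N : ι ⊕ κ → ℕ} (h : ∀ n, {i | N i = n}.Finite) (w : ι ⊕ κ → A)
    (h1 : ∀ n, {i | N (Sum.inl i) = n}.Finite) (h2 : ∀ n, {i | N (Sum.inr i) = n}.Finite) :
    thetaSer N h w = thetaSer (fun i => N (Sum.inl i)) h1 (fun i => w (Sum.inl i)) +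
      thetaSer (fun i => N (Sum.inr i)) h2 (fun i => w (Sum.inr i)) := by
  ext n
  rw [map_add]
  simp only [thetaSer, coeff_mk]
  rw [← Finset.sum_disjSum]
  refine Finset.sum_congr ?_ fun _ _ => rfl
  ext i
  rcases i with i | i <;> simp

theorem thetaSer_neg {N : ι → ℕ} (h : ∀ n, {i | N i = n}.Finite) (w : ι → A) :
    thetaSer N h (fun i => -(w i)) = -thetaSer N h w := by
  ext n
  simp [thetaSer]

theorem map_thetaSer {B : Type*} [CommRing B] (φ : A →+* B) {N : ι → ℕ}
    (h : ∀ n, {i | N i = n}.Finite) (w : ι → A) :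
    PowerSeries.map φ (thetaSer N h w) = thetaSer N h (fun i => φ (w i)) := by
  ext n
  simp [thetaSer]

/-- The exponential series `e^{cz}`. -/
def expo (c : ℚ) : ℚ⟦X⟧ := rescale c (PowerSeries.exp ℚ)

theorem coeff_expo (c : ℚ) (k : ℕ) : coeff k (expo c) = c ^ k / k.factorial := by
  simp [expo, coeff_rescale, coeff_exp, div_eq_mul_inv]

theorem expo_mul (c d : ℚ) : expo c * expo d = expo (c + d) := exp_mul_exp_eq_exp_add c d

theorem expo_zero : expo 0 = 1 := by simp [expo]

theorem constantCoeff_expo (c : ℚ) : constantCoeff (expo c) = 1 := by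
  rw [← coeff_zero_eq_constantCoeff_apply, coeff_expo]; simp

theorem dX_expo (c : ℚ) : dX (expo c) = C c * expo c := by
  ext k
  rw [coeff_dX, coeff_C_mul, coeff_expo, coeff_expo, Nat.factorial_succ]
  have : ((k : ℚ) + 1) ≠ 0 := by positivity
  push_cast
  field_simp
  ring

/-- Theta series with quadratic exponents satisfy a heat equation. -/
theorem heat_thetaSer {N : ι → ℕ} (h : ∀ n, {i | N i = n}.Finite) (ε c : ι → ℚ) (a b : ℚ)
    (hc : ∀ i, c i ^ 2 = a * N i + b) :
    coeffDer dX (coeffDer dX (thetaSer N h fun i => C (ε i) * expo (c i))) =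
      a • eulerDer (thetaSer N h fun i => C (ε i) * expo (c i)) +
        b • thetaSer N h fun i => C (ε i) * expo (c i) := by
  ext1 n
  rw [coeff_coeffDer, coeff_coeffDer, map_add, coeff_smul, coeff_smul, coeff_eulerDer]
  simp only [thetaSer, coeff_mk, map_sum, Finset.mul_sum, Finset.smul_sum]
  rw [← Finset.sum_add_distrib]
  refine Finset.sum_congr rfl fun i hi => ?_
  have hi' : N i = n := by simpa using hi
  have hd : ∀ r : ℚ, dX (C r * expo (c i)) = C (c i * r) * expo (c i) := by
    intro r
    rw [Derivation.leibniz, dX_C, dX_expo]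
    simp only [smul_eq_mul, map_mul]
    ring
  rw [hd, hd, ← mul_assoc, ← sq, hc, hi', map_mul, map_add, smul_eq_C_mul, smul_eq_C_mul, map_mul,
    map_natCast]
  ring

end ThetaSeries

/-! ### The substitution `p = e^z` as a ring homomorphism -/

/-- `zExpansion` as a ring homomorphism. -/
def zHom : HalfLaurent⟦X⟧ →+* ℚ⟦X⟧⟦X⟧ := swapHom.comp (PowerSeries.map substExp)

theorem zExpansion_eq_zHom (f : HalfLaurent⟦X⟧) : zExpansion f = zHom f := by
  ext k n
  simp [zHom, zExpansion, swapHom]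

theorem coeff_coeff_zHom (f : HalfLaurent⟦X⟧) (k n : ℕ) :
    coeff n (coeff k (zHom f)) = coeff k (substExp (coeff n f)) := by
  simp [zHom, swapHom]

theorem substExp_C (r : ℚ) : substExp (LaurentPolynomial.C r) = C r := by
  simp [substExp]

theorem expHalf_zpow (n : ℤ) : ((expHalf ^ n : ℚ⟦X⟧ˣ) : ℚ⟦X⟧) = expo (n / 2) := by
  have hnat : ∀ (c : ℚ) (k : ℕ), expo c ^ k = expo (k * c) := by
    intro c k
    induction k with
    | zero => simp [expo_zero]
    | succ k ih => rw [pow_succ, ih, expo_mul]; push_cast; ring_nf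
  have h1 : (expHalf : ℚ⟦X⟧) = expo (1 / 2) := rfl
  have h2 : ((expHalf⁻¹ : ℚ⟦X⟧ˣ) : ℚ⟦X⟧) = expo (-(1 / 2)) := rfl
  rcases Int.eq_nat_or_neg n with ⟨k, rfl | rfl⟩
  · rw [zpow_natCast, Units.val_pow_eq_pow_val, h1, hnat]
    push_cast; ring_nf
  · rw [zpow_neg, zpow_natCast, ← inv_pow, Units.val_pow_eq_pow_val, h2, hnat]
    push_cast; ring_nf

theorem substExp_T (n : ℤ) : substExp (LaurentPolynomial.T n) = expo (n / 2) := by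
  rw [← expHalf_zpow]
  simp [substExp]

/-- `q d/dq` on power series in `z` with coefficients in `ℚ⟦q⟧`. -/
def DV : Derivation ℚ ℚ⟦X⟧⟦X⟧ ℚ⟦X⟧⟦X⟧ := coeffDer eulerDer

theorem DV_zHom (f : HalfLaurent⟦X⟧) : DV (zHom f) = zHom (Dtau f) := by
  ext k n
  rw [DV, coeff_coeffDer, coeff_eulerDer, coeff_coeff_zHom, coeff_coeff_zHom, coeff_Dtau, map_mul,
    map_natCast, ← map_natCast (C (R := ℚ)), coeff_C_mul]

theorem DV_C (f : ℚ⟦X⟧) : DV (C f) = C (eulerDer f) := coeffDer_C _ _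

theorem dX_DV (f : ℚ⟦X⟧⟦X⟧) : dX (DV f) = DV (dX f) := dX_coeffDer _ _

theorem zHom_map_C (e : ℚ⟦X⟧) : zHom (PowerSeries.map LaurentPolynomial.C e) = C e := by
  rw [← swapHom_map_C, zHom, RingHom.comp_apply]
  congr 1
  ext1 n
  simp [substExp_C]

theorem zHom_C (c : HalfLaurent) : zHom (C c) = PowerSeries.map C (substExp c) := by
  rw [zHom, RingHom.comp_apply, map_C, swapHom_C]

/-- The constant term in `z`. -/
theorem constantCoeff_zHom (f : HalfLaurent⟦X⟧) :
    constantCoeff (zHom f) = PowerSeries.map (constantCoeff.comp substExp) f := by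
  ext n
  rw [← coeff_zero_eq_constantCoeff_apply, coeff_coeff_zHom]
  simp

/-! ### The series `Θ` in the variable `z` -/

/-- `Θ` as a power series in `z`. -/
def Th : ℚ⟦X⟧⟦X⟧ := zHom Theta

/-- `∏ (1 - q^n)`. -/
def eul : ℚ⟦X⟧ := infProd 1

theorem constantCoeff_eul : constantCoeff eul = 1 := constantCoeff_infProd 1

theorem eul_ne_zero : eul ≠ 0 := by
  intro h
  have := constantCoeff_eul
  rw [h, map_zero] at this
  exact zero_ne_one this

theorem eulerProduct_eq_map_eul :
    eulerProduct HalfLaurent = PowerSeries.map LaurentPolynomial.C eul := by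
  rw [eul, map_infProd, map_one, eulerProduct_eq_infProd]

theorem Theta_mul_eulerProduct_pow_three : Theta * eulerProduct HalfLaurent ^ 3 = thetaOne := by
  rw [Theta, mul_assoc, mul_comm (invOfUnit _ _), mul_invOfUnit, mul_one]
  simp [constantCoeff_eulerProduct]

theorem eulerProduct_ne_zero : eulerProduct HalfLaurent ≠ 0 := by
  intro h
  have := constantCoeff_eulerProduct HalfLaurent
  rw [h, map_zero] at this
  exact zero_ne_one this

/-- The product formula for `Θ`. -/
theorem Theta_mul_eulerProduct_sq : Theta * eulerProduct HalfLaurent ^ 2 =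
    C (LaurentPolynomial.T 1 - LaurentPolynomial.T (-1)) *
      (infProd (LaurentPolynomial.T 2) * infProd (LaurentPolynomial.T (-2))) := by
  refine mul_right_cancel₀ eulerProduct_ne_zero ?_
  rw [← thetaOne_eq, ← Theta_mul_eulerProduct_pow_three]
  ring

/-- The logarithmic derivative of `Θ`. -/
def logDerTheta : HalfLaurent⟦X⟧ :=
  lambertSeries 1 + lambertSeries 1 - lambertSeries (LaurentPolynomial.T 2) -
    lambertSeries (LaurentPolynomial.T (-2))

theorem Dtau_C {A : Type*} [CommRing A] (a : A) : Dtau (C a) = 0 := by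
  simp [Dtau]

/-- In the product formula the factor s − s⁻¹ is constant in q, and the two factors ∏(1 − q^i) on
the left contribute the two copies of `lambertSeries 1`. -/
theorem Dtau_Theta : Dtau Theta = logDerTheta * Theta := by
  have h := congrArg Dtau Theta_mul_eulerProduct_sq
  rw [Dtau_mul, Dtau_mul, Dtau_mul, Dtau_C, pow_two, Dtau_mul, Dtau_infProd, Dtau_infProd,
    eulerProduct_eq_infProd, Dtau_infProd, ← eulerProduct_eq_infProd] at h
  refine mul_right_cancel₀ (pow_ne_zero 2 eulerProduct_ne_zero) ?_
  rw [logDerTheta]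
  linear_combination h + (lambertSeries (LaurentPolynomial.T 2) +
    lambertSeries (LaurentPolynomial.T (-2))) * Theta_mul_eulerProduct_sq

/-- `L = D_τ Θ / Θ` in the variable `z`. -/
def Lz : ℚ⟦X⟧⟦X⟧ := zHom logDerTheta

theorem DV_Th : DV Th = Lz * Th := by
  rw [Th, DV_zHom, Dtau_Theta, map_mul, Lz]

/-- Under p = e^z the sum p^d + p^{−d} has z^k coefficient (1 + (−1)^k) d^k/k!. -/
theorem coeff_coeff_Lz (k n : ℕ) : coeff n (coeff k Lz) =
    2 * (∑ d ∈ n.divisors, ((n / d : ℕ) : ℚ)) * (if k = 0 then 1 else 0) -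
      (∑ d ∈ n.divisors, ((n / d : ℕ) : ℚ) * (d : ℚ) ^ k) * (1 + (-1) ^ k) / k.factorial := by
  rw [Lz, coeff_coeff_zHom, logDerTheta]
  have hT : ∀ (e : ℤ) (d : ℕ), (LaurentPolynomial.T e : HalfLaurent) ^ d =
      LaurentPolynomial.T (d * e) := fun e d => LaurentPolynomial.T_pow e d
  simp only [lambertSeries, map_sub, map_add, coeff_mk, map_mul, map_sum, map_natCast, one_pow, mul_one, hT, substExp_T]
  have hn : ∀ (m : ℕ) (f : ℚ⟦X⟧), coeff k ((m : ℚ⟦X⟧) * f) = m * coeff k f := by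
    intro m f
    rw [← map_natCast (C (R := ℚ)), coeff_C_mul]
  have hn' : ∀ (m : ℕ), coeff k (m : ℚ⟦X⟧) = m * (if k = 0 then 1 else 0) := by
    intro m
    rw [← mul_one (m : ℚ⟦X⟧), hn, coeff_one]
  simp only [hn, hn', coeff_expo]
  rw [← two_mul, mul_assoc, Finset.sum_mul, sub_sub, ← Finset.sum_add_distrib, mul_div_assoc, Finset.sum_mul]
  congr 1
  refine Finset.sum_congr rfl fun d _ => ?_
  push_cast
  rw [show (d : ℚ) * 2 / 2 = d by ring, show (d : ℚ) * -2 / 2 = -1 * d by ring, mul_pow]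
  ring

/-- Since n d^{k−1} = (n/d) d^k, the divisor sums in the logarithmic derivative of Θ are exactly
those of D G_k. -/
theorem coeff_eulerDer_G (k n : ℕ) (hk : 0 < k) :
    coeff n (eulerDer (G k)) = ∑ d ∈ n.divisors, ((n / d : ℕ) : ℚ) * (d : ℚ) ^ k := by
  rw [coeff_eulerDer, G, coeff_mk]
  split_ifs with h
  · subst h; simp
  · rw [Finset.mul_sum]
    refine Finset.sum_congr rfl fun d hd => ?_
    have hd0 : (d : ℚ) ≠ 0 := by
      exact_mod_cast (Nat.pos_of_mem_divisors hd).ne'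
    rw [Nat.cast_div (Nat.dvd_of_mem_divisors hd) hd0]
    obtain ⟨j, rfl⟩ : ∃ j, k = j + 1 := ⟨k - 1, by omega⟩
    rw [Nat.add_sub_cancel, pow_succ]
    field_simp

theorem coeff_Lz_even (k : ℕ) (hk : 0 < k) (he : Even k) :
    coeff k Lz = (-(2 : ℚ) / k.factorial) • eulerDer (G k) := by
  ext n
  rw [coeff_coeff_Lz, coeff_smul, coeff_eulerDer_G k n hk, if_neg (by omega), he.neg_one_pow,
    smul_eq_mul]
  ring

theorem coeff_Lz_odd (k : ℕ) (ho : Odd k) : coeff k Lz = 0 := by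
  ext n
  rw [coeff_coeff_Lz, if_neg (by rintro rfl; simp at ho), ho.neg_one_pow, map_zero]
  ring

theorem coeff_zero_Lz : coeff 0 Lz = 0 := by
  ext n
  rw [coeff_coeff_Lz, map_zero]
  simp
  ring

theorem G_two_eq : G 2 = C (-(1 / 24) : ℚ) + lambertSeries 1 := by
  ext n
  rw [G, coeff_mk, map_add, lambertSeries, coeff_mk, coeff_C]
  split_ifs with h
  · subst h; norm_num [bernoulli_two]
  · simp only [one_pow, mul_one, zero_add]
    rw [← Nat.sum_div_divisors n (fun d => (d : ℚ) ^ (2 - 1))]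
    simp

/-! #### The heat equation -/

theorem finite_fibre_tri (n : ℕ) : {i : ℤ | tri i = n}.Finite := by
  refine (Set.finite_Icc (-((n : ℤ) + 1)) n).subset ?_
  intro i hi
  have hi' : tri i = n := hi
  have := two_mul_tri i
  rw [hi'] at this
  exact ⟨by nlinarith, by nlinarith⟩

theorem map_substExp_thetaOne : PowerSeries.map substExp thetaOne =
    thetaSer tri finite_fibre_tri (fun i : ℤ => C ((-1 : ℚ) ^ i) * expo (i + 1 / 2)) := by
  ext1 n
  rw [coeff_map, thetaOne, coeff_mk, thetaSer, coeff_mk, map_sum]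
  refine Finset.sum_congr ?_ fun i _ => ?_
  · ext i
    have := two_mul_tri i
    simp only [mem_filter, Finset.mem_Icc, Set.Finite.mem_toFinset, Set.mem_ofPred_eq]
    constructor
    · rintro ⟨_, h⟩; omega
    · rintro rfl
      exact ⟨⟨by nlinarith, by nlinarith⟩, this.symm⟩
  · rw [map_mul, substExp_C, substExp_T]
    push_cast
    ring_nf

theorem dX_swapHom_heat {ι : Type*} {N : ι → ℕ} (h : ∀ n, {i | N i = n}.Finite) (ε c : ι → ℚ)
    (a b : ℚ) (hc : ∀ i, c i ^ 2 = a * N i + b) :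
    dX (dX (swapHom (thetaSer N h fun i => C (ε i) * expo (c i)))) =
      a • DV (swapHom (thetaSer N h fun i => C (ε i) * expo (c i))) +
        b • swapHom (thetaSer N h fun i => C (ε i) * expo (c i)) := by
  have hs : ∀ (r : ℚ) (f : ℚ⟦X⟧⟦X⟧), swapHom (r • f) = r • swapHom f := by
    intro r f
    ext k n
    simp [coeff_coeff_swapHom]
  rw [← swapHom_coeffDer_dX, ← swapHom_coeffDer_dX, heat_thetaSer h ε c a b hc, map_add, hs, hs,
    swapHom_eulerDer, DV]

theorem zHom_thetaOne : zHom thetaOne = Th * C eul ^ 3 := by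
  rw [← Theta_mul_eulerProduct_pow_three, map_mul, map_pow, eulerProduct_eq_map_eul, zHom_map_C, Th]

theorem eulerDer_eul : eulerDer eul = -(lambertSeries 1) * eul := Dtau_infProd 1

theorem C_eul_ne_zero : (C eul : ℚ⟦X⟧⟦X⟧) ≠ 0 := by
  rw [Ne, ← map_zero C, C_injective.eq_iff]
  exact eul_ne_zero

/-- The heat equation for `Θ`. -/
theorem heat_Th : 2 * DV Th = dX (dX Th) + 6 * C (G 2) * Th := by
  -- The exponents satisfy (i + 1/2)² = 2·(i(i+1)/2) + 1/4.
  have h : dX (dX (zHom thetaOne)) = (2 : ℚ) • DV (zHom thetaOne) + (1 / 4 : ℚ) • zHom thetaOne := by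
    rw [zHom, RingHom.comp_apply, map_substExp_thetaOne]
    refine dX_swapHom_heat _ _ _ _ _ fun i => ?_
    have : (2 * (tri i : ℤ) : ℚ) = i * (i + 1) := by exact_mod_cast two_mul_tri i
    push_cast at this
    linear_combination -this
  have hd : ∀ f : ℚ⟦X⟧⟦X⟧, dX (f * C eul ^ 3) = dX f * C eul ^ 3 := by
    intro f
    rw [← map_pow, Derivation.leibniz, dX_C, smul_zero, zero_add, smul_eq_mul, mul_comm]
  -- Dividing by ∏(1 − q^n)³ adds 6·`lambertSeries 1`, which joins the −1/4 to form 6 G₂.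
  have hD : DV (C eul ^ 3 : ℚ⟦X⟧⟦X⟧) = -3 * C (lambertSeries 1) * C eul ^ 3 := by
    rw [Derivation.leibniz_pow, DV_C, eulerDer_eul]
    simp only [map_mul, map_neg, smul_eq_mul, nsmul_eq_mul]
    push_cast
    ring
  rw [zHom_thetaOne, hd, hd, Derivation.leibniz, hD] at h
  refine mul_right_cancel₀ (pow_ne_zero 3 C_eul_ne_zero) ?_
  rw [G_two_eq]
  have h4 : ∀ (f : ℚ⟦X⟧⟦X⟧), (1 / 4 : ℚ) • f = C (C (1 / 4 : ℚ)) * f := by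
    intro f; ext k n; simp
  have h2 : ∀ (f : ℚ⟦X⟧⟦X⟧), (2 : ℚ) • f = 2 * f := by
    intro f; rw [two_smul, two_mul]
  rw [h4, h2] at h
  have h6 : (C (C (-(1 / 24) : ℚ)) * 6 : ℚ⟦X⟧⟦X⟧) = - C (C (1 / 4 : ℚ)) := by
    rw [show (6 : ℚ⟦X⟧⟦X⟧) = C (C (6 : ℚ)) by rw [map_ofNat, map_ofNat], ← map_mul, ← map_mul, ← map_neg, ← map_neg]
    norm_num
  simp only [smul_eq_mul] at h
  rw [map_add]
  linear_combination -h + (Th * C eul ^ 3) * (-h6)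

/-- The recursion for the coefficients of `Θ` given by the heat equation. -/
theorem coeff_Th_add_two (k : ℕ) : (((k : ℚ) + 1) * ((k : ℚ) + 2)) • coeff (k + 2) Th =
    (2 : ℚ) • eulerDer (coeff k Th) - (6 : ℚ) • (G 2 * coeff k Th) := by
  have h := congrArg (coeff k) heat_Th
  rw [map_add, coeff_dX, coeff_dX, show (2 * DV Th) = C (2 : ℚ⟦X⟧) * DV Th by rw [map_ofNat], coeff_C_mul,
    show 6 * C (G 2) * Th = C (6 * G 2) * Th by rw [map_mul, map_ofNat], coeff_C_mul, DV, coeff_coeffDer] at h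
  have e : ∀ (r : ℚ) (f : ℚ⟦X⟧), r • f = C r * f := fun r f => smul_eq_C_mul _ _
  simp only [e, map_mul, map_add, map_one, map_natCast, map_ofNat]
  push_cast at h ⊢
  linear_combination -h

theorem Th_mul_eul_sq : Th * C eul ^ 2 = PowerSeries.map C (expo (1 / 2) - expo (-(1 / 2))) *
    zHom (infProd (LaurentPolynomial.T 2) * infProd (LaurentPolynomial.T (-2))) := by
  have h := congrArg zHom Theta_mul_eulerProduct_sq
  rw [map_mul, map_pow, eulerProduct_eq_map_eul, zHom_map_C, map_mul _ (C _), zHom_C, map_sub,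
    substExp_T, substExp_T] at h
  rw [Th, h]
  norm_num

/-! ### Leading coefficients and parity of Θ in z -/

theorem coeff_zero_Th : coeff 0 Th = 0 := by
  have h := congrArg constantCoeff Th_mul_eul_sq
  rw [map_mul, map_mul, map_pow, constantCoeff_C] at h
  have : constantCoeff (PowerSeries.map C (expo (1 / 2) - expo (-(1 / 2))) : ℚ⟦X⟧⟦X⟧) = 0 := by
    rw [← coeff_zero_eq_constantCoeff_apply, coeff_map, map_sub, coeff_expo, coeff_expo]; simp
  rw [this, zero_mul] at h
  rw [coeff_zero_eq_constantCoeff_apply]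
  exact (mul_eq_zero.1 h).resolve_right (pow_ne_zero _ eul_ne_zero)

/-- e^{z/2} − e^{−z/2} starts with z, and at p = 1 the two remaining products become ∏(1 − q^n)²,
cancelling the denominator. -/
theorem coeff_one_Th : coeff 1 Th = 1 := by
  have h := congrArg (coeff 1) Th_mul_eul_sq
  have h1 : constantCoeff
      (zHom (infProd (LaurentPolynomial.T 2) * infProd (LaurentPolynomial.T (-2)))) = eul ^ 2 := by
    rw [constantCoeff_zHom, map_mul, map_infProd, map_infProd, RingHom.comp_apply,
      RingHom.comp_apply, substExp_T, substExp_T, constantCoeff_expo, constantCoeff_expo, eul, sq]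
  have h2 : coeff 0 (PowerSeries.map C (expo (1 / 2) - expo (-(1 / 2))) : ℚ⟦X⟧⟦X⟧) = 0 := by
    rw [coeff_map, map_sub, coeff_expo, coeff_expo]; simp
  have h3 : coeff 1 (PowerSeries.map C (expo (1 / 2) - expo (-(1 / 2))) : ℚ⟦X⟧⟦X⟧) = 1 := by
    rw [coeff_map, map_sub, coeff_expo, coeff_expo]; norm_num
  rw [← map_pow, coeff_mul_C, coeff_mul,
    Nat.sum_antidiagonal_eq_sum_range_succ_mk, Finset.sum_range_succ, Finset.sum_range_one] at h
  simp only [Nat.sub_zero, Nat.sub_self] at h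
  rw [h2, h3, coeff_zero_eq_constantCoeff_apply, h1, zero_mul, zero_add, one_mul] at h
  exact mul_right_cancel₀ (pow_ne_zero 2 eul_ne_zero) (by rw [h, one_mul])

theorem coeff_even_Th (k : ℕ) (hk : Even k) : coeff k Th = 0 := by
  obtain ⟨j, rfl⟩ := hk
  induction j with
  | zero => exact coeff_zero_Th
  | succ j ih =>
    have h := coeff_Th_add_two (j + j)
    rw [ih, map_zero, mul_zero, smul_zero, smul_zero, sub_zero] at h
    rw [show j + 1 + (j + 1) = j + j + 2 by ring]
    exact (smul_eq_zero.1 h).resolve_left (by positivity)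

theorem Th_ne_zero : Th ≠ 0 := by
  intro h
  have := coeff_one_Th
  rw [h, map_zero] at this
  exact zero_ne_one this

/-- `F` as a power series in `z`. -/
def Fz : ℚ⟦X⟧⟦X⟧ := zHom F

theorem Fz_mul_Th : Fz * Th = DV (DV Th) := by
  rw [Fz, Th, ← map_mul, F_mul_Theta, DV_zHom, DV_zHom]

/-! ### `Θ²` lies in a module of rank two which is stable under the heat operator -/

theorem finite_fibre_two_mul_tri (n : ℕ) : {i : ℤ | 2 * tri i = n}.Finite :=
  (finite_fibre_tri (n / 2)).subset fun i (hi : 2 * tri i = n) => show tri i = n / 2 by omega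

theorem finite_fibre_natAbs_sq (n : ℕ) : {i : ℤ | i.natAbs ^ 2 = n}.Finite := by
  refine (Set.finite_Icc (-(n : ℤ)) n).subset ?_
  intro i (hi : i.natAbs ^ 2 = n)
  have : i.natAbs ≤ n := by rw [← hi]; exact Nat.le_self_pow (by norm_num) _
  exact ⟨by omega, by omega⟩

/-- The theta series over odd integers. -/
def thetaOdd : ℚ⟦X⟧⟦X⟧ :=
  thetaSer (fun k : ℤ => 2 * tri k) finite_fibre_two_mul_tri
    (fun k : ℤ => C (1 : ℚ) * expo (2 * k + 1))

/-- The theta series over even integers. -/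
def thetaEven : ℚ⟦X⟧⟦X⟧ :=
  thetaSer (fun k : ℤ => k.natAbs ^ 2) finite_fibre_natAbs_sq (fun k : ℤ => C (1 : ℚ) * expo (2 * k))

/-- The change of summation variables `(i, j) ↦ (i + j + 1, i - j)`, according to parity. -/
def latticeEquiv : (ℤ × ℤ) ⊕ (ℤ × ℤ) ≃ ℤ × ℤ where
  toFun := Sum.elim (fun p => (p.1 + p.2, p.1 - p.2)) (fun p => (p.1 + p.2, p.1 - p.2 - 1))
  invFun p := if (p.1 - p.2) % 2 = 0 then Sum.inl ((p.1 + p.2) / 2, (p.1 - p.2) / 2)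
    else Sum.inr ((p.1 + p.2 + 1) / 2, (p.1 - p.2 - 1) / 2)
  left_inv p := by
    rcases p with ⟨k, l⟩ | ⟨k, l⟩
    · refine (if_pos (show (k + l - (k - l)) % 2 = 0 by omega)).trans ?_
      simp only [Sum.elim_inl, Sum.inl.injEq, Prod.mk.injEq]
      omega
    · refine (if_neg (show ¬(k + l - (k - l - 1)) % 2 = 0 by omega)).trans ?_
      simp only [Sum.elim_inr, Sum.inr.injEq, Prod.mk.injEq]
      omega
  right_inv p := by
    obtain ⟨i, j⟩ := p
    simp only
    split_ifs with h
    · simp only [Sum.elim_inl, Prod.mk.injEq]; omega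
    · simp only [Sum.elim_inr, Prod.mk.injEq]; omega

/-- Pairs (i, j) are split by the parity of i − j. In the new variables the q-exponent separates as
k(k+1) + l² or k² + l(l+1), while the z-exponent involves k only; so each half is a theta series in
z times a series in q. The sign (−1)^{i+j} is + on one half and − on the other. -/
theorem thetaOne_sq_aux : PowerSeries.map substExp thetaOne ^ 2 =
    thetaOdd * thetaSer (fun k : ℤ => k.natAbs ^ 2) finite_fibre_natAbs_sq (fun _ => 1) -
      thetaEven * thetaSer (fun k : ℤ => 2 * tri k) finite_fibre_two_mul_tri (fun _ => 1) := by
  have hfib := finite_fibre_add finite_fibre_tri finite_fibre_tri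
  have hfib' : ∀ n, {p : (ℤ × ℤ) ⊕ (ℤ × ℤ) | tri (latticeEquiv p).1 + tri (latticeEquiv p).2 =
      n}.Finite := fun n => (hfib n).preimage latticeEquiv.injective.injOn
  have sgn : ∀ a b : ℤ, (C ((-1 : ℚ) ^ a) * C ((-1 : ℚ) ^ b) : ℚ⟦X⟧) = C ((-1 : ℚ) ^ (a + b)) := by
    intro a b
    rw [← map_mul, zpow_add₀ (by norm_num)]
  rw [sq, map_substExp_thetaOne, thetaSer_mul,
    thetaSer_reindex (N := fun p : ℤ × ℤ => tri p.1 + tri p.2) _ _ latticeEquiv hfib',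
    thetaSer_sum (N := fun p => tri (latticeEquiv p).1 + tri (latticeEquiv p).2) _ _
      (fun n => (hfib' n).preimage Sum.inl_injective.injOn)
      (fun n => (hfib' n).preimage Sum.inr_injective.injOn), sub_eq_add_neg]
  congr 1
  · rw [thetaOdd, thetaSer_mul]
    refine thetaSer_congr ?_ ?_
    · rintro ⟨k, l⟩
      simp only [latticeEquiv, Equiv.coe_fn_mk, Sum.elim_inl]
      have h1 := two_mul_tri (k + l)
      have h2 := two_mul_tri (k - l)
      have h3 := two_mul_tri k
      zify
      rw [sq_abs]
      nlinarith
    · rintro ⟨k, l⟩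
      simp only [latticeEquiv, Equiv.coe_fn_mk, Sum.elim_inl]
      rw [mul_mul_mul_comm, sgn, expo_mul, mul_one, show k + l + (k - l) = 2 * k by ring,
        (even_two_mul k).neg_one_zpow]
      push_cast
      ring_nf
  · rw [thetaEven, thetaSer_mul, ← thetaSer_neg]
    refine thetaSer_congr ?_ ?_
    · rintro ⟨k, l⟩
      simp only [latticeEquiv, Equiv.coe_fn_mk, Sum.elim_inr]
      have h1 := two_mul_tri (k + l)
      have h2 := two_mul_tri (k - l - 1)
      have h3 := two_mul_tri l
      zify
      rw [sq_abs]
      nlinarith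
    · rintro ⟨k, l⟩
      simp only [latticeEquiv, Equiv.coe_fn_mk, Sum.elim_inr]
      rw [mul_mul_mul_comm, sgn, expo_mul, mul_one, show k + l + (k - l - 1) = 2 * k - 1 by ring,
        Odd.neg_one_zpow ⟨k - 1, by ring⟩]
      push_cast
      rw [map_neg]
      ring_nf

/-- `f` is a combination of the two theta series with coefficients in `ℚ⟦q⟧`. -/
def InThetaSpan (f : ℚ⟦X⟧⟦X⟧) : Prop :=
  ∃ c d : ℚ⟦X⟧, f = C c * swapHom thetaOdd + C d * swapHom thetaEven

/-- The heat operator. -/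
def heatOp (f : ℚ⟦X⟧⟦X⟧) : ℚ⟦X⟧⟦X⟧ := 4 * DV f - dX (dX f)

theorem ratSMul_eq (r : ℚ) (f : ℚ⟦X⟧⟦X⟧) : r • f = C (C r) * f := by
  ext k n; simp

theorem C_C_four : (C (C (4 : ℚ)) : ℚ⟦X⟧⟦X⟧) = 4 := by rw [map_ofNat, map_ofNat]

theorem heatOp_thetaOdd : heatOp (swapHom thetaOdd) = -swapHom thetaOdd := by
  rw [heatOp, thetaOdd, dX_swapHom_heat _ _ _ 4 1]
  · rw [ratSMul_eq, C_C_four, one_smul]; ring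
  · intro k
    have : (2 * (tri k : ℤ) : ℚ) = k * (k + 1) := by exact_mod_cast two_mul_tri k
    push_cast at this ⊢
    linear_combination -4 * this

theorem heatOp_thetaEven : heatOp (swapHom thetaEven) = 0 := by
  rw [heatOp, thetaEven, dX_swapHom_heat _ _ _ 4 0]
  · rw [ratSMul_eq, C_C_four, zero_smul]; ring
  · intro k
    have : ((k.natAbs ^ 2 : ℕ) : ℤ) = k ^ 2 := by push_cast; exact sq_abs k
    have h : ((k.natAbs ^ 2 : ℕ) : ℚ) = (k : ℚ) ^ 2 := by
      rw [← Int.cast_natCast, this, Int.cast_pow]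
    rw [h]; ring

theorem heatOp_C_mul (c : ℚ⟦X⟧) (f : ℚ⟦X⟧⟦X⟧) :
    heatOp (C c * f) = C (4 * eulerDer c) * f + C c * heatOp f := by
  simp only [heatOp, Derivation.leibniz, dX_C, DV_C, smul_eq_mul, mul_zero, add_zero,
    map_mul, map_ofNat]
  ring

theorem InThetaSpan.heatOp {f : ℚ⟦X⟧⟦X⟧} (h : InThetaSpan f) : InThetaSpan (heatOp f) := by
  obtain ⟨c, d, rfl⟩ := h
  refine ⟨4 * eulerDer c - c, 4 * eulerDer d, ?_⟩
  have : ∀ f g, KanekoZagierJacobi.heatOp (f + g) =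
      KanekoZagierJacobi.heatOp f + KanekoZagierJacobi.heatOp g := by
    intro f g; simp only [KanekoZagierJacobi.heatOp, map_add]; ring
  rw [this, heatOp_C_mul, heatOp_C_mul, heatOp_thetaOdd, heatOp_thetaEven, map_sub]
  ring

theorem InThetaSpan.add {f g : ℚ⟦X⟧⟦X⟧} (hf : InThetaSpan f) (hg : InThetaSpan g) :
    InThetaSpan (f + g) := by
  obtain ⟨c, d, rfl⟩ := hf
  obtain ⟨c', d', rfl⟩ := hg
  exact ⟨c + c', d + d', by simp only [map_add]; ring⟩

theorem InThetaSpan.C_mul {f : ℚ⟦X⟧⟦X⟧} (hf : InThetaSpan f) (e : ℚ⟦X⟧) :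
    InThetaSpan (C e * f) := by
  obtain ⟨c, d, rfl⟩ := hf
  exact ⟨e * c, e * d, by simp only [map_mul]; ring⟩

theorem inThetaSpan_Th_sq : InThetaSpan (Th ^ 2) := by
  have h : zHom thetaOne ^ 2 = swapHom (PowerSeries.map substExp thetaOne ^ 2) := by
    rw [map_pow]; rfl
  have hc : ∀ (N : ℤ → ℕ) (hN : ∀ n, {i | N i = n}.Finite),
      swapHom (thetaSer N hN fun _ => (1 : ℚ⟦X⟧)) = C (thetaSer N hN fun _ => (1 : ℚ)) := by
    intro N hN
    rw [← swapHom_map_C, map_thetaSer, map_one]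
  rw [thetaOne_sq_aux, map_sub, map_mul, map_mul, hc, hc, zHom_thetaOne] at h
  have hinv : (C eul * C eul⁻¹ : ℚ⟦X⟧⟦X⟧) = 1 := by
    rw [← map_mul, PowerSeries.mul_inv_cancel _ (by rw [constantCoeff_eul]; exact one_ne_zero),
      map_one]
  have h' : Th ^ 2 = C (eul⁻¹ ^ 6) * (Th * C eul ^ 3) ^ 2 := by
    rw [map_pow]
    have : (C eul⁻¹ ^ 6 * (Th * C eul ^ 3) ^ 2 : ℚ⟦X⟧⟦X⟧) =
      (C eul * C eul⁻¹) ^ 6 * Th ^ 2 := by ring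
    rw [this, hinv]; ring
  rw [h', h]
  refine InThetaSpan.C_mul ⟨thetaSer (fun k : ℤ => k.natAbs ^ 2) finite_fibre_natAbs_sq fun _ => 1,
    -thetaSer (fun k : ℤ => 2 * tri k) finite_fibre_two_mul_tri fun _ => 1, ?_⟩ _
  rw [map_neg]
  ring

/-- `P = Θ'² - Θ Θ''`. -/
def Pz : ℚ⟦X⟧⟦X⟧ := dX Th ^ 2 - Th * dX (dX Th)

theorem heatOp_Th_sq : heatOp (Th ^ 2) = 24 * C (G 2) * Th ^ 2 - 2 * Pz := by
  have h := heat_Th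
  simp only [heatOp, Pz, sq, Derivation.leibniz, smul_eq_mul, map_add]
  linear_combination (4 * Th) * h

/-- By `heatOp_Th_sq`, P is a combination of Θ² and its image under the heat operator, so it stays
in the stable module. -/
theorem inThetaSpan_Pz : InThetaSpan Pz := by
  have h : Pz = C (12 * G 2) * Th ^ 2 + C (C (-(1 / 2) : ℚ)) * heatOp (Th ^ 2) := by
    have hh : (C (C (-(1 / 2) : ℚ)) * 2 : ℚ⟦X⟧⟦X⟧) = -1 := by
      rw [show (2 : ℚ⟦X⟧⟦X⟧) = C (C (2 : ℚ)) by rw [map_ofNat, map_ofNat], ← map_mul, ← map_mul]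
      norm_num
    rw [heatOp_Th_sq, map_mul, map_ofNat]
    linear_combination (Pz - 12 * C (G 2) * Th ^ 2) * hh
  rw [h]
  exact (inThetaSpan_Th_sq.C_mul _).add (inThetaSpan_Th_sq.heatOp.C_mul _)

theorem constantCoeff_Th : constantCoeff Th = 0 := by
  rw [← coeff_zero_eq_constantCoeff_apply, coeff_zero_Th]

theorem constantCoeff_dX_Th : constantCoeff (dX Th) = 1 := by
  rw [← coeff_zero_eq_constantCoeff_apply, coeff_dX, zero_add, coeff_one_Th]; simp

theorem constantCoeff_dX_dX_Th : constantCoeff (dX (dX Th)) = 0 := by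
  rw [← coeff_zero_eq_constantCoeff_apply, coeff_dX, coeff_dX, coeff_even_Th _ (by decide)]; simp

theorem constantCoeff_Pz : constantCoeff Pz = 1 := by
  rw [Pz]
  simp [constantCoeff_Th, constantCoeff_dX_Th]

theorem dX_dX_Pz : dX (dX Pz) = dX (dX Th) ^ 2 - Th * dX (dX (dX (dX Th))) := by
  simp only [Pz, sq, Derivation.leibniz, smul_eq_mul, map_add, map_sub]
  ring

theorem constantCoeff_heatOp_Pz : constantCoeff (heatOp Pz) = 0 := by
  have h : constantCoeff (DV Pz) = 0 := by
    rw [← coeff_zero_eq_constantCoeff_apply, DV, coeff_coeffDer,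
      coeff_zero_eq_constantCoeff_apply, constantCoeff_Pz, Derivation.map_one_eq_zero]
  rw [heatOp, dX_dX_Pz]
  simp [h, constantCoeff_Th, constantCoeff_dX_dX_Th]

theorem coeff_two_Th_sq : coeff 2 (Th ^ 2) = 1 := by
  rw [sq, coeff_mul, Nat.sum_antidiagonal_eq_sum_range_succ_mk, Finset.sum_range_succ,
    Finset.sum_range_succ, Finset.sum_range_one]
  simp [coeff_zero_Th, coeff_one_Th]

/-- The invariant `u` with `4 D P - P'' = u Θ²`. -/
def uInv : ℚ⟦X⟧ := coeff 2 (heatOp Pz)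

/-- Θ², P and the heat operator applied to P are three elements of a rank two module, hence
dependent over ℚ⟦q⟧. At z = 0 they are 0, 1 and 0, so P drops out; the z² coefficient gives the
factor. -/
theorem heatOp_Pz : heatOp Pz = C uInv * Th ^ 2 := by
  obtain ⟨c1, c2, h1⟩ := inThetaSpan_Th_sq
  obtain ⟨c3, c4, h3⟩ := inThetaSpan_Pz
  obtain ⟨c5, c6, h5⟩ := inThetaSpan_Pz.heatOp
  -- The Cramer relation among three vectors in a plane.
  have hs : C (c3 * c6 - c4 * c5) * Th ^ 2 - C (c1 * c6 - c2 * c5) * Pz +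
      C (c1 * c4 - c2 * c3) * heatOp Pz = 0 := by
    rw [h5, h3, h1]
    simp only [map_sub, map_mul]
    ring
  have h0 : c1 * c6 - c2 * c5 = 0 := by
    have := congrArg constantCoeff hs
    simp only [map_add, map_sub, map_mul, map_pow, constantCoeff_C, constantCoeff_Th,
      constantCoeff_Pz, constantCoeff_heatOp_Pz, map_zero] at this
    linear_combination -this
  rw [h0, map_zero, zero_mul, sub_zero] at hs
  have h2 : (c3 * c6 - c4 * c5) + (c1 * c4 - c2 * c3) * uInv = 0 := by
    have := congrArg (coeff 2) hs
    rwa [map_add, coeff_C_mul, coeff_C_mul, coeff_two_Th_sq, mul_one, map_zero] at this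
  -- A zero determinant would make Θ² and P proportional; the constant terms 0 and 1 then force c1 =
  -- c2 = 0, that is Θ² = 0.
  have hne : c1 * c4 - c2 * c3 ≠ 0 := by
    intro hz
    have e1 : C c3 * Th ^ 2 - C c1 * Pz = 0 := by
      have : C c3 * Th ^ 2 - C c1 * Pz = C (-(c1 * c4 - c2 * c3)) * swapHom thetaEven := by
        rw [h3, h1]; simp only [map_sub, map_mul, map_neg]; ring
      rw [this, hz]; simp
    have e2 : C c4 * Th ^ 2 - C c2 * Pz = 0 := by
      have : C c4 * Th ^ 2 - C c2 * Pz = C (c1 * c4 - c2 * c3) * swapHom thetaOdd := by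
        rw [h3, h1]; simp only [map_sub, map_mul]; ring
      rw [this, hz]; simp
    have z1 : c1 = 0 := by
      have := congrArg constantCoeff e1
      simpa [constantCoeff_Th, constantCoeff_Pz] using this
    have z2 : c2 = 0 := by
      have := congrArg constantCoeff e2
      simpa [constantCoeff_Th, constantCoeff_Pz] using this
    rw [z1, z2] at h1
    simp at h1
    exact Th_ne_zero h1
  have hfin : C (c1 * c4 - c2 * c3) * (heatOp Pz - C uInv * Th ^ 2) = 0 := by
    have h2' := congrArg (C (R := ℚ⟦X⟧)) h2
    rw [map_add, map_mul _ _ uInv, map_zero] at h2'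
    linear_combination hs - Th ^ 2 * h2'
  refine sub_eq_zero.1 ((mul_eq_zero.1 hfin).resolve_left ?_)
  exact fun h => hne (C_injective (by rw [h, map_zero]))

/-- The bilinear differential equation satisfied by `Θ`. -/
theorem quartic_Th : 4 * dX Th * dX (dX (dX Th)) - 3 * dX (dX Th) ^ 2 -
    Th * dX (dX (dX (dX Th))) + 24 * C (G 2) * Pz = C uInv * Th ^ 2 := by
  rw [← heatOp_Pz, heatOp, dX_dX_Pz]
  have h := heat_Th
  have hC : ∀ f : ℚ⟦X⟧⟦X⟧, dX (6 * C (G 2) * f) = 6 * C (G 2) * dX f := by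
    intro f
    rw [show (6 * C (G 2) : ℚ⟦X⟧⟦X⟧) = C (6 * G 2) by rw [map_mul, map_ofNat], Derivation.leibniz,
      dX_C]
    simp
  have h2 : ∀ f : ℚ⟦X⟧⟦X⟧, dX (2 * f) = 2 * dX f := by
    intro f; rw [two_mul, map_add, two_mul]
  have h' := congrArg dX h
  rw [h2, map_add, hC, dX_DV] at h'
  have h'' := congrArg dX h'
  rw [h2, map_add, hC, dX_DV] at h''
  have e : DV Pz = 2 * dX Th * DV (dX Th) - DV Th * dX (dX Th) - Th * DV (dX (dX Th)) := by
    simp only [Pz, sq, Derivation.leibniz, smul_eq_mul, map_sub]; ring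
  rw [e, Pz]
  linear_combination (-4 * dX Th) * h' + 2 * dX (dX Th) * h + 2 * Th * h''

/-! ### Weights -/

section Grading

variable {A : Type*} [CommRing A] [Algebra ℚ A]

/-- A multiplicative family of subspaces. -/
structure IsGraded (W : ℤ → Submodule ℚ A) : Prop where
  one_mem : (1 : A) ∈ W 0
  mul_mem' : ∀ {v w : ℤ} {f g : A}, f ∈ W v → g ∈ W w → f * g ∈ W (v + w)

theorem IsGraded.mul_mem {W : ℤ → Submodule ℚ A} (hW : IsGraded W) {u v w : ℤ} {f g : A}
    (hf : f ∈ W v) (hg : g ∈ W w) (h : v + w = u) : f * g ∈ W u :=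
  h ▸ hW.mul_mem' hf hg

theorem IsGraded.pow_mem {W : ℤ → Submodule ℚ A} (hW : IsGraded W) {v : ℤ} {f : A}
    (hf : f ∈ W v) (n : ℕ) {u : ℤ} (h : n * v = u) : f ^ n ∈ W u := by
  subst h
  induction n with
  | zero => simpa using hW.one_mem
  | succ n ih => rw [pow_succ]; exact hW.mul_mem ih hf (by push_cast; ring)

theorem smul_natCast_eq (n : ℕ) (f : A) : (n : A) * f = (n : ℚ) • f := by
  rw [← map_natCast (algebraMap ℚ A), Algebra.smul_def]

theorem natCast_mul_mem {W : Submodule ℚ A} {f : A} (hf : f ∈ W) (n : ℕ) : (n : A) * f ∈ W := by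
  rw [smul_natCast_eq]
  exact W.smul_mem _ hf

theorem mem_of_natCast_mul_mem {W : Submodule ℚ A} {f : A} {n : ℕ} (hn : n ≠ 0)
    (hf : (n : A) * f ∈ W) : f ∈ W := by
  rw [smul_natCast_eq] at hf
  exact (W.smul_mem_iff (by exact_mod_cast hn)).1 hf

/-- The induced weights on power series, the variable having weight `-1`. -/
def seriesGrading (W : ℤ → Submodule ℚ A) (w : ℤ) : Submodule ℚ A⟦X⟧ where
  carrier := {f | ∀ k : ℕ, coeff k f ∈ W (w + k)}
  add_mem' hf hg k := by rw [map_add]; exact (W _).add_mem (hf k) (hg k)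
  zero_mem' k := by rw [map_zero]; exact (W _).zero_mem
  smul_mem' c f hf k := by rw [coeff_smul]; exact (W _).smul_mem c (hf k)

theorem C_mem_seriesGrading {W : ℤ → Submodule ℚ A} {w : ℤ} {a : A} (ha : a ∈ W w) :
    C a ∈ seriesGrading W w := by
  intro k
  rw [coeff_C]
  split_ifs with h
  · subst h; simpa using ha
  · exact (W _).zero_mem

theorem IsGraded.series {W : ℤ → Submodule ℚ A} (hW : IsGraded W) :
    IsGraded (seriesGrading W) where
  one_mem := by
    rw [← map_one C]; exact C_mem_seriesGrading hW.one_mem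
  mul_mem' {v w f g} hf hg k := by
    rw [coeff_mul]
    refine (W _).sum_mem fun p hp => hW.mul_mem (hf p.1) (hg p.2) ?_
    rw [← HasAntidiagonal.mem_antidiagonal.1 hp]
    push_cast
    ring

theorem dX_mem_seriesGrading {W : ℤ → Submodule ℚ A} {w : ℤ} {f : A⟦X⟧}
    (hf : f ∈ seriesGrading W w) : dX f ∈ seriesGrading W (w + 1) := by
  intro k
  rw [coeff_dX, mul_comm, show ((k : A) + 1) = ((k + 1 : ℕ) : A) by push_cast; ring,
    show w + 1 + (k : ℤ) = w + ((k + 1 : ℕ) : ℤ) by push_cast; ring]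
  exact natCast_mul_mem (hf (k + 1)) _

/-- The inverse of a series of weight zero with constant term one has weight zero. -/
theorem IsGraded.inv_mem {W : ℤ → Submodule ℚ A} (hW : IsGraded W) {f g : A⟦X⟧}
    (hf : f ∈ seriesGrading W 0) (h0 : constantCoeff f = 1) (hfg : f * g = 1) :
    g ∈ seriesGrading W 0 := by
  intro k
  induction k using Nat.strong_induction_on with
  | _ k ih =>
    have h := congrArg (coeff k) hfg
    rw [coeff_mul, Nat.sum_antidiagonal_eq_sum_range_succ_mk, Finset.sum_range_succ',
      Nat.sub_zero, coeff_zero_eq_constantCoeff_apply, h0, one_mul] at h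
    rw [eq_sub_of_add_eq' h]
    refine (W _).sub_mem ?_ ((W _).sum_mem fun i hi => ?_)
    · have := hW.series.one_mem k
      exact this
    · rw [Finset.mem_range] at hi
      refine hW.mul_mem (hf (i + 1)) (ih (k - (i + 1)) (by omega)) ?_
      omega

end Grading

/-! ### Quasi-modular forms and Ramanujan's identities -/

/-- `QMod_w` for an integer weight `w`. -/
def QZ (w : ℤ) : Submodule ℚ ℚ⟦X⟧ :=
  Submodule.span ℚ
    {f | ∃ a b c : ℕ, 2 * (a : ℤ) + 4 * b + 6 * c = w ∧ f = G 2 ^ a * G 4 ^ b * G 6 ^ c}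

theorem QZ_natCast (k : ℕ) : QZ k = QMod k := by
  rw [QZ, QMod]
  congr 1
  ext f
  refine exists_congr fun a => exists_congr fun b => exists_congr fun c => ?_
  norm_cast

theorem isGraded_QZ : IsGraded QZ where
  one_mem := Submodule.subset_span ⟨0, 0, 0, by simp, by simp⟩
  mul_mem' {v w f g} hf hg := by
    have h : QZ v * QZ w ≤ QZ (v + w) := by
      rw [QZ, QZ, Submodule.span_mul_span]
      refine Submodule.span_mono ?_
      rintro _ ⟨_, ⟨a, b, c, h, rfl⟩, _, ⟨a', b', c', h', rfl⟩, rfl⟩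
      exact ⟨a + a', b + b', c + c', by push_cast; rw [← h, ← h']; ring, by ring⟩
    exact h (Submodule.mul_mem_mul hf hg)

theorem G_two_mem : G 2 ∈ QZ 2 := Submodule.subset_span ⟨1, 0, 0, by simp, by simp⟩

theorem G_four_mem : G 4 ∈ QZ 4 := Submodule.subset_span ⟨0, 1, 0, by simp, by simp⟩

theorem G_six_mem : G 6 ∈ QZ 6 := Submodule.subset_span ⟨0, 0, 1, by simp, by simp⟩

theorem constantCoeff_G (k : ℕ) : constantCoeff (G k) = -(bernoulli k) / (2 * k) := by
  rw [← coeff_zero_eq_constantCoeff_apply, G, coeff_mk, if_pos rfl]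

theorem constantCoeff_G_two : constantCoeff (G 2) = -1 / 24 := by
  rw [constantCoeff_G, bernoulli_two]; norm_num

theorem constantCoeff_G_four : constantCoeff (G 4) = 1 / 240 := by
  rw [constantCoeff_G, bernoulli_eq_bernoulli'_of_ne_one (by norm_num), bernoulli'_four]; norm_num

theorem constantCoeff_G_six : constantCoeff (G 6) = -1 / 504 := by
  have h5 : bernoulli' 5 = 0 := by
    rw [bernoulli'_def]; norm_num [Finset.sum_range_succ, Nat.choose]
  have h6 : bernoulli 6 = 1 / 42 := by
    rw [bernoulli_eq_bernoulli'_of_ne_one (by norm_num), bernoulli'_def]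
    norm_num [Finset.sum_range_succ, Nat.choose, h5]
  rw [constantCoeff_G, h6]; norm_num

theorem constantCoeff_eulerDer (f : ℚ⟦X⟧) : constantCoeff (eulerDer f) = 0 := by
  rw [← coeff_zero_eq_constantCoeff_apply, coeff_eulerDer]; simp

theorem eq_zero_of_eulerDer {f : ℚ⟦X⟧} (h : eulerDer f = 0) (h0 : constantCoeff f = 0) : f = 0 := by
  ext n
  cases n with
  | zero => rw [coeff_zero_eq_constantCoeff_apply, h0, map_zero]
  | succ n =>
    have := congrArg (coeff (n + 1)) h
    rw [coeff_eulerDer, map_zero] at this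
    rw [map_zero]
    exact (mul_eq_zero.1 this).resolve_left (by positivity)

/-! ### Low z-coefficients of Θ and Ramanujan's identities -/

theorem heat_coeff_Th (k : ℕ) : (((k + 1) * (k + 2) : ℕ) : ℚ⟦X⟧) * coeff (k + 2) Th =
    2 * eulerDer (coeff k Th) - 6 * (G 2 * coeff k Th) := by
  have h := coeff_Th_add_two k
  rw [smul_natCast_eq, ← Nat.cast_ofNat (R := ℚ⟦X⟧) (n := 2), smul_natCast_eq,
    ← Nat.cast_ofNat (R := ℚ⟦X⟧) (n := 6), smul_natCast_eq]
  push_cast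
  exact h

theorem coeff_three_Th : coeff 3 Th = -G 2 := by
  have h := heat_coeff_Th 1
  rw [coeff_one_Th, Derivation.map_one_eq_zero] at h
  have h6 : (6 : ℚ⟦X⟧) ≠ 0 := by
    intro h
    have := congrArg constantCoeff h
    rw [map_zero, map_ofNat] at this
    norm_num at this
  refine mul_left_cancel₀ h6 ?_
  push_cast at h
  linear_combination h

theorem heat_five : 20 * coeff 5 Th = -2 * eulerDer (G 2) + 6 * G 2 ^ 2 := by
  have h := heat_coeff_Th 3
  rw [coeff_three_Th, map_neg] at h
  push_cast at h
  linear_combination h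

theorem heat_seven : 42 * coeff 7 Th = 2 * eulerDer (coeff 5 Th) - 6 * (G 2 * coeff 5 Th) := by
  have h := heat_coeff_Th 5
  push_cast at h
  linear_combination h

theorem Lz_two : coeff 2 Lz = -eulerDer (G 2) := by
  rw [coeff_Lz_even 2 (by norm_num) (by decide)]
  norm_num [Nat.factorial]

theorem Lz_four : 12 * coeff 4 Lz = -eulerDer (G 4) := by
  rw [coeff_Lz_even 4 (by norm_num) (by decide), ← Nat.cast_ofNat (R := ℚ⟦X⟧) (n := 12),
    smul_natCast_eq, smul_smul]
  norm_num [Nat.factorial]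

theorem Lz_six : 360 * coeff 6 Lz = -eulerDer (G 6) := by
  rw [coeff_Lz_even 6 (by norm_num) (by decide), ← Nat.cast_ofNat (R := ℚ⟦X⟧) (n := 360),
    smul_natCast_eq, smul_smul]
  norm_num [Nat.factorial]

theorem eulerDer_ofNat_mul (n : ℕ) (f : ℚ⟦X⟧) : eulerDer ((n : ℚ⟦X⟧) * f) = n * eulerDer f := by
  rw [smul_natCast_eq, smul_natCast_eq, Derivation.map_smul]

theorem eulerDer_six_mul_sq (f : ℚ⟦X⟧) : eulerDer (6 * f ^ 2) = 12 * (f * eulerDer f) := by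
  have := eulerDer_ofNat_mul 6 (f ^ 2)
  push_cast at this
  rw [this, sq, Derivation.leibniz, smul_eq_mul]
  ring

/-- The z⁵ coefficient of DΘ = LΘ is the q d/dq derivative of this identity; the constant term is
supplied by the heat equation at q = 0 and the Bernoulli numbers. Confronting the result with the
heat equation yields D G₂. The z⁷ coefficient is treated likewise for D G₄. -/
theorem coeff_five_Th : 12 * coeff 5 Th = 6 * G 2 ^ 2 - G 4 := by
  have hD := congrArg (coeff 5) DV_Th
  rw [DV, coeff_coeffDer, coeff_mul, Nat.sum_antidiagonal_eq_sum_range_succ_mk] at hD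
  simp only [Finset.sum_range_succ, Finset.sum_range_zero, Nat.reduceSub, coeff_zero_Lz, zero_mul,
    coeff_Lz_odd 1 (by decide), coeff_Lz_odd 3 (by decide), coeff_Lz_odd 5 (by decide),
    coeff_three_Th, coeff_one_Th, Lz_two] at hD
  have h4 := Lz_four
  refine sub_eq_zero.1 (eq_zero_of_eulerDer ?_ ?_)
  · rw [map_sub, map_sub]
    have e1 := eulerDer_ofNat_mul 12 (coeff 5 Th)
    push_cast at e1
    rw [e1, eulerDer_six_mul_sq]
    linear_combination 12 * hD + h4
  · have h5 := congrArg constantCoeff heat_five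
    simp only [map_mul, map_add, map_pow, map_neg, map_ofNat, constantCoeff_eulerDer,
      constantCoeff_G_two] at h5
    simp only [map_sub, map_mul, map_pow, map_ofNat, constantCoeff_G_two, constantCoeff_G_four]
    linarith

theorem coeff_seven_Th : 360 * coeff 7 Th = -G 6 + 30 * G 2 * G 4 - 60 * G 2 ^ 3 := by
  have hD := congrArg (coeff 7) DV_Th
  rw [DV, coeff_coeffDer, coeff_mul, Nat.sum_antidiagonal_eq_sum_range_succ_mk] at hD
  simp only [Finset.sum_range_succ, Finset.sum_range_zero, Nat.reduceSub, coeff_zero_Lz, zero_mul,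
    coeff_Lz_odd 1 (by decide), coeff_Lz_odd 3 (by decide), coeff_Lz_odd 5 (by decide),
    coeff_Lz_odd 7 (by decide), coeff_three_Th, coeff_one_Th, Lz_two] at hD
  have h4 := Lz_four
  have h6 := Lz_six
  have h5 := coeff_five_Th
  refine sub_eq_zero.1 (eq_zero_of_eulerDer ?_ ?_)
  · have e1 := eulerDer_ofNat_mul 360 (coeff 7 Th)
    have e2 := eulerDer_ofNat_mul 30 (G 2 * G 4)
    have e3 := eulerDer_ofNat_mul 60 (G 2 ^ 3)
    push_cast at e1 e2 e3
    rw [mul_assoc]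
    simp only [map_sub, map_add, map_neg, e1, e2, e3, Derivation.leibniz, Derivation.leibniz_pow,
      smul_eq_mul, nsmul_eq_mul]
    push_cast
    linear_combination 360 * hD + h6 - 30 * G 2 * h4 - 30 * eulerDer (G 2) * h5
  · have h7 := congrArg constantCoeff heat_seven
    have h5' := congrArg constantCoeff heat_five
    simp only [map_mul, map_add, map_sub, map_pow, map_neg, map_ofNat, constantCoeff_eulerDer,
      constantCoeff_G_two] at h7 h5'
    simp only [map_sub, map_add, map_neg, map_mul, map_pow, map_ofNat, constantCoeff_G_two,
      constantCoeff_G_four, constantCoeff_G_six]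
    linarith

/-- Ramanujan's identity for `D G₂`. -/
theorem eulerDer_G_two : 6 * eulerDer (G 2) = 5 * G 4 - 12 * G 2 ^ 2 := by
  linear_combination 3 * heat_five - 5 * coeff_five_Th

/-- Ramanujan's identity for `D G₄`. -/
theorem eulerDer_G_four : 10 * eulerDer (G 4) = 7 * G 6 - 80 * G 2 * G 4 := by
  have h7 := coeff_seven_Th
  have hh := heat_seven
  have h5 := coeff_five_Th
  have h2 := eulerDer_G_two
  have hd := congrArg eulerDer h5
  have e1 := eulerDer_ofNat_mul 12 (coeff 5 Th)
  push_cast at e1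
  rw [map_sub, e1, eulerDer_six_mul_sq] at hd
  linear_combination -7 * h7 + 60 * hh + 10 * hd - 30 * G 2 * h5 + 20 * G 2 * h2

theorem quartic_Th_C : C (4 : ℚ⟦X⟧) * (dX Th * dX (dX (dX Th))) -
    C (3 : ℚ⟦X⟧) * (dX (dX Th) * dX (dX Th)) - Th * dX (dX (dX (dX Th))) +
    C (24 * G 2) * (dX Th * dX Th - Th * dX (dX Th)) = C uInv * (Th * Th) := by
  have h := quartic_Th
  rw [Pz] at h
  simp only [map_mul, map_ofNat]
  linear_combination h

theorem uInv_eq : uInv = 120 * coeff 5 Th - 36 * coeff 3 Th ^ 2 := by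
  have h := congrArg (coeff 2) quartic_Th_C
  simp only [map_add, map_sub, coeff_C_mul] at h
  simp only [coeff_mul, Nat.sum_antidiagonal_eq_sum_range_succ_mk,
    Finset.sum_range_succ, Finset.sum_range_zero, coeff_dX, Nat.reduceSub, Nat.reduceAdd,
    coeff_one_Th, coeff_even_Th 0 (by decide), coeff_even_Th 2 (by decide),
    coeff_even_Th 4 (by decide)] at h
  push_cast at h
  linear_combination -h

/-- The logarithmic derivative would bring in G₈ here. The quartic equation instead expresses the z⁹
coefficient through lower ones, which keeps D G₆ inside ℚ[G₂, G₄, G₆]. -/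
theorem coeff_nine_Th : 1008 * coeff 9 Th =
    336 * (coeff 3 Th * coeff 7 Th) - 120 * coeff 5 Th ^ 2 +
    24 * (G 2 * (4 * (coeff 3 Th * coeff 5 Th) - 28 * coeff 7 Th)) -
    uInv * (2 * coeff 5 Th + coeff 3 Th ^ 2) := by
  have h := congrArg (coeff 6) quartic_Th_C
  simp only [map_add, map_sub, coeff_C_mul] at h
  simp only [coeff_mul, Nat.sum_antidiagonal_eq_sum_range_succ_mk,
    Finset.sum_range_succ, Finset.sum_range_zero, coeff_dX, Nat.reduceSub, Nat.reduceAdd,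
    coeff_one_Th, coeff_even_Th 0 (by decide), coeff_even_Th 2 (by decide),
    coeff_even_Th 4 (by decide), coeff_even_Th 6 (by decide), coeff_even_Th 8 (by decide)] at h
  push_cast at h
  linear_combination -h

/-! ### Weights of the low coefficients and of D G₂, D G₄, D G₆ -/

theorem coeff_three_mem : coeff 3 Th ∈ QZ 2 := by
  rw [coeff_three_Th]; exact (QZ 2).neg_mem G_two_mem

theorem coeff_five_mem : coeff 5 Th ∈ QZ 4 := by
  refine mem_of_natCast_mul_mem (n := 12) (by norm_num) ?_
  rw [Nat.cast_ofNat, coeff_five_Th]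
  exact (QZ 4).sub_mem (natCast_mul_mem (isGraded_QZ.pow_mem G_two_mem 2 (by norm_num)) 6) G_four_mem

theorem coeff_seven_mem : coeff 7 Th ∈ QZ 6 := by
  refine mem_of_natCast_mul_mem (n := 360) (by norm_num) ?_
  rw [Nat.cast_ofNat, coeff_seven_Th, mul_assoc]
  exact (QZ 6).sub_mem ((QZ 6).add_mem ((QZ 6).neg_mem G_six_mem)
    (natCast_mul_mem (isGraded_QZ.mul_mem G_two_mem G_four_mem (by norm_num)) 30))
    (natCast_mul_mem (isGraded_QZ.pow_mem G_two_mem 3 (by norm_num)) 60)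

theorem uInv_mem : uInv ∈ QZ 4 := by
  rw [uInv_eq]
  exact (QZ 4).sub_mem (natCast_mul_mem coeff_five_mem 120)
    (natCast_mul_mem (isGraded_QZ.pow_mem coeff_three_mem 2 (by norm_num)) 36)

theorem coeff_nine_mem : coeff 9 Th ∈ QZ 8 := by
  refine mem_of_natCast_mul_mem (n := 1008) (by norm_num) ?_
  rw [Nat.cast_ofNat, coeff_nine_Th]
  have h35 := isGraded_QZ.mul_mem (u := 6) coeff_three_mem coeff_five_mem (by norm_num)
  have h37 := isGraded_QZ.mul_mem (u := 8) coeff_three_mem coeff_seven_mem (by norm_num)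
  refine (QZ 8).sub_mem ((QZ 8).add_mem ((QZ 8).sub_mem (natCast_mul_mem h37 336)
    (natCast_mul_mem (isGraded_QZ.pow_mem coeff_five_mem 2 (by norm_num)) 120))
    (natCast_mul_mem (isGraded_QZ.mul_mem (v := 2) (w := 6) G_two_mem ((QZ 6).sub_mem
      (natCast_mul_mem h35 4) (natCast_mul_mem coeff_seven_mem 28)) (by norm_num)) 24)) ?_
  exact isGraded_QZ.mul_mem (v := 4) (w := 4) uInv_mem ((QZ 4).add_mem
    (natCast_mul_mem coeff_five_mem 2) (isGraded_QZ.pow_mem coeff_three_mem 2 (by norm_num)))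
    (by norm_num)

theorem eulerDer_G_two_mem : eulerDer (G 2) ∈ QZ 4 := by
  refine mem_of_natCast_mul_mem (n := 6) (by norm_num) ?_
  rw [Nat.cast_ofNat, eulerDer_G_two]
  exact (QZ 4).sub_mem (natCast_mul_mem G_four_mem 5)
    (natCast_mul_mem (isGraded_QZ.pow_mem G_two_mem 2 (by norm_num)) 12)

theorem eulerDer_G_four_mem : eulerDer (G 4) ∈ QZ 6 := by
  refine mem_of_natCast_mul_mem (n := 10) (by norm_num) ?_
  rw [Nat.cast_ofNat, eulerDer_G_four, mul_assoc]
  exact (QZ 6).sub_mem (natCast_mul_mem G_six_mem 7)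
    (natCast_mul_mem (isGraded_QZ.mul_mem G_two_mem G_four_mem (by norm_num)) 80)

/-- G₆ is read off from the z⁷ coefficient of Θ, whose derivative the heat equation expresses
through the z⁹ coefficient. -/
theorem eulerDer_G_six_mem : eulerDer (G 6) ∈ QZ 8 := by
  have h7 : eulerDer (coeff 7 Th) ∈ QZ 8 := by
    refine mem_of_natCast_mul_mem (n := 2) (by norm_num) ?_
    have h := heat_coeff_Th 7
    rw [Nat.cast_ofNat, show 2 * eulerDer (coeff 7 Th) =
      (((7 + 1) * (7 + 2) : ℕ) : ℚ⟦X⟧) * coeff (7 + 2) Th + 6 * (G 2 * coeff 7 Th) by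
        rw [h]; ring]
    exact (QZ 8).add_mem (natCast_mul_mem coeff_nine_mem _)
      (natCast_mul_mem (isGraded_QZ.mul_mem G_two_mem coeff_seven_mem (by norm_num)) 6)
  have h := congrArg eulerDer coeff_seven_Th
  have e1 := eulerDer_ofNat_mul 360 (coeff 7 Th)
  have e2 := eulerDer_ofNat_mul 30 (G 2 * G 4)
  have e3 := eulerDer_ofNat_mul 60 (G 2 ^ 3)
  push_cast at e1 e2 e3
  rw [mul_assoc, e1, map_sub, map_add, map_neg, e2, e3] at h
  rw [show eulerDer (G 6) = 30 * eulerDer (G 2 * G 4) - 60 * eulerDer (G 2 ^ 3) -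
    360 * eulerDer (coeff 7 Th) by linear_combination h]
  refine (QZ 8).sub_mem ((QZ 8).sub_mem (natCast_mul_mem ?_ 30) (natCast_mul_mem ?_ 60))
    (natCast_mul_mem h7 360)
  · rw [Derivation.leibniz]
    exact (QZ 8).add_mem (isGraded_QZ.mul_mem G_two_mem eulerDer_G_four_mem (by norm_num))
      (isGraded_QZ.mul_mem G_four_mem eulerDer_G_two_mem (by norm_num))
  · rw [Derivation.leibniz_pow, ← Nat.cast_smul_eq_nsmul ℚ]
    exact (QZ 8).smul_mem _ (isGraded_QZ.mul_mem (v := 4) (w := 4)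
      (isGraded_QZ.pow_mem G_two_mem 2 (by norm_num)) eulerDer_G_two_mem (by norm_num))

/-- `D_τ` raises the weight by two. -/
theorem eulerDer_mem {w v : ℤ} {f : ℚ⟦X⟧} (hf : f ∈ QZ w) (hv : w + 2 = v) :
    eulerDer f ∈ QZ v := by
  subst hv
  have hpow : ∀ {u : ℤ} {g : ℚ⟦X⟧}, g ∈ QZ u → eulerDer g ∈ QZ (u + 2) → ∀ n : ℕ,
      eulerDer (g ^ n) ∈ QZ (n * u + 2) := by
    intro u g hg hd n
    induction n with
    | zero => simp
    | succ n ih =>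
      rw [pow_succ, Derivation.leibniz]
      exact (QZ _).add_mem (isGraded_QZ.mul_mem (isGraded_QZ.pow_mem hg n rfl) hd
        (by push_cast; ring)) (isGraded_QZ.mul_mem hg ih (by push_cast; ring))
  refine Submodule.span_induction ?_ ?_ ?_ ?_ hf
  · rintro _ ⟨a, b, c, h, rfl⟩
    have h2 := hpow G_two_mem eulerDer_G_two_mem a
    have h4 := hpow G_four_mem eulerDer_G_four_mem b
    have h6 := hpow G_six_mem eulerDer_G_six_mem c
    have k2 := isGraded_QZ.pow_mem G_two_mem a rfl
    have k4 := isGraded_QZ.pow_mem G_four_mem b rfl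
    have k6 := isGraded_QZ.pow_mem G_six_mem c rfl
    rw [Derivation.leibniz, Derivation.leibniz]
    refine (QZ _).add_mem (isGraded_QZ.mul_mem (isGraded_QZ.mul_mem k2 k4 rfl) h6 (by linarith))
      (isGraded_QZ.mul_mem k6 ((QZ (a * 2 + b * 4 + 2)).add_mem
        (isGraded_QZ.mul_mem k2 h4 (by ring)) (isGraded_QZ.mul_mem k4 h2 (by ring))) (by linarith))
  · simp
  · intro f g _ _ hf hg
    rw [map_add]; exact (QZ _).add_mem hf hg
  · intro c f _ hf
    rw [Derivation.map_smul]; exact (QZ _).smul_mem c hf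

/-- The coefficients of `Θ` are quasi-modular forms. -/
theorem Th_mem : Th ∈ seriesGrading QZ (-1) := by
  have hodd : ∀ j : ℕ, coeff (2 * j + 1) Th ∈ QZ (2 * j) := by
    intro j
    induction j with
    | zero => rw [mul_zero, zero_add, coeff_one_Th]; exact isGraded_QZ.one_mem
    | succ j ih =>
      refine mem_of_natCast_mul_mem (n := (2 * j + 1 + 1) * (2 * j + 1 + 2)) (by positivity) ?_
      rw [show 2 * (j + 1) + 1 = 2 * j + 1 + 2 by ring, heat_coeff_Th]
      push_cast
      exact (QZ _).sub_mem (natCast_mul_mem (eulerDer_mem ih (by ring)) 2)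
        (natCast_mul_mem (isGraded_QZ.mul_mem G_two_mem ih (by ring)) 6)
  intro k
  rcases Nat.even_or_odd' k with ⟨j, rfl | rfl⟩
  · rw [coeff_even_Th _ (even_two_mul j)]; exact (QZ _).zero_mem
  · have := hodd j
    rwa [show (2 * (j : ℤ)) = -1 + ((2 * j + 1 : ℕ) : ℤ) by push_cast; ring] at this

/-! ### Two elliptic variables: Taylor expansion -/

section EvalNeg

variable {A : Type*} [CommRing A]

theorem evalNegHom_C (a : A) : evalNegHom (C a) = C a := by
  ext n
  rw [evalNegHom, coeff_rescale, coeff_C]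
  split_ifs with h
  · simp [h]
  · simp

theorem evalNegHom_evalNegHom (f : A⟦X⟧) : evalNegHom (evalNegHom f) = f := by
  ext n
  rw [evalNegHom, coeff_rescale, coeff_rescale, ← mul_assoc, ← mul_pow]
  simp

end EvalNeg

section Taylor

variable {A : Type*} [CommRing A] [Algebra ℚ A]

theorem natCast_mul_eq_zero {n : ℕ} (hn : n ≠ 0) {a : A} (h : (n : A) * a = 0) : a = 0 := by
  rw [smul_natCast_eq] at h
  exact (smul_eq_zero.1 h).resolve_left (by exact_mod_cast hn)

/-- A series killed by `∂_x - ∂` is determined by its constant term. -/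
theorem ext_of_transport (d : Derivation ℚ A A) {f g : A⟦X⟧} (hf : dX f = coeffDer d f)
    (hg : dX g = coeffDer d g) (h0 : constantCoeff f = constantCoeff g) : f = g := by
  rw [← sub_eq_zero]
  have h : dX (f - g) = coeffDer d (f - g) := by rw [map_sub, map_sub, hf, hg]
  have h0' : constantCoeff (f - g) = 0 := by rw [map_sub, h0, sub_self]
  generalize f - g = k at h h0'
  ext n
  rw [map_zero]
  induction n with
  | zero => rw [coeff_zero_eq_constantCoeff_apply, h0']
  | succ n ih =>
    have := congrArg (coeff n) h
    rw [coeff_dX, coeff_coeffDer, ih, map_zero, mul_comm] at this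
    exact natCast_mul_eq_zero (n := n + 1) (by omega) (by push_cast; exact this)

/-- `f(z) ↦ f(x + z)` for the flow of a derivation. -/
def taylorSeries (d : Derivation ℚ A A) (f : A) : A⟦X⟧ :=
  PowerSeries.mk fun n => ((n.factorial : ℚ)⁻¹) • (d^[n] f)

theorem dX_taylorSeries (d : Derivation ℚ A A) (f : A) :
    dX (taylorSeries d f) = taylorSeries d (d f) := by
  ext n
  rw [coeff_dX, taylorSeries, taylorSeries, coeff_mk, coeff_mk, Function.iterate_succ_apply,
    mul_comm, show ((n : A) + 1) = ((n + 1 : ℕ) : A) by push_cast; ring, smul_natCast_eq, smul_smul,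
    Nat.factorial_succ]
  congr 1
  have : ((n + 1 : ℕ) : ℚ) ≠ 0 := by positivity
  push_cast at this ⊢
  field_simp

theorem coeffDer_taylorSeries (d e : Derivation ℚ A A) (h : ∀ a, e (d a) = d (e a)) (f : A) :
    coeffDer e (taylorSeries d f) = taylorSeries d (e f) := by
  ext n
  rw [coeff_coeffDer, taylorSeries, taylorSeries, coeff_mk, coeff_mk, Derivation.map_smul]
  congr 1
  exact (Function.Commute.iterate_right (f := e) (g := d) h n) f

theorem constantCoeff_taylorSeries (d : Derivation ℚ A A) (f : A) :
    constantCoeff (taylorSeries d f) = f := by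
  rw [← coeff_zero_eq_constantCoeff_apply, taylorSeries, coeff_mk]; simp

theorem taylorSeries_mul (d : Derivation ℚ A A) (f g : A) :
    taylorSeries d (f * g) = taylorSeries d f * taylorSeries d g := by
  refine ext_of_transport d ?_ ?_ ?_
  · rw [dX_taylorSeries, coeffDer_taylorSeries d d fun _ => rfl]
  · simp only [Derivation.leibniz, dX_taylorSeries, coeffDer_taylorSeries d d fun _ => rfl]
  · simp only [map_mul, constantCoeff_taylorSeries]

theorem taylorSeries_add (d : Derivation ℚ A A) (f g : A) :
    taylorSeries d (f + g) = taylorSeries d f + taylorSeries d g := by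
  refine ext_of_transport d ?_ ?_ ?_
  · rw [dX_taylorSeries, coeffDer_taylorSeries d d fun _ => rfl]
  · simp only [map_add, dX_taylorSeries, coeffDer_taylorSeries d d fun _ => rfl]
  · simp only [map_add, constantCoeff_taylorSeries]

theorem taylorSeries_of_eq_zero (d : Derivation ℚ A A) {f : A} (h : d f = 0) :
    taylorSeries d f = C f := by
  refine ext_of_transport d ?_ ?_ ?_
  · rw [dX_taylorSeries, coeffDer_taylorSeries d d fun _ => rfl]
  · rw [dX_C, coeffDer_C, h, map_zero]
  · rw [constantCoeff_taylorSeries, constantCoeff_C]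

theorem dX_evalNegHom (f : A⟦X⟧) : dX (evalNegHom f) = -evalNegHom (dX f) := by
  ext n
  rw [coeff_dX, map_neg, evalNegHom, coeff_rescale, coeff_rescale, coeff_dX, pow_succ]
  ring

theorem coeffDer_evalNegHom (d : Derivation ℚ A A) (f : A⟦X⟧) :
    coeffDer d (evalNegHom f) = evalNegHom (coeffDer d f) := by
  ext n
  rw [coeff_coeffDer, evalNegHom, coeff_rescale, coeff_rescale, coeff_coeffDer,
    show ((-1 : A) ^ n) = algebraMap ℚ A ((-1) ^ n) by simp, ← Algebra.smul_def,
    Derivation.map_smul, Algebra.smul_def]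

end Taylor

/-- `ℚ⟦q⟧⟦z⟧⟦x⟧`. -/
abbrev XZ : Type := ℚ⟦X⟧⟦X⟧⟦X⟧

/-- `f(x)`. -/
def inX : ℚ⟦X⟧⟦X⟧ →+* XZ := PowerSeries.map C

/-- `f(z)`. -/
def inZ : ℚ⟦X⟧⟦X⟧ →+* XZ := C

/-- `f(x + z)`. -/
def inXZ : ℚ⟦X⟧⟦X⟧ →+* XZ where
  toFun := taylorSeries (A := ℚ⟦X⟧⟦X⟧) dX
  map_one' := by rw [taylorSeries_of_eq_zero _ (Derivation.map_one_eq_zero _), map_one]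
  map_mul' f g := taylorSeries_mul dX f g
  map_zero' := by rw [taylorSeries_of_eq_zero _ (map_zero _), map_zero]
  map_add' f g := taylorSeries_add dX f g

theorem inXZ_apply (f : ℚ⟦X⟧⟦X⟧) : inXZ f = taylorSeries dX f := rfl

/-- `∂_x`. -/
def ddx : Derivation ℚ XZ XZ := dX

/-- `∂_z`. -/
def ddz : Derivation ℚ XZ XZ := coeffDer dX

/-- `q d/dq`. -/
def DS : Derivation ℚ XZ XZ := coeffDer DV

/-- The coefficients, i.e. power series in `q`. -/
def inQ : ℚ⟦X⟧ →+* XZ := (C (R := ℚ⟦X⟧⟦X⟧)).comp C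

theorem inX_C (c : ℚ⟦X⟧) : inX (C c) = inQ c := map_C _ _

theorem inZ_C (c : ℚ⟦X⟧) : inZ (C c) = inQ c := rfl

theorem inXZ_C (c : ℚ⟦X⟧) : inXZ (C c) = inQ c := by
  rw [inXZ_apply, taylorSeries_of_eq_zero _ (dX_C c)]; rfl

theorem ddx_inX (f : ℚ⟦X⟧⟦X⟧) : ddx (inX f) = inX (dX f) := dX_map _ _

theorem ddz_inX (f : ℚ⟦X⟧⟦X⟧) : ddz (inX f) = 0 := by
  ext n : 1
  rw [ddz, coeff_coeffDer, inX, coeff_map, dX_C, map_zero]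

theorem DS_inX (f : ℚ⟦X⟧⟦X⟧) : DS (inX f) = inX (DV f) :=
  coeffDer_map _ _ _ DV_C f

theorem ddx_inZ (f : ℚ⟦X⟧⟦X⟧) : ddx (inZ f) = 0 := dX_C _

theorem ddz_inZ (f : ℚ⟦X⟧⟦X⟧) : ddz (inZ f) = inZ (dX f) := coeffDer_C _ _

theorem DS_inZ (f : ℚ⟦X⟧⟦X⟧) : DS (inZ f) = inZ (DV f) := coeffDer_C _ _

theorem ddx_inXZ (f : ℚ⟦X⟧⟦X⟧) : ddx (inXZ f) = inXZ (dX f) := by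
  rw [inXZ_apply, inXZ_apply, ddx, dX_taylorSeries]

theorem ddz_inXZ (f : ℚ⟦X⟧⟦X⟧) : ddz (inXZ f) = inXZ (dX f) := by
  rw [inXZ_apply, inXZ_apply, ddz, coeffDer_taylorSeries _ _ fun _ => rfl]

theorem DS_inXZ (f : ℚ⟦X⟧⟦X⟧) : DS (inXZ f) = inXZ (DV f) := by
  rw [inXZ_apply, inXZ_apply, DS, coeffDer_taylorSeries _ _ fun a => (dX_DV a).symm]

/-- `f(z - x)`. -/
def inZsubX : ℚ⟦X⟧⟦X⟧ →+* XZ := evalNegHom.comp inXZ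

theorem inZsubX_C (c : ℚ⟦X⟧) : inZsubX (C c) = inQ c := by
  rw [inZsubX, RingHom.comp_apply, inXZ_C]
  exact evalNegHom_C _

theorem ddx_inZsubX (f : ℚ⟦X⟧⟦X⟧) : ddx (inZsubX f) = -inZsubX (dX f) := by
  rw [inZsubX, RingHom.comp_apply, RingHom.comp_apply, ddx, dX_evalNegHom, ← ddx, ddx_inXZ]

theorem ddz_inZsubX (f : ℚ⟦X⟧⟦X⟧) : ddz (inZsubX f) = inZsubX (dX f) := by
  rw [inZsubX, RingHom.comp_apply, RingHom.comp_apply, ddz, coeffDer_evalNegHom, ← ddz, ddz_inXZ]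

theorem DS_inZsubX (f : ℚ⟦X⟧⟦X⟧) : DS (inZsubX f) = inZsubX (DV f) := by
  rw [inZsubX, RingHom.comp_apply, RingHom.comp_apply, DS, coeffDer_evalNegHom, ← DS, DS_inXZ]

theorem constantCoeff_inXZ (f : ℚ⟦X⟧⟦X⟧) : constantCoeff (inXZ f) = f := by
  rw [inXZ_apply, constantCoeff_taylorSeries]

theorem constantCoeff_inZsubX (f : ℚ⟦X⟧⟦X⟧) : constantCoeff (inZsubX f) = f := by
  rw [← coeff_zero_eq_constantCoeff_apply, inZsubX, RingHom.comp_apply, evalNegHom, coeff_rescale,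
    pow_zero, one_mul, coeff_zero_eq_constantCoeff_apply, constantCoeff_inXZ]

/-! ### The addition formula -/

/-- The term ∂_x² determines the x^{n+2} coefficient from the x^n coefficient, so two initial
coefficients in x suffice. -/
theorem heat_unique {f : XZ} (h : 4 * DS f = ddx (ddx f) + ddz (ddz f) + 24 * inQ (G 2) * f)
    (h0 : coeff 0 f = 0) (h1 : coeff 1 f = 0) : f = 0 := by
  ext1 n
  rw [map_zero]
  induction n using Nat.strong_induction_on with
  | _ n ih =>
    match n with
    | 0 => exact h0
    | 1 => exact h1
    | n + 2 =>
      have hn := congrArg (coeff n) h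
      rw [show (4 : XZ) = C (4 : ℚ⟦X⟧⟦X⟧) from (map_ofNat C 4).symm,
        show 24 * inQ (G 2) = C (24 * C (G 2)) by rw [map_mul, map_ofNat]; rfl,
        map_add, map_add, coeff_C_mul, coeff_C_mul, DS, ddx, ddz, coeff_coeffDer, coeff_coeffDer,
        coeff_coeffDer, coeff_dX, coeff_dX, ih n (by omega), map_zero, map_zero, map_zero, mul_zero,
        mul_zero, add_zero, add_zero] at hn
      refine natCast_mul_eq_zero (n := (n + 2) * (n + 1)) (by positivity) ?_
      rw [hn]
      push_cast
      ring

theorem heat_hom (φ : ℚ⟦X⟧⟦X⟧ →+* XZ) (hC : ∀ c, φ (C c) = inQ c) :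
    2 * φ (DV Th) = φ (dX (dX Th)) + 6 * inQ (G 2) * φ Th := by
  have := congrArg φ heat_Th
  simpa only [map_mul, map_add, map_ofNat, hC] using this

/-- `Θ(x + z) Θ(z - x) = P(x) Θ(z)² - Θ(x)² P(z)`. -/
theorem addition_formula : inXZ Th * inZsubX Th =
    inX Pz * inZ Th ^ 2 - inX Th ^ 2 * inZ Pz := by
  rw [← sub_eq_zero]
  refine heat_unique ?_ ?_ ?_
  -- Both sides solve the two-variable heat equation. On the left the cross terms of ∂_x² and ∂_z²
  -- cancel; on the right the terms u Θ(x)²Θ(z)² and −2P(x)P(z) cancel by antisymmetry.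
  · have t := heat_hom inXZ inXZ_C
    have s := heat_hom inZsubX inZsubX_C
    have hx := congrArg inX heatOp_Pz
    have hz := congrArg inZ heatOp_Pz
    have kx := congrArg inX heatOp_Th_sq
    have kz := congrArg inZ heatOp_Th_sq
    simp only [heatOp, map_sub, map_mul, map_ofNat, map_pow, inX_C, inZ_C] at hx hz kx kz
    have e1 : ∀ f : ℚ⟦X⟧⟦X⟧, inX f ^ 2 = inX (f ^ 2) := fun f => (map_pow _ _ _).symm
    have e2 : ∀ f : ℚ⟦X⟧⟦X⟧, inZ f ^ 2 = inZ (f ^ 2) := fun f => (map_pow _ _ _).symm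
    rw [e1, e2]
    rw [e1] at kx hx
    rw [e2] at kz hz
    simp only [map_sub, map_add, map_neg, Derivation.leibniz, smul_eq_mul, ddx_inX, ddx_inZ,
      ddx_inXZ, ddx_inZsubX, ddz_inX, ddz_inZ, ddz_inXZ, ddz_inZsubX, DS_inX, DS_inZ, DS_inXZ,
      DS_inZsubX, mul_zero, zero_add, add_zero]
    linear_combination 2 * inZsubX Th * t + 2 * inXZ Th * s - inZ (Th ^ 2) * hx - inX Pz * kz +
      inZ Pz * kx + inX (Th ^ 2) * hz
  -- At x = 0 both sides equal Θ(z)².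
  · have h2 : coeff 0 (inX Th) = 0 := by
      rw [inX, coeff_map, coeff_zero_Th, map_zero]
    have h3 : constantCoeff (inX Pz) = 1 := by
      rw [← coeff_zero_eq_constantCoeff_apply, inX, coeff_map, coeff_zero_eq_constantCoeff_apply,
        constantCoeff_Pz, map_one]
    rw [coeff_zero_eq_constantCoeff_apply] at h2 ⊢
    simp only [map_sub, map_mul, map_pow, constantCoeff_inXZ, constantCoeff_inZsubX, h2, h3]
    simp [inZ]
    ring
  -- Both sides are even in x, because Θ is odd and P is even; hence no x¹ term.
  · set K := inXZ Th * inZsubX Th - (inX Pz * inZ Th ^ 2 - inX Th ^ 2 * inZ Pz)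
    have hThx : evalNegHom (inX Th) = -inX Th := by
      ext1 n
      rw [evalNegHom, coeff_rescale, map_neg, inX, coeff_map]
      rcases Nat.even_or_odd n with hn | hn
      · rw [coeff_even_Th n hn]; simp
      · rw [hn.neg_one_pow, neg_one_mul]
    have hdThx : evalNegHom (inX (dX Th)) = inX (dX Th) := by
      rw [← ddx_inX, ← neg_inj, ← map_neg]
      have := dX_evalNegHom (inX Th)
      rw [hThx, map_neg] at this
      rw [map_neg]
      exact this.symm
    have hddThx : evalNegHom (inX (dX (dX Th))) = -inX (dX (dX Th)) := by
      rw [← ddx_inX (dX Th), ← neg_inj, neg_neg]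
      have := dX_evalNegHom (inX (dX Th))
      rw [hdThx] at this
      exact this.symm
    have hP : evalNegHom (inX Pz) = inX Pz := by
      simp only [Pz, map_sub, map_mul, map_pow, hThx, hdThx, hddThx]
      ring
    have hz : ∀ f, evalNegHom (inZ f) = inZ f := fun f => evalNegHom_C f
    have hinv : evalNegHom (inZsubX Th) = inXZ Th := evalNegHom_evalNegHom _
    have hK : evalNegHom K = K := by
      have hx : evalNegHom (inXZ Th) = inZsubX Th := rfl
      simp only [K, map_sub, map_mul, map_pow, hz, hP, hThx, hinv, hx]
      ring
    have := congrArg (coeff 1) hK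
    rw [evalNegHom, coeff_rescale, pow_one, neg_one_mul] at this
    refine natCast_mul_eq_zero (n := 2) (by norm_num) ?_
    push_cast
    linear_combination -this

/-! ### Derivations of fraction fields -/

section Fraction

variable {S : Type*} [CommRing S] [Algebra ℚ S]

/-- The ring homomorphism to the dual numbers attached to a derivation. -/
def derHom (d : Derivation ℚ S S) : S →+* DualNumber (FractionRing S) where
  toFun s := (algebraMap S (FractionRing S) s, algebraMap S (FractionRing S) (d s))
  map_one' := by
    refine TrivSqZeroExt.ext ?_ ?_
    · exact map_one _
    · change algebraMap S (FractionRing S) (d 1) = 0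
      simp
  map_zero' := by
    refine TrivSqZeroExt.ext ?_ ?_
    · exact map_zero _
    · change algebraMap S (FractionRing S) (d 0) = 0
      simp
  map_add' a b := by
    refine TrivSqZeroExt.ext ?_ ?_
    · exact map_add _ _ _
    · change algebraMap S (FractionRing S) (d (a + b)) = _
      rw [map_add, map_add]; rfl
  map_mul' a b := by
    refine TrivSqZeroExt.ext ?_ ?_
    · exact map_mul _ _ _
    · change algebraMap S (FractionRing S) (d (a * b)) =
        algebraMap S (FractionRing S) a * algebraMap S (FractionRing S) (d b) +
        algebraMap S (FractionRing S) (d a) * algebraMap S (FractionRing S) b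
      rw [Derivation.leibniz, map_add, smul_eq_mul, smul_eq_mul, map_mul, map_mul]
      ring

/-- A dual number is invertible as soon as its first component is; thus s ↦ s + d(s)ε extends to
fractions by the universal property. -/
theorem isUnit_derHom (d : Derivation ℚ S S) (s : nonZeroDivisors S) : IsUnit (derHom d s) := by
  rw [TrivSqZeroExt.isUnit_iff_isUnit_fst]
  exact IsLocalization.map_units (FractionRing S) s

/-- The extension of `derHom` to the fraction field. -/
def fracDerHom (d : Derivation ℚ S S) : FractionRing S →+* DualNumber (FractionRing S) :=
  IsLocalization.lift (M := nonZeroDivisors S) (isUnit_derHom d)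

theorem fracDerHom_algebraMap (d : Derivation ℚ S S) (s : S) :
    fracDerHom d (algebraMap S (FractionRing S) s) = derHom d s :=
  IsLocalization.lift_eq _ s

theorem fst_fracDerHom (d : Derivation ℚ S S) (x : FractionRing S) :
    TrivSqZeroExt.fst (fracDerHom d x) = x := by
  have h : (TrivSqZeroExt.fstHom (FractionRing S) (FractionRing S) (FractionRing S)).toRingHom.comp
      (fracDerHom d) = RingHom.id _ := by
    refine IsLocalization.ringHom_ext (nonZeroDivisors S) ?_
    ext s
    change TrivSqZeroExt.fst (fracDerHom d (algebraMap S (FractionRing S) s)) = _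
    rw [fracDerHom_algebraMap]
    rfl
  exact congrArg (fun φ : FractionRing S →+* FractionRing S => φ x) h

/-- The extension of a derivation to the fraction field. -/
def fracDer (d : Derivation ℚ S S) : Derivation ℚ (FractionRing S) (FractionRing S) :=
  Derivation.mk'
    (AddMonoidHom.toRatLinearMap
      { toFun := fun x => TrivSqZeroExt.snd (fracDerHom d x)
        map_zero' := by rw [map_zero, TrivSqZeroExt.snd_zero]
        map_add' := fun x y => by rw [map_add, TrivSqZeroExt.snd_add] })
    (by
      intro x y
      change TrivSqZeroExt.snd (fracDerHom d (x * y)) =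
        x * TrivSqZeroExt.snd (fracDerHom d y) + y * TrivSqZeroExt.snd (fracDerHom d x)
      rw [map_mul, DualNumber.snd_mul, fst_fracDerHom, fst_fracDerHom]
      ring)

theorem fracDer_algebraMap (d : Derivation ℚ S S) (s : S) :
    fracDer d (algebraMap S (FractionRing S) s) = algebraMap S (FractionRing S) (d s) := by
  change TrivSqZeroExt.snd (fracDerHom d (algebraMap S (FractionRing S) s)) = _
  rw [fracDerHom_algebraMap]
  rfl

end Fraction

/-! ### Logarithmic derivatives and the addition theorem in a differential field -/

section FieldIdentities

variable {K : Type*} [Field K] [Algebra ℚ K]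

/-- First logarithmic derivative. -/
def ld1 (t t1 : K) : K := t1 / t

/-- Minus the second logarithmic derivative. -/
def ld2 (t t1 t2 : K) : K := (t1 / t) ^ 2 - t2 / t

/-- Minus the third logarithmic derivative. -/
def ld3 (t t1 t2 t3 : K) : K := (t1 / t) ^ 3 - 3 * (t1 / t) * ld2 t t1 t2 - t3 / t

theorem der_div_mul (d : Derivation ℚ K K) {s t : K} (ht : t ≠ 0) :
    d (s / t) = d s / t - (s / t) * (d t / t) := by
  have h : s / t * t = s := div_mul_cancel₀ _ ht
  have h2 := congrArg d h
  rw [Derivation.leibniz, smul_eq_mul, smul_eq_mul] at h2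
  field_simp at h2 ⊢
  linear_combination h2

/-- Here t, t1, t2, … stand for Θ and its derivatives at one argument, and e for the derivative of
that argument along d; the values 1, −1, 2 and 0 occur. -/
theorem der_ld1 (d : Derivation ℚ K K) (e : K) {t t1 t2 : K} (ht : t ≠ 0)
    (h0 : d t = e * t1) (h1 : d t1 = e * t2) : d (ld1 t t1) = -e * ld2 t t1 t2 := by
  rw [ld1, der_div_mul d ht, h0, h1, ld2]
  ring

theorem der_ld2 (d : Derivation ℚ K K) (e : K) {t t1 t2 t3 : K} (ht : t ≠ 0)
    (h0 : d t = e * t1) (h1 : d t1 = e * t2) (h2 : d t2 = e * t3) :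
    d (ld2 t t1 t2) = e * ld3 t t1 t2 t3 := by
  have ha := der_ld1 d e ht h0 h1
  rw [ld1] at ha
  rw [ld3, ld2] at *
  rw [map_sub, Derivation.leibniz_pow, ha, der_div_mul d ht, h0, h2]
  simp only [smul_eq_mul, nsmul_eq_mul]
  push_cast
  ring

/-- Divided by t², the quartic equation `hq` becomes the Weierstrass-type equation X'' = 6X² − 24gX
+ u for X = −(log t)''. -/
theorem der_ld3 (d : Derivation ℚ K K) (e : K) {t t1 t2 t3 t4 g u : K} (ht : t ≠ 0)
    (h0 : d t = e * t1) (h1 : d t1 = e * t2) (h2 : d t2 = e * t3) (h3 : d t3 = e * t4)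
    (hq : 4 * t1 * t3 - 3 * t2 ^ 2 - t * t4 + 24 * g * (t1 ^ 2 - t * t2) = u * t ^ 2) :
    d (ld3 t t1 t2 t3) = e * (6 * ld2 t t1 t2 ^ 2 - 24 * g * ld2 t t1 t2 + u) := by
  have ha := der_ld1 d e ht h0 h1
  have hX := der_ld2 d e ht h0 h1 h2
  rw [ld1] at ha
  have h4 : t4 / t = 4 * (t1 / t) * (t3 / t) - 3 * (t2 / t) ^ 2 + 24 * g * ld2 t t1 t2 - u := by
    rw [ld2]
    field_simp
    linear_combination -hq
  have hd : d (3 * (t1 / t) * ld2 t t1 t2) =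
      3 * ((t1 / t) * (e * ld3 t t1 t2 t3) + ld2 t t1 t2 * (-e * ld2 t t1 t2)) := by
    rw [mul_assoc, Derivation.leibniz, Derivation.leibniz, ha, hX]
    have : d (3 : K) = 0 := by
      have := Derivation.map_natCast d 3
      exact_mod_cast this
    rw [this]
    simp only [smul_eq_mul]
    ring
  rw [ld3, map_sub, map_sub, Derivation.leibniz_pow, ha, hd, der_div_mul d ht, h0, h3,
    show e * t4 / t = e * (t4 / t) by ring, h4]
  simp only [smul_eq_mul, nsmul_eq_mul, ld3]
  push_cast
  simp only [ld2]
  ring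

/-- The addition theorem, and the identity which makes the residue construction work. -/
theorem addition_identity (E E' : Derivation ℚ K K) {a b c h X Y Z X1 Y1 Z1 g u : K}
    (hXZ : X - Z ≠ 0) (hb : b = a + c + h) (hh : 2 * h * (X - Z) = X1 - Z1)
    (Ea : E a = -X) (Ec : E c = -Z) (EX : E X = X1) (EZ : E Z = Z1)
    (EX1 : E X1 = 6 * X ^ 2 - 24 * g * X + u) (EZ1 : E Z1 = 6 * Z ^ 2 - 24 * g * Z + u)
    (Eb : E b = -2 * Y) (EY : E Y = 2 * Y1) (Eg : E g = 0)
    (Ea' : E' a = -X) (Ec' : E' c = Z) (EX' : E' X = X1) (EZ' : E' Z = -Z1)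
    (EX1' : E' X1 = 6 * X ^ 2 - 24 * g * X + u)
    (EZ1' : E' Z1 = -(6 * Z ^ 2 - 24 * g * Z + u)) (Eb' : E' b = 0) :
    ((b ^ 3 - 3 * b * Y - Y1 + 6 * g * b) / 3 - (a ^ 3 - 3 * a * X - X1 + 6 * g * a) / 3 -
        (c ^ 3 - 3 * c * Z - Z1 + 6 * g * c) / 3) * (b - a) =
      ((b ^ 2 - Y) / 2 - (a ^ 2 - X) / 2) ^ 2 -
        ((c ^ 4 - 6 * c ^ 2 * Z - 4 * c * Z1 - 3 * Z ^ 2) / 4 + 3 * g * Z + 3 * g * c ^ 2 - u / 2 +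
          9 * g ^ 2) := by
  have : CharZero K := algebraRat.charZero K
  have d2 : ∀ (d : Derivation ℚ K K) (f : K), d (2 * f) = 2 * d f := by
    intro d f; rw [two_mul, map_add, two_mul]
  -- a, b, c are Θ'/Θ at x, x + z, z. E is ∂_x + ∂_z, under which x + z has derivative 2;
  -- differentiating the addition theorem along it expresses Y and Y1 by X, Z and h.
  have hE := congrArg E hh
  rw [Derivation.leibniz, d2, map_sub, map_sub, EX, EZ, EX1, EZ1] at hE
  simp only [smul_eq_mul] at hE
  have Eh : E h = 3 * (X + Z) - 12 * g - 2 * h ^ 2 := by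
    refine mul_left_cancel₀ (mul_ne_zero two_ne_zero hXZ) ?_
    linear_combination hE + 2 * h * hh
  have hY : Y = h ^ 2 - X - Z + 6 * g := by
    rw [hb, map_add, map_add, Ea, Ec, Eh] at Eb
    linear_combination (1 / 2 : K) * Eb
  have d6 : E (6 * g) = 0 := by
    rw [Derivation.leibniz, Eg]
    have : E (6 : K) = 0 := by exact_mod_cast Derivation.map_natCast E 6
    rw [this]; simp
  have hY1 : Y1 = h * (3 * (X + Z) - 12 * g - 2 * h ^ 2) - (X1 + Z1) / 2 := by
    rw [hY, map_add, map_sub, map_sub, Derivation.leibniz_pow, EX, EZ, Eh, d6] at EY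
    simp only [smul_eq_mul, nsmul_eq_mul] at EY
    push_cast at EY
    linear_combination -(1 / 2 : K) * EY
  -- E' is ∂_x − ∂_z, which kills every function of x + z. It supplies the last relation among X, Z,
  -- Z1 and h; the claim is a quarter of it.
  have Eh' : E' h = X - Z := by
    rw [hb, map_add, map_add, Ea', Ec'] at Eb'
    linear_combination Eb'
  have hE' := congrArg E' hh
  rw [Derivation.leibniz, d2, map_sub, map_sub, EX', EZ', EX1', EZ1', Eh'] at hE'
  simp only [smul_eq_mul] at hE'
  have hX1 : X1 = Z1 + 2 * h * (X - Z) := by linear_combination -hh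
  rw [hX1] at hE'
  rw [hb, hY, hY1, hX1]
  linear_combination (1 / 4 : K) * hE'

end FieldIdentities

/-! ### The functions `M` and `U` -/

/-- `Θ / z`. -/
def Uz : ℚ⟦X⟧⟦X⟧ := PowerSeries.mk fun n => coeff (n + 1) Th

theorem X_mul_Uz : X * Uz = Th := by
  ext1 n
  cases n with
  | zero => rw [coeff_zero_Th, coeff_zero_X_mul]
  | succ n => rw [coeff_succ_X_mul, Uz, coeff_mk]

theorem constantCoeff_Uz : constantCoeff Uz = 1 := by
  rw [← coeff_zero_eq_constantCoeff_apply, Uz, coeff_mk, coeff_one_Th]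

/-- `z / Θ`. -/
def UzInv : ℚ⟦X⟧⟦X⟧ := invOfUnit Uz 1

theorem Uz_mul_UzInv : Uz * UzInv = 1 := mul_invOfUnit _ _ (by simpa using constantCoeff_Uz)

/-- Division by Θ is possible because Θ' has constant term 1, so DΘ' vanishes at z = 0, while Θ is z
times a unit. -/
theorem exists_Mz : ∃ M : ℚ⟦X⟧⟦X⟧, 3 * Th * M = 2 * DV (dX Th) := by
  have h : (X : ℚ⟦X⟧⟦X⟧) ∣ DV (dX Th) := by
    rw [X_dvd_iff, ← coeff_zero_eq_constantCoeff_apply, DV, coeff_coeffDer,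
      coeff_zero_eq_constantCoeff_apply, constantCoeff_dX_Th, Derivation.map_one_eq_zero]
  obtain ⟨W, hW⟩ := h
  refine ⟨C (C (2 / 3 : ℚ)) * W * UzInv, ?_⟩
  have h3 : (3 : ℚ⟦X⟧⟦X⟧) * C (C (2 / 3 : ℚ)) = 2 := by
    rw [show (3 : ℚ⟦X⟧⟦X⟧) = C (C (3 : ℚ)) by rw [map_ofNat, map_ofNat], ← map_mul, ← map_mul,
      show (3 : ℚ) * (2 / 3) = 2 by norm_num, map_ofNat, map_ofNat]
  rw [hW]
  conv_lhs => rw [← X_mul_Uz]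
  linear_combination X * W * Uz * UzInv * h3 + 2 * X * W * Uz_mul_UzInv

/-- `(2/3) D Θ' / Θ`. -/
def Mz : ℚ⟦X⟧⟦X⟧ := exists_Mz.choose

theorem Mz_spec : 3 * Th * Mz = 2 * DV (dX Th) := exists_Mz.choose_spec

theorem Th_mul_Mz : 3 * Th * Mz = dX (dX (dX Th)) + 6 * C (G 2) * dX Th := by
  have h := congrArg dX heat_Th
  have h2 : dX (2 : ℚ⟦X⟧⟦X⟧) = 0 := by exact_mod_cast Derivation.map_natCast dX 2
  have h6 : dX (6 : ℚ⟦X⟧⟦X⟧) = 0 := by exact_mod_cast Derivation.map_natCast dX 6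
  simp only [map_add, Derivation.leibniz, dX_C, smul_eq_mul, h2, h6, dX_DV, mul_zero, add_zero] at h
  rw [Mz_spec, h]

theorem uInv_eq_eulerDer : uInv = -12 * eulerDer (G 2) := by
  rw [uInv_eq, coeff_three_Th]
  linear_combination 6 * heat_five

theorem four_mul_DV_DV_Th : 4 * DV (DV Th) = dX (dX (dX (dX Th))) +
    12 * C (G 2) * dX (dX Th) + (36 * C (G 2) ^ 2 - C uInv) * Th := by
  have h := congrArg DV heat_Th
  have h1 := congrArg dX (congrArg dX heat_Th)
  have h2 : dX (2 : ℚ⟦X⟧⟦X⟧) = 0 := by exact_mod_cast Derivation.map_natCast dX 2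
  have h6 : dX (6 : ℚ⟦X⟧⟦X⟧) = 0 := by exact_mod_cast Derivation.map_natCast dX 6
  have k2 : DV (2 : ℚ⟦X⟧⟦X⟧) = 0 := by exact_mod_cast Derivation.map_natCast DV 2
  have k6 : DV (6 : ℚ⟦X⟧⟦X⟧) = 0 := by exact_mod_cast Derivation.map_natCast DV 6
  simp only [map_add, Derivation.leibniz, dX_C, smul_eq_mul, h2, h6, dX_DV, mul_zero,
    add_zero] at h1
  simp only [map_add, Derivation.leibniz, smul_eq_mul, k2, k6, mul_zero, add_zero, DV_C] at h
  have hu : C uInv = -12 * C (eulerDer (G 2)) := by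
    rw [uInv_eq_eulerDer, map_mul, map_neg, map_ofNat]
  rw [hu]
  linear_combination 2 * h + h1 + 6 * C (G 2) * heat_Th

/-- M is a z-primitive of DL up to a series in q alone. This turns the error term in `DS_DS_gz_pow`
into an exact x-derivative. -/
theorem dX_Mz : 6 * dX Mz = 6 * DV Lz + C uInv := by
  have hL := congrArg DV DV_Th
  have hM := congrArg dX Th_mul_Mz
  have h3 : dX (3 : ℚ⟦X⟧⟦X⟧) = 0 := by exact_mod_cast Derivation.map_natCast dX 3
  have h6 : dX (6 : ℚ⟦X⟧⟦X⟧) = 0 := by exact_mod_cast Derivation.map_natCast dX 6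
  simp only [map_add, Derivation.leibniz, dX_C, smul_eq_mul, h3, h6, mul_zero, add_zero] at hM
  simp only [Derivation.leibniz, smul_eq_mul] at hL
  have hq := quartic_Th
  rw [Pz] at hq
  refine mul_left_cancel₀ (pow_ne_zero 2 Th_ne_zero) ?_
  have h2 : (2 : ℚ⟦X⟧⟦X⟧) ≠ 0 := fun h => by
    simpa using natCast_mul_eq_zero (A := ℚ⟦X⟧⟦X⟧) two_ne_zero (a := 1) (by simpa using h)
  refine mul_left_cancel₀ h2 ?_
  linear_combination 4 * Th * hM - 4 * dX Th * Th_mul_Mz + 12 * Th * hL - 3 * Th * four_mul_DV_DV_Th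
    - 12 * DV Th * DV_Th + 3 * (2 * DV Th + dX (dX Th) + 6 * C (G 2) * Th) * heat_Th - hq

/-! ### The residue identity -/

section Logarithmic

/-- Derivatives of `Θ` in the fraction field. -/
def fracTh (φ : ℚ⟦X⟧⟦X⟧ →+* XZ) (n : ℕ) : FractionRing XZ :=
  algebraMap XZ (FractionRing XZ) (φ (dX^[n] Th))

/-- The constants in the fraction field. -/
def fracQ (c : ℚ⟦X⟧) : FractionRing XZ := algebraMap XZ (FractionRing XZ) (inQ c)

theorem fracDer_fracTh {φ : ℚ⟦X⟧⟦X⟧ →+* XZ} {d : Derivation ℚ XZ XZ} {e : ℤ}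
    (h : ∀ f, d (φ f) = e * φ (dX f)) (n : ℕ) :
    fracDer d (fracTh φ n) = e * fracTh φ (n + 1) := by
  rw [fracTh, fracDer_algebraMap, h, map_mul, map_intCast, fracTh, Function.iterate_succ_apply']

theorem fracTh_quartic {φ : ℚ⟦X⟧⟦X⟧ →+* XZ} (hC : ∀ c, φ (C c) = inQ c) :
    4 * fracTh φ 1 * fracTh φ 3 - 3 * fracTh φ 2 ^ 2 - fracTh φ 0 * fracTh φ 4 +
    24 * fracQ (G 2) * (fracTh φ 1 ^ 2 - fracTh φ 0 * fracTh φ 2) = fracQ uInv * fracTh φ 0 ^ 2 := by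
  have h := congrArg (fun f => algebraMap XZ (FractionRing XZ) (φ f)) quartic_Th
  simp only [Pz, map_add, map_sub, map_mul, map_pow, map_ofNat, hC] at h
  exact h

/-- `Θ' / Θ`. -/
def logA (φ : ℚ⟦X⟧⟦X⟧ →+* XZ) : FractionRing XZ := ld1 (fracTh φ 0) (fracTh φ 1)

/-- `-(Θ' / Θ)'`. -/
def logB (φ : ℚ⟦X⟧⟦X⟧ →+* XZ) : FractionRing XZ := ld2 (fracTh φ 0) (fracTh φ 1) (fracTh φ 2)

/-- `-(Θ' / Θ)''`. -/
def logC (φ : ℚ⟦X⟧⟦X⟧ →+* XZ) : FractionRing XZ :=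
  ld3 (fracTh φ 0) (fracTh φ 1) (fracTh φ 2) (fracTh φ 3)

variable {φ : ℚ⟦X⟧⟦X⟧ →+* XZ} {d : Derivation ℚ XZ XZ} {e : ℤ}

theorem fracDer_logA (h0 : fracTh φ 0 ≠ 0) (h : ∀ f, d (φ f) = e * φ (dX f)) :
    fracDer d (logA φ) = -e * logB φ :=
  der_ld1 _ _ h0 (fracDer_fracTh h 0) (fracDer_fracTh h 1)

theorem fracDer_logB (h0 : fracTh φ 0 ≠ 0) (h : ∀ f, d (φ f) = e * φ (dX f)) :
    fracDer d (logB φ) = e * logC φ :=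
  der_ld2 _ _ h0 (fracDer_fracTh h 0) (fracDer_fracTh h 1) (fracDer_fracTh h 2)

theorem fracDer_logC (hC : ∀ c, φ (C c) = inQ c) (h0 : fracTh φ 0 ≠ 0)
    (h : ∀ f, d (φ f) = e * φ (dX f)) :
    fracDer d (logC φ) = e * (6 * logB φ ^ 2 - 24 * fracQ (G 2) * logB φ + fracQ uInv) :=
  der_ld3 _ _ h0 (fracDer_fracTh h 0) (fracDer_fracTh h 1) (fracDer_fracTh h 2)
    (fracDer_fracTh h 3) (fracTh_quartic hC)

theorem frac_Lz (hC : ∀ c, φ (C c) = inQ c) (h0 : fracTh φ 0 ≠ 0) :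
    algebraMap XZ (FractionRing XZ) (φ Lz) = (logA φ ^ 2 - logB φ) / 2 + 3 * fracQ (G 2) := by
  have h := congrArg (fun f => algebraMap XZ (FractionRing XZ) (φ f)) heat_Th
  rw [DV_Th] at h
  simp only [map_add, map_mul, map_ofNat, hC] at h
  have h' : 2 * (algebraMap XZ (FractionRing XZ) (φ Lz) * fracTh φ 0) =
    fracTh φ 2 + 6 * fracQ (G 2) * fracTh φ 0 := h
  have : CharZero (FractionRing XZ) := algebraRat.charZero _
  rw [logA, logB, ld2, ld1]
  field_simp
  linear_combination fracTh φ 0 * h'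

theorem frac_Mz (hC : ∀ c, φ (C c) = inQ c) (h0 : fracTh φ 0 ≠ 0) :
    algebraMap XZ (FractionRing XZ) (φ Mz) =
      (logA φ ^ 3 - 3 * logA φ * logB φ - logC φ + 6 * fracQ (G 2) * logA φ) / 3 := by
  have h := congrArg (fun f => algebraMap XZ (FractionRing XZ) (φ f)) Th_mul_Mz
  simp only [map_add, map_mul, map_ofNat, hC] at h
  have h' : 3 * fracTh φ 0 * algebraMap XZ (FractionRing XZ) (φ Mz) =
    fracTh φ 3 + 6 * fracQ (G 2) * fracTh φ 1 := h
  have : CharZero (FractionRing XZ) := algebraRat.charZero _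
  rw [logA, logB, logC, ld3, ld2, ld1]
  field_simp
  linear_combination fracTh φ 0 ^ 2 * h'

theorem frac_Fz (hC : ∀ c, φ (C c) = inQ c) (h0 : fracTh φ 0 ≠ 0) :
    algebraMap XZ (FractionRing XZ) (φ Fz) =
      (logA φ ^ 4 - 6 * logA φ ^ 2 * logB φ - 4 * logA φ * logC φ - 3 * logB φ ^ 2) / 4 +
        3 * fracQ (G 2) * logB φ + 3 * fracQ (G 2) * logA φ ^ 2 - fracQ uInv / 2 +
        9 * fracQ (G 2) ^ 2 := by
  have h := congrArg (fun f => algebraMap XZ (FractionRing XZ) (φ f)) four_mul_DV_DV_Th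
  rw [← Fz_mul_Th] at h
  simp only [map_add, map_sub, map_mul, map_pow, map_ofNat, hC] at h
  have h' : 4 * (algebraMap XZ (FractionRing XZ) (φ Fz) * fracTh φ 0) =
    fracTh φ 4 + 12 * fracQ (G 2) * fracTh φ 2 +
      (36 * fracQ (G 2) ^ 2 - fracQ uInv) * fracTh φ 0 := h
  have hq := fracTh_quartic hC
  have : CharZero (FractionRing XZ) := algebraRat.charZero _
  rw [logA, logB, logC, ld3, ld2, ld1]
  field_simp
  linear_combination 2 * fracTh φ 0 ^ 3 * h' - 2 * fracTh φ 0 ^ 2 * hq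

end Logarithmic

theorem fracTh_inX_ne_zero : fracTh inX 0 ≠ 0 := by
  intro h
  rw [fracTh, map_eq_zero_iff _ (IsFractionRing.injective XZ _)] at h
  exact Th_ne_zero ((map_eq_zero_iff inX (PowerSeries.map_injective _ C_injective)).1 h)

theorem fracTh_inZ_ne_zero : fracTh inZ 0 ≠ 0 := by
  intro h
  rw [fracTh, map_eq_zero_iff _ (IsFractionRing.injective XZ _)] at h
  exact Th_ne_zero ((map_eq_zero_iff inZ C_injective).1 h)

theorem fracTh_inXZ_ne_zero : fracTh inXZ 0 ≠ 0 := by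
  intro h
  rw [fracTh, map_eq_zero_iff _ (IsFractionRing.injective XZ _)] at h
  have := congrArg constantCoeff h
  rw [constantCoeff_inXZ, map_zero] at this
  exact Th_ne_zero this

theorem fracTh_inZsubX_ne_zero : fracTh inZsubX 0 ≠ 0 := by
  intro h
  rw [fracTh, map_eq_zero_iff _ (IsFractionRing.injective XZ _)] at h
  have := congrArg constantCoeff h
  rw [constantCoeff_inZsubX, map_zero] at this
  exact Th_ne_zero this

theorem frac_addition : fracTh inXZ 0 * fracTh inZsubX 0 =
    fracTh inX 0 ^ 2 * fracTh inZ 0 ^ 2 * (logB inX - logB inZ) := by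
  have h := congrArg (algebraMap XZ (FractionRing XZ)) addition_formula
  simp only [Pz, map_sub, map_mul, map_pow] at h
  have h' : fracTh inXZ 0 * fracTh inZsubX 0 =
    (fracTh inX 1 ^ 2 - fracTh inX 0 * fracTh inX 2) * fracTh inZ 0 ^ 2 -
      fracTh inX 0 ^ 2 * (fracTh inZ 1 ^ 2 - fracTh inZ 0 * fracTh inZ 2) := h
  have h1 := fracTh_inX_ne_zero
  have h2 := fracTh_inZ_ne_zero
  rw [h', logB, logB, ld2, ld2]
  field_simp

theorem plus_inX (f : ℚ⟦X⟧⟦X⟧) : (ddx + ddz) (inX f) = (1 : ℤ) * inX (dX f) := by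
  rw [Derivation.add_apply, ddx_inX, ddz_inX]; push_cast; ring

theorem plus_inZ (f : ℚ⟦X⟧⟦X⟧) : (ddx + ddz) (inZ f) = (1 : ℤ) * inZ (dX f) := by
  rw [Derivation.add_apply, ddx_inZ, ddz_inZ]; push_cast; ring

theorem plus_inXZ (f : ℚ⟦X⟧⟦X⟧) : (ddx + ddz) (inXZ f) = (2 : ℤ) * inXZ (dX f) := by
  rw [Derivation.add_apply, ddx_inXZ, ddz_inXZ]; push_cast; ring

theorem plus_inZsubX (f : ℚ⟦X⟧⟦X⟧) : (ddx + ddz) (inZsubX f) = (0 : ℤ) * inZsubX (dX f) := by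
  rw [Derivation.add_apply, ddx_inZsubX, ddz_inZsubX]; push_cast; ring

theorem minus_inX (f : ℚ⟦X⟧⟦X⟧) : (ddx - ddz) (inX f) = (1 : ℤ) * inX (dX f) := by
  rw [Derivation.sub_apply, ddx_inX, ddz_inX]; push_cast; ring

theorem minus_inZ (f : ℚ⟦X⟧⟦X⟧) : (ddx - ddz) (inZ f) = (-1 : ℤ) * inZ (dX f) := by
  rw [Derivation.sub_apply, ddx_inZ, ddz_inZ]; push_cast; ring

theorem minus_inXZ (f : ℚ⟦X⟧⟦X⟧) : (ddx - ddz) (inXZ f) = (0 : ℤ) * inXZ (dX f) := by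
  rw [Derivation.sub_apply, ddx_inXZ, ddz_inXZ]; push_cast; ring

theorem fracDer_fracQ (c : ℚ⟦X⟧) : fracDer (ddx + ddz) (fracQ c) = 0 := by
  rw [fracQ, fracDer_algebraMap, ← inX_C, plus_inX, dX_C, map_zero, mul_zero, map_zero]

theorem logB_sub_ne_zero : logB inX - logB inZ ≠ 0 := by
  intro h
  have := frac_addition
  rw [h, mul_zero] at this
  exact mul_ne_zero fracTh_inXZ_ne_zero fracTh_inZsubX_ne_zero this

/-- The addition theorem for `Θ' / Θ`. -/
theorem logA_addition : 2 * (logA inXZ - logA inX - logA inZ) * (logB inX - logB inZ) =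
    logC inX - logC inZ := by
  have hx := fracTh_inX_ne_zero
  have hz := fracTh_inZ_ne_zero
  have hy := fracTh_inXZ_ne_zero
  have h := frac_addition
  -- Along ∂_x + ∂_z the factor Θ(z − x) is constant, so only the logarithmic derivative at x + z
  -- appears on the left.
  have hd := congrArg (fracDer (ddx + ddz)) h
  rw [Derivation.leibniz, Derivation.leibniz, Derivation.leibniz, Derivation.leibniz_pow,
    Derivation.leibniz_pow, map_sub, fracDer_fracTh plus_inXZ, fracDer_fracTh plus_inZsubX,
    fracDer_fracTh plus_inX, fracDer_fracTh plus_inZ, fracDer_logB hx plus_inX,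
    fracDer_logB hz plus_inZ] at hd
  have ey : fracTh inXZ 1 = logA inXZ * fracTh inXZ 0 := (div_mul_cancel₀ _ hy).symm
  have ex : fracTh inX 1 = logA inX * fracTh inX 0 := (div_mul_cancel₀ _ hx).symm
  have ez : fracTh inZ 1 = logA inZ * fracTh inZ 0 := (div_mul_cancel₀ _ hz).symm
  simp only [zero_add, ex, ey, ez, smul_eq_mul, nsmul_eq_mul] at hd
  push_cast at hd
  refine mul_left_cancel₀ (mul_ne_zero (pow_ne_zero 2 hx) (pow_ne_zero 2 hz)) ?_
  linear_combination hd - 2 * logA inXZ * h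

/-- The factor `logA inXZ - logA inX` is ∂_x log(Θ(x+z)/Θ(x)). Expressing L, M and F by logarithmic
derivatives of Θ makes this an instance of `addition_identity`; the constants 3G₂ of L cancel in the
difference. -/
theorem frac_residue_identity :
    algebraMap XZ (FractionRing XZ) (inXZ Mz - inX Mz - inZ Mz) * (logA inXZ - logA inX) =
      algebraMap XZ (FractionRing XZ) ((inXZ Lz - inX Lz) ^ 2 - inZ Fz) := by
  have hx := fracTh_inX_ne_zero
  have hz := fracTh_inZ_ne_zero
  have hy := fracTh_inXZ_ne_zero
  simp only [map_sub, map_pow, frac_Mz inX_C hx, frac_Mz inZ_C hz, frac_Mz inXZ_C hy,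
    frac_Lz inX_C hx, frac_Lz inXZ_C hy, frac_Fz inZ_C hz]
  have := addition_identity (fracDer (ddx + ddz)) (fracDer (ddx - ddz)) (a := logA inX)
    (b := logA inXZ) (c := logA inZ) (X := logB inX) (Y := logB inXZ) (Z := logB inZ)
    (X1 := logC inX) (Y1 := logC inXZ) (Z1 := logC inZ) (g := fracQ (G 2)) (u := fracQ uInv)
    (h := logA inXZ - logA inX - logA inZ) logB_sub_ne_zero (by ring) logA_addition
    (by simpa using fracDer_logA hx plus_inX) (by simpa using fracDer_logA hz plus_inZ)
    (by simpa using fracDer_logB hx plus_inX) (by simpa using fracDer_logB hz plus_inZ)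
    (by simpa using fracDer_logC inX_C hx plus_inX) (by simpa using fracDer_logC inZ_C hz plus_inZ)
    (by simpa using fracDer_logA hy plus_inXZ) (by simpa using fracDer_logB hy plus_inXZ)
    (fracDer_fracQ _)
    (by simpa using fracDer_logA hx minus_inX) (by simpa using fracDer_logA hz minus_inZ)
    (by simpa using fracDer_logB hx minus_inX) (by simpa using fracDer_logB hz minus_inZ)
    (by simpa using fracDer_logC inX_C hx minus_inX)
    (by simpa using fracDer_logC inZ_C hz minus_inZ)
    (by simpa using fracDer_logA hy minus_inXZ)
  linear_combination this

/-- The function `x Θ(x + z) / Θ(x)`. -/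
def gz : XZ := inXZ Th * inX UzInv

theorem inX_X : inX X = X := PowerSeries.map_X _

theorem gz_mul : gz * inX Th = X * inXZ Th := by
  have h : inX Th * inX UzInv = X := by
    rw [← map_mul, ← X_mul_Uz, mul_assoc, Uz_mul_UzInv, mul_one, inX_X]
  rw [gz, mul_assoc, mul_comm (inX UzInv), h, mul_comm]

theorem ddx_X : ddx X = 1 := dX_X

/-- This clears denominators: for y = gz/x one has x·∂_x gz − gz = x·gz·∂_x log y. It returns the
identity from the fraction field to power series. -/
theorem residue_identity : (inXZ Mz - inX Mz - inZ Mz) * (X * ddx gz - gz) =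
    X * gz * ((inXZ Lz - inX Lz) ^ 2 - inZ Fz) := by
  have hx := fracTh_inX_ne_zero
  have hy := fracTh_inXZ_ne_zero
  have hd := congrArg ddx gz_mul
  rw [Derivation.leibniz, Derivation.leibniz, ddx_inX, ddx_inXZ, ddx_X] at hd
  simp only [smul_eq_mul, mul_one] at hd
  have e : (X * ddx gz - gz) * (inX Th * inXZ Th) =
      X * gz * (inXZ (dX Th) * inX Th - inX (dX Th) * inXZ Th) := by
    linear_combination X * inXZ Th * hd - (X * inXZ (dX Th) + inXZ Th) * gz_mul
  have e' : algebraMap XZ (FractionRing XZ) (X * ddx gz - gz) =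
      algebraMap XZ (FractionRing XZ) (X * gz) * (logA inXZ - logA inX) := by
    have e2 := congrArg (algebraMap XZ (FractionRing XZ)) e
    rw [map_mul, map_mul, map_mul _ (X * gz), map_sub _ (inXZ (dX Th) * inX Th),
      map_mul _ (inXZ (dX Th)), map_mul _ (inX (dX Th))] at e2
    have e3 : algebraMap XZ (FractionRing XZ) (X * ddx gz - gz) * (fracTh inX 0 * fracTh inXZ 0) =
      algebraMap XZ (FractionRing XZ) (X * gz) *
        (fracTh inXZ 1 * fracTh inX 0 - fracTh inX 1 * fracTh inXZ 0) := e2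
    rw [logA, logA, ld1, ld1]
    field_simp
    linear_combination e3
  refine IsFractionRing.injective XZ (FractionRing XZ) ?_
  rw [map_mul, map_mul _ (X * gz), e', ← frac_residue_identity]
  ring

/-! ### Solutions of the differential equation -/

theorem inX_Th_ne_zero : inX Th ≠ 0 := fun h =>
  Th_ne_zero ((map_eq_zero_iff inX (PowerSeries.map_injective _ C_injective)).1 h)

theorem DS_gz : DS gz = gz * (inXZ Lz - inX Lz) := by
  have h := congrArg DS gz_mul
  have hX : DS X = 0 := coeffDer_X _
  rw [Derivation.leibniz, Derivation.leibniz, DS_inX, DS_inXZ, DV_Th, hX, map_mul, map_mul] at h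
  simp only [smul_eq_mul, mul_zero, add_zero] at h
  refine mul_right_cancel₀ inX_Th_ne_zero ?_
  linear_combination h - inXZ Lz * gz_mul

theorem ddx_Mz : ddx (inXZ Mz - inX Mz - inZ Mz) = DS (inXZ Lz - inX Lz) := by
  have h1 := congrArg inXZ dX_Mz
  have h2 := congrArg inX dX_Mz
  simp only [map_add, map_mul, map_ofNat, inX_C, inXZ_C] at h1 h2
  rw [map_sub, map_sub, map_sub, ddx_inXZ, ddx_inX, ddx_inZ, DS_inXZ, DS_inX, ← sub_eq_zero]
  refine natCast_mul_eq_zero (n := 6) (by norm_num) ?_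
  push_cast
  linear_combination h1 - h2

/-- With m = n + 1, y = gz/x and R = M(x+z) − M(x) − M(z), this is D²(y^m) = m² F(z) y^m + m ∂_x(R
y^m) multiplied by x^{m+1}. -/
theorem DS_DS_gz_pow (n : ℕ) : X * DS (DS (gz ^ (n + 1))) =
    X * (((n + 1 : ℕ) : XZ) ^ 2 * inZ Fz * gz ^ (n + 1)) +
      ((n + 1 : ℕ) : XZ) * (X * ddx ((inXZ Mz - inX Mz - inZ Mz) * gz ^ (n + 1)) -
        ((n + 1 : ℕ) : XZ) * ((inXZ Mz - inX Mz - inZ Mz) * gz ^ (n + 1))) := by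
  have hn : DS ((n + 1 : ℕ) : XZ) = 0 := Derivation.map_natCast _ _
  have h1 : DS (gz ^ (n + 1)) = ((n + 1 : ℕ) : XZ) * (gz ^ (n + 1) * (inXZ Lz - inX Lz)) := by
    rw [Derivation.leibniz_pow, DS_gz, nsmul_eq_mul, smul_eq_mul, Nat.add_sub_cancel, pow_succ]
    ring
  have h2 : ddx (gz ^ (n + 1)) = ((n + 1 : ℕ) : XZ) * (gz ^ n * ddx gz) := by
    rw [Derivation.leibniz_pow, nsmul_eq_mul, smul_eq_mul, Nat.add_sub_cancel]
  rw [h1, Derivation.leibniz, Derivation.leibniz, h1, hn, Derivation.leibniz, h2, ddx_Mz]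
  simp only [smul_eq_mul, mul_zero, add_zero]
  linear_combination -((n + 1 : ℕ) : XZ) ^ 2 * gz ^ n * residue_identity

/-- The residue of a derivative is zero: the series is x^{n+2} times ∂_x(x^{−(n+1)} f). -/
theorem coeff_succ_X_mul_ddx (n : ℕ) (f : XZ) :
    coeff (n + 1) (X * ddx f - ((n + 1 : ℕ) : XZ) * f) = 0 := by
  rw [map_sub, coeff_succ_X_mul, ddx, coeff_dX, ← map_natCast (C (R := ℚ⟦X⟧⟦X⟧)), coeff_C_mul]
  push_cast
  ring

/-- The residue of `(Θ(x + z) / Θ(x)) ^ (n + 1)` at `x = 0`. -/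
def residue (n : ℕ) : ℚ⟦X⟧⟦X⟧ := coeff n (gz ^ (n + 1))

theorem DV_DV_residue (n : ℕ) :
    DV (DV (residue n)) = ((n + 1 : ℕ) : ℚ⟦X⟧⟦X⟧) ^ 2 * Fz * residue n := by
  have h := congrArg (coeff (n + 1)) (DS_DS_gz_pow n)
  rw [map_add, coeff_succ_X_mul, coeff_succ_X_mul, ← map_natCast (C (R := ℚ⟦X⟧⟦X⟧)), coeff_C_mul,
    map_natCast, coeff_succ_X_mul_ddx, mul_zero, add_zero, DS, coeff_coeffDer, coeff_coeffDer, inZ,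
    ← map_natCast (C (R := ℚ⟦X⟧⟦X⟧)), ← map_pow, ← map_mul, coeff_C_mul] at h
  exact h

/-! ### The value at `q = 0` -/

/-- The substitution `q = 0`. -/
def qZero : ℚ⟦X⟧⟦X⟧ →+* ℚ⟦X⟧ := PowerSeries.map constantCoeff

theorem qZero_zHom (f : HalfLaurent⟦X⟧) : qZero (zHom f) = substExp (constantCoeff f) := by
  ext k
  rw [qZero, coeff_map, ← coeff_zero_eq_constantCoeff_apply, coeff_coeff_zHom,
    coeff_zero_eq_constantCoeff_apply]

theorem qZero_Th : qZero Th = expo (1 / 2) - expo (-(1 / 2)) := by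
  rw [Th, qZero_zHom, constantCoeff_Theta, map_sub, substExp_T, substExp_T]
  norm_num

theorem qZero_zHom_phi (m : ℤ) : qZero (zHom (phi m)) = expo (m / 2) - expo (-(m / 2)) := by
  rw [qZero_zHom, (phi_isSolution m).2, map_sub, substExp_T, substExp_T]
  push_cast
  rw [neg_div]

theorem qZero_dX_iterate (n : ℕ) (f : ℚ⟦X⟧⟦X⟧) : qZero (dX^[n] f) = dX^[n] (qZero f) := by
  induction n generalizing f with
  | zero => rfl
  | succ n ih => rw [Function.iterate_succ_apply, ih, qZero, ← dX_map]; rfl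

theorem map_qZero_inXZ (f : ℚ⟦X⟧⟦X⟧) :
    PowerSeries.map qZero (inXZ f) = taylorSeries dX (qZero f) := by
  ext1 n
  rw [coeff_map, inXZ_apply, taylorSeries, taylorSeries, coeff_mk, coeff_mk, ratSMul_eq, map_mul,
    qZero_dX_iterate, smul_eq_C_mul]
  congr 1
  rw [qZero, map_C, constantCoeff_C]

theorem map_qZero_inX (f : ℚ⟦X⟧⟦X⟧) :
    PowerSeries.map qZero (inX f) = PowerSeries.map C (qZero f) := by
  ext1 n
  rw [coeff_map, inX, coeff_map, coeff_map, qZero, map_C, coeff_map]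

theorem taylorSeries_expo (c : ℚ) :
    taylorSeries dX (expo c) = PowerSeries.map C (expo c) * C (expo c) := by
  refine ext_of_transport dX ?_ ?_ ?_
  · rw [dX_taylorSeries, coeffDer_taylorSeries _ _ fun _ => rfl]
  · rw [Derivation.leibniz, Derivation.leibniz, dX_C, coeffDer_C, dX_map, dX_expo, map_mul, map_mul,
      map_C]
    have : coeffDer dX (PowerSeries.map C (expo c)) = 0 := by
      ext1 n
      rw [coeff_coeffDer, coeff_map, dX_C, map_zero]
    rw [this]
    simp only [smul_eq_mul]
    ring
  · rw [constantCoeff_taylorSeries, map_mul, constantCoeff_C]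
    have : constantCoeff (PowerSeries.map C (expo c) : ℚ⟦X⟧⟦X⟧) = 1 := by
      rw [← coeff_zero_eq_constantCoeff_apply, coeff_map, coeff_zero_eq_constantCoeff_apply,
        constantCoeff_expo, map_one]
    rw [this, one_mul]

theorem taylorSeries_sub {A : Type*} [CommRing A] [Algebra ℚ A] (d : Derivation ℚ A A) (f g : A) :
    taylorSeries d (f - g) = taylorSeries d f - taylorSeries d g := by
  rw [eq_sub_iff_add_eq, ← taylorSeries_add, sub_add_cancel]

/-- The generating series `x / (e ^ x - 1)`. -/
def bern : ℚ⟦X⟧ := qZero UzInv * expo (-(1 / 2))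

/-! ### Residues of powers of 1/(e^x − 1) and the limit q = 0 -/

theorem qZero_UzInv_mul : qZero UzInv * (expo (1 / 2) - expo (-(1 / 2))) = X := by
  rw [← qZero_Th, ← X_mul_Uz, map_mul, mul_left_comm, ← map_mul, mul_comm UzInv, Uz_mul_UzInv,
    map_one, mul_one, qZero, PowerSeries.map_X]

theorem bern_mul : bern * (expo 1 - 1) = X := by
  have h := qZero_UzInv_mul
  have h1 : expo (-(1 / 2)) * expo 1 = expo (1 / 2) := by rw [expo_mul]; norm_num
  rw [bern]
  linear_combination h + qZero UzInv * h1

theorem eulerDer_bern : X * dX bern = bern - X * bern - bern ^ 2 := by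
  have h := bern_mul
  have hd := congrArg dX h
  rw [Derivation.leibniz, map_sub, dX_expo, Derivation.map_one_eq_zero, dX_X, map_one] at hd
  simp only [smul_eq_mul, one_mul, sub_zero] at hd
  linear_combination bern * hd - (dX bern + bern) * h

/-- This is the residue of y^{n+1} for y = 1/(e^x − 1). From y' = −y − y² one gets (y^m)' = −m(y^m +
y^{m+1}), so consecutive residues are opposite. -/
theorem coeff_bern_pow (n : ℕ) : coeff n (bern ^ (n + 1)) = (-1) ^ n := by
  induction n with
  | zero =>
    have h := congrArg (coeff 1) bern_mul
    rw [coeff_mul, Nat.sum_antidiagonal_eq_sum_range_succ_mk, Finset.sum_range_succ,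
      Finset.sum_range_one] at h
    simp only [Nat.sub_zero, Nat.sub_self, map_sub, coeff_expo] at h
    simpa using h
  | succ n ih =>
    have h : X * dX (bern ^ (n + 1)) =
        ((n + 1 : ℕ) : ℚ⟦X⟧) * (bern ^ (n + 1) - X * bern ^ (n + 1) - bern ^ (n + 2)) := by
      rw [Derivation.leibniz_pow, nsmul_eq_mul, smul_eq_mul, Nat.add_sub_cancel]
      linear_combination ((n + 1 : ℕ) : ℚ⟦X⟧) * bern ^ n * eulerDer_bern
    have hc := congrArg (coeff (n + 1)) h
    rw [coeff_succ_X_mul, coeff_dX, ← map_natCast (C (R := ℚ)), coeff_C_mul, map_sub, map_sub,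
      coeff_succ_X_mul, ih] at hc
    have hn : ((n : ℚ) + 1) ≠ 0 := by positivity
    refine mul_left_cancel₀ hn ?_
    push_cast at hc
    linear_combination hc

/-- At q = 0 the quotient Θ(x+z)/Θ(x) is e^{z/2} + (e^{z/2} − e^{−z/2})/(e^x − 1); the formula is x
times this. -/
theorem map_qZero_gz : PowerSeries.map qZero gz = X * C (expo (1 / 2)) +
    PowerSeries.map C bern * C (expo (1 / 2) - expo (-(1 / 2))) := by
  have h1 : bern + X = qZero UzInv * expo (1 / 2) := by
    rw [← qZero_UzInv_mul, bern]; ring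
  have h1' := congrArg (PowerSeries.map (C (R := ℚ))) h1
  rw [map_add, map_mul, PowerSeries.map_X] at h1'
  rw [gz, map_mul, map_qZero_inXZ, map_qZero_inX, qZero_Th, taylorSeries_sub, taylorSeries_expo,
    taylorSeries_expo, map_sub C]
  have h2 : PowerSeries.map (C (R := ℚ)) bern =
    PowerSeries.map C (qZero UzInv) * PowerSeries.map C (expo (-(1 / 2))) := by rw [bern, map_mul]
  linear_combination C (expo (-(1 / 2))) * h2 - C (expo (1 / 2)) * h1'

theorem qZero_residue (n : ℕ) :
    qZero (residue n) = expo ((n + 1 : ℕ) / 2) - expo (-((n + 1 : ℕ) / 2)) := by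
  set a := expo (1 / 2) with ha
  set b := expo (1 / 2) - expo (-(1 / 2)) with hb
  have hpow : ∀ (c : ℚ) (k : ℕ), expo c ^ k = expo (k * c) := by
    intro c k
    induction k with
    | zero => simp [expo_zero]
    | succ k ih => rw [pow_succ, ih, expo_mul]; push_cast; ring_nf
  have e1 : expo ((n + 1 : ℕ) / 2) = a ^ (n + 1) := by rw [ha, hpow]; congr 1; ring
  have e2 : expo (-((n + 1 : ℕ) / 2)) = (a + -b) ^ (n + 1) := by
    rw [ha, hb, show expo (1 / 2) + -(expo (1 / 2) - expo (-(1 / 2))) = expo (-(1 / 2)) by ring, hpow]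
    congr 1; ring
  have h : qZero (residue n) = coeff n ((X * C a + PowerSeries.map C bern * C b) ^ (n + 1)) := by
    rw [← map_qZero_gz, ← map_pow, coeff_map]; rfl
  rw [h, e1, e2, add_pow, add_pow, map_sum, Finset.sum_range_succ,
    Finset.sum_range_succ _ (n + 1)]
  -- The top binomial term has no pole in x. The other terms give −a^k(−b)^{n+1−k} with binomial
  -- weights, so the sum is a^{n+1} − (a − b)^{n+1}, where a − b = e^{−z/2}.
  have hlast : coeff n ((X * C a) ^ (n + 1) * (PowerSeries.map (C (R := ℚ)) bern * C b) ^
      (n + 1 - (n + 1)) * ((n + 1).choose (n + 1) : ℚ⟦X⟧⟦X⟧)) = 0 := by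
    rw [Nat.sub_self, Nat.choose_self, pow_zero, Nat.cast_one, mul_one, mul_one, mul_pow,
      coeff_X_pow_mul', if_neg (by omega)]
  have hsum : ∀ k ∈ Finset.range (n + 1), coeff n ((X * C a) ^ k *
      (PowerSeries.map (C (R := ℚ)) bern * C b) ^ (n + 1 - k) * ((n + 1).choose k : ℚ⟦X⟧⟦X⟧)) =
      -(a ^ k * (-b) ^ (n + 1 - k) * ((n + 1).choose k : ℚ⟦X⟧)) := by
    intro k hk
    obtain ⟨j, rfl⟩ : ∃ j, n = k + j := ⟨n - k, by have := Finset.mem_range.1 hk; omega⟩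
    rw [show k + j + 1 - k = j + 1 by omega, mul_pow, mul_pow, ← map_pow, ← map_pow, ← map_pow,
      show X ^ k * C (a ^ k) * (PowerSeries.map (C (R := ℚ)) (bern ^ (j + 1)) * C (b ^ (j + 1))) *
        (((k + j + 1).choose k : ℕ) : ℚ⟦X⟧⟦X⟧) = X ^ k * (C (a ^ k * b ^ (j + 1) *
        (((k + j + 1).choose k : ℕ) : ℚ⟦X⟧)) * PowerSeries.map (C (R := ℚ)) (bern ^ (j + 1))) by
        rw [map_mul, map_mul, map_natCast]; ring, coeff_X_pow_mul', if_pos (by omega),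
      show k + j - k = j by omega, coeff_C_mul, coeff_map, coeff_bern_pow]
    rw [map_pow, map_neg, map_one, neg_pow b, pow_succ (-1 : ℚ⟦X⟧)]
    ring
  rw [hlast, Finset.sum_congr rfl hsum, Finset.sum_neg_distrib]
  simp

/-! ### Identification of the solutions -/

/-- As H has no constant term, n² times the n-th coefficient of f involves earlier coefficients
only. -/
theorem eq_zero_of_second_order {A : Type*} [CommRing A] [Algebra ℚ A] {f H : A⟦X⟧}
    (h : eulerDer (eulerDer f) = H * f) (hH : constantCoeff H = 0) (h0 : constantCoeff f = 0) :
    f = 0 := by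
  ext n
  rw [map_zero]
  induction n using Nat.strong_induction_on with
  | _ n ih =>
    rcases Nat.eq_zero_or_pos n with rfl | hn
    · rw [coeff_zero_eq_constantCoeff_apply, h0]
    · have hc := congrArg (coeff n) h
      rw [coeff_eulerDer, coeff_eulerDer, coeff_mul] at hc
      rw [Finset.sum_eq_zero] at hc
      · exact natCast_mul_eq_zero hn.ne' (natCast_mul_eq_zero hn.ne' hc)
      · rintro ⟨i, j⟩ hij
        rw [HasAntidiagonal.mem_antidiagonal] at hij
        simp only at hij ⊢
        rcases Nat.eq_zero_or_pos i with rfl | hi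
        · rw [coeff_zero_eq_constantCoeff_apply, hH, zero_mul]
        · rw [ih j (by omega), mul_zero]

theorem swapHom_swapHom {A : Type*} [CommRing A] (f : A⟦X⟧⟦X⟧) : swapHom (swapHom f) = f := by
  ext k n
  rw [coeff_coeff_swapHom, coeff_coeff_swapHom]

theorem constantCoeff_swapHom (f : ℚ⟦X⟧⟦X⟧) : constantCoeff (swapHom f) = qZero f := by
  ext k
  rw [← coeff_zero_eq_constantCoeff_apply, coeff_coeff_swapHom, qZero, coeff_map,
    coeff_zero_eq_constantCoeff_apply]

theorem eq_of_DV_DV {f g H : ℚ⟦X⟧⟦X⟧} (hf : DV (DV f) = H * f) (hg : DV (DV g) = H * g)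
    (hH : qZero H = 0) (h0 : qZero f = qZero g) : f = g := by
  have hk : DV (DV (f - g)) = H * (f - g) := by rw [map_sub, map_sub, hf, hg, mul_sub]
  have hk0 : qZero (f - g) = 0 := by rw [map_sub, h0, sub_self]
  rw [← sub_eq_zero]
  generalize f - g = k at hk hk0
  have e : eulerDer (eulerDer (swapHom k)) = swapHom H * swapHom k := by
    rw [← map_mul, ← hk, DV, ← swapHom_swapHom (eulerDer (eulerDer (swapHom k))), swapHom_eulerDer,
      swapHom_eulerDer, swapHom_swapHom]
  have := eq_zero_of_second_order e (by rw [constantCoeff_swapHom, hH])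
    (by rw [constantCoeff_swapHom, hk0])
  rw [← swapHom_swapHom k, this, map_zero]

theorem qZero_Fz : qZero Fz = 0 := by
  rw [Fz, qZero_zHom, constantCoeff_F, map_zero]

theorem DV_DV_zHom_phi (m : ℤ) :
    DV (DV (zHom (phi m))) = (m : ℚ⟦X⟧⟦X⟧) ^ 2 * Fz * zHom (phi m) := by
  rw [DV_zHom, DV_zHom, (phi_isSolution m).1, map_mul, map_mul, map_pow, map_intCast, Fz]

/-- Only positive m are needed: the closed form is used solely to find the weights of infinitely
many values. -/
theorem zHom_phi_eq_residue (n : ℕ) : zHom (phi (n + 1 : ℕ)) = residue n := by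
  refine eq_of_DV_DV (DV_DV_zHom_phi _) (DV_DV_residue n) ?_ ?_
  · rw [map_mul, qZero_Fz, mul_zero]
  · rw [qZero_zHom_phi, qZero_residue]
    push_cast
    rfl

/-! ### Weights of the solutions -/

theorem inX_mem {w : ℤ} {f : ℚ⟦X⟧⟦X⟧} (hf : f ∈ seriesGrading QZ w) :
    inX f ∈ seriesGrading (seriesGrading QZ) w := by
  intro i
  rw [inX, coeff_map]
  exact C_mem_seriesGrading (hf i)

theorem dX_iterate_mem {w : ℤ} {f : ℚ⟦X⟧⟦X⟧} (hf : f ∈ seriesGrading QZ w) (i : ℕ) :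
    dX^[i] f ∈ seriesGrading QZ (w + i) := by
  induction i with
  | zero => simpa using hf
  | succ i ih =>
    rw [Function.iterate_succ_apply']
    have := dX_mem_seriesGrading ih
    push_cast
    rwa [← add_assoc]

theorem inXZ_mem {w : ℤ} {f : ℚ⟦X⟧⟦X⟧} (hf : f ∈ seriesGrading QZ w) :
    inXZ f ∈ seriesGrading (seriesGrading QZ) w := by
  intro i
  rw [inXZ_apply, taylorSeries, coeff_mk]
  exact Submodule.smul_mem _ _ (dX_iterate_mem hf i)

theorem UzInv_mem : UzInv ∈ seriesGrading QZ 0 := by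
  refine isGraded_QZ.inv_mem (f := Uz) ?_ constantCoeff_Uz Uz_mul_UzInv
  intro i
  rw [Uz, coeff_mk]
  have := Th_mem (i + 1)
  rwa [show (-1 : ℤ) + ((i + 1 : ℕ) : ℤ) = 0 + i by push_cast; ring] at this

theorem gz_mem : gz ∈ seriesGrading (seriesGrading QZ) (-1) :=
  isGraded_QZ.series.series.mul_mem (inXZ_mem Th_mem) (inX_mem UzInv_mem) (by norm_num)

/-- The power has weight −(n + 1), and extracting x^n adds n: the weight −1 does not depend on n. -/
theorem residue_mem (n : ℕ) : residue n ∈ seriesGrading QZ (-1) := by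
  have h := isGraded_QZ.series.series.pow_mem gz_mem (n + 1) rfl n
  rwa [show ((n + 1 : ℕ) : ℤ) * (-1) + n = -1 by push_cast; ring] at h

/-! ### Polynomials with values in a subspace -/

/-- Linear functionals vanishing on W separate A/W. Applied to the coefficients of p, each produces
a rational polynomial vanishing at every positive integer, hence zero. -/
theorem coeff_mem_of_eval_mem {A : Type*} [CommRing A] [Algebra ℚ A] (W : Submodule ℚ A)
    (p : Polynomial A) (h : ∀ n : ℕ, p.eval ((n + 1 : ℕ) : A) ∈ W) (j : ℕ) : p.coeff j ∈ W := by
  rw [← Submodule.Quotient.mk_eq_zero, ← Module.forall_dual_apply_eq_zero_iff ℚ]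
  intro l
  set L : A →ₗ[ℚ] ℚ := l.comp W.mkQ with hL
  set r : Polynomial ℚ := ∑ i ∈ Finset.range (p.natDegree + 1), Polynomial.monomial i (L (p.coeff i))
    with hr
  have hr0 : r = 0 := by
    refine Polynomial.eq_zero_of_infinite_isRoot r ?_
    refine Set.Infinite.mono (s := Set.range fun n : ℕ => ((n + 1 : ℕ) : ℚ)) ?_ ?_
    · rintro _ ⟨n, rfl⟩
      have h0 : L (p.eval ((n + 1 : ℕ) : A)) = 0 := by
        rw [hL, LinearMap.comp_apply, Submodule.mkQ_apply, (Submodule.Quotient.mk_eq_zero W).2 (h n),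
          map_zero]
      rw [Polynomial.eval_eq_sum_range, map_sum] at h0
      change r.eval _ = 0
      rw [hr, Polynomial.eval_finsetSum, ← h0]
      refine Finset.sum_congr rfl fun i _ => ?_
      rw [Polynomial.eval_monomial, mul_comm, mul_comm (p.coeff i), ← Nat.cast_pow, ← Nat.cast_pow,
        smul_natCast_eq _ (p.coeff i), map_smul, smul_eq_mul]
    · refine Set.infinite_range_of_injective fun a b hab => ?_
      simpa using hab
  by_cases hj : j ∈ Finset.range (p.natDegree + 1)
  · have hc := congrArg (fun s => Polynomial.coeff s j) hr0
    simp only [hr, Polynomial.finsetSum_coeff, Polynomial.coeff_monomial, Finset.sum_ite_eq',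
      if_pos hj, Polynomial.coeff_zero] at hc
    exact hc
  · have : p.coeff j = 0 := Polynomial.coeff_eq_zero_of_natDegree_lt (by simpa using hj)
    rw [this]
    simp

/-! ### The polynomials -/

/-- The right inverse of `D²`. -/
def invSq : ℚ⟦X⟧ →ₗ[ℚ] ℚ⟦X⟧ where
  -- At n = 0 the division by zero returns 0, so the constant term is dropped and restored
  -- separately in `eq_add_invSq`.
  toFun f := PowerSeries.mk fun n => coeff n f / (n : ℚ) ^ 2
  map_add' f g := by ext n; simp [add_div]
  map_smul' c f := by ext n; simp [mul_div_assoc]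

theorem eq_add_invSq (f : ℚ⟦X⟧) : f = C (constantCoeff f) + invSq (eulerDer (eulerDer f)) := by
  ext n
  rw [map_add, coeff_C]
  change _ = _ + coeff n (PowerSeries.mk fun n : ℕ => coeff n (eulerDer (eulerDer f)) / (n : ℚ) ^ 2)
  rw [coeff_mk, coeff_eulerDer, coeff_eulerDer]
  split_ifs with h
  · simp [h]
  · have : (n : ℚ) ≠ 0 := by exact_mod_cast h
    field_simp
    ring

/-- Coefficientwise application of `invSq`. -/
def polyInvSq (p : Polynomial ℚ⟦X⟧) : Polynomial ℚ⟦X⟧ :=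
  ∑ i ∈ Finset.range (p.natDegree + 1), Polynomial.monomial i (invSq (p.coeff i))

theorem coeff_polyInvSq (p : Polynomial ℚ⟦X⟧) (j : ℕ) :
    (polyInvSq p).coeff j = invSq (p.coeff j) := by
  simp only [polyInvSq, Polynomial.finsetSum_coeff, Polynomial.coeff_monomial, Finset.sum_ite_eq']
  split_ifs with h
  · rfl
  · rw [Polynomial.coeff_eq_zero_of_natDegree_lt (by simpa using h), map_zero]

theorem intCast_mul_eq_smul {A : Type*} [CommRing A] [Algebra ℚ A] (n : ℤ) (f : A) :
    (n : A) * f = (n : ℚ) • f := by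
  rw [Algebra.smul_def]; simp

theorem eval_polyInvSq (p : Polynomial ℚ⟦X⟧) (m : ℤ) :
    (polyInvSq p).eval (m : ℚ⟦X⟧) = invSq (p.eval (m : ℚ⟦X⟧)) := by
  rw [polyInvSq, Polynomial.eval_finsetSum, Polynomial.eval_eq_sum_range, map_sum]
  refine Finset.sum_congr rfl fun i _ => ?_
  rw [Polynomial.eval_monomial, ← Int.cast_pow, mul_comm, mul_comm (p.coeff i), intCast_mul_eq_smul,
    intCast_mul_eq_smul, map_smul]

/-- The coefficients of `e^{uz/2} - e^{-uz/2}` as a power series in `uz`. -/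
def sinhCoeff (k : ℕ) : ℚ := ((1 / 2) ^ k - (-(1 / 2)) ^ k) / k.factorial

theorem sinhCoeff_even {k : ℕ} (hk : Even k) : sinhCoeff k = 0 := by
  rw [sinhCoeff, hk.neg_pow, sub_self, zero_div]

/-- The polynomials `P_k`, with `P_k(m)` the coefficient of `z ^ k` in `φ_m`. -/
def polyP : ℕ → Polynomial ℚ⟦X⟧
  -- The z^k coefficient of the differential equation is D²P_k = u² Σ F_{k−i} P_i, and only i < k
  -- occurs because F has no z⁰ term; the monomial is the value at q = 0.
  | k => Polynomial.monomial k (C (sinhCoeff k)) + Polynomial.X ^ 2 *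
      polyInvSq (∑ i : Fin k, Polynomial.C (coeff (k - i) Fz) * polyP i)

theorem polyP_eq (k : ℕ) : polyP k = Polynomial.monomial k (C (sinhCoeff k)) + Polynomial.X ^ 2 *
    polyInvSq (∑ i ∈ Finset.range k, Polynomial.C (coeff (k - i) Fz) * polyP i) := by
  rw [polyP, Finset.sum_range]

/-! ### Parity, degree and divisibility of the polynomials -/

theorem coeff_eq_zero_of_evalNegHom_eq {f : ℚ⟦X⟧⟦X⟧} (h : evalNegHom f = f) {k : ℕ} (hk : Odd k) :
    coeff k f = 0 := by
  have := congrArg (coeff k) h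
  rw [evalNegHom, coeff_rescale, hk.neg_one_pow, neg_one_mul] at this
  refine natCast_mul_eq_zero (n := 2) (by norm_num) ?_
  push_cast
  linear_combination -this

theorem evalNegHom_Th : evalNegHom Th = -Th := by
  ext1 n
  rw [evalNegHom, coeff_rescale, map_neg]
  rcases Nat.even_or_odd n with hn | hn
  · rw [coeff_even_Th n hn]; simp
  · rw [hn.neg_one_pow, neg_one_mul]

/-- Θ is odd in z and so is D²Θ; their quotient F is even. -/
theorem coeff_odd_Fz {k : ℕ} (hk : Odd k) : coeff k Fz = 0 := by
  refine coeff_eq_zero_of_evalNegHom_eq ?_ hk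
  have h := congrArg evalNegHom Fz_mul_Th
  rw [map_mul, evalNegHom_Th, DV, ← coeffDer_evalNegHom, ← coeffDer_evalNegHom, evalNegHom_Th,
    map_neg, map_neg, ← DV, ← Fz_mul_Th] at h
  refine mul_right_cancel₀ Th_ne_zero ?_
  linear_combination -h

theorem coeff_zero_Fz : coeff 0 Fz = 0 := by
  have h := congrArg (coeff 1) Fz_mul_Th
  rw [DV, coeff_coeffDer, coeff_coeffDer, coeff_one_Th, Derivation.map_one_eq_zero, map_zero,
    coeff_mul, Nat.sum_antidiagonal_eq_sum_range_succ_mk, Finset.sum_range_succ,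
    Finset.sum_range_one] at h
  simp only [Nat.sub_zero, Nat.sub_self] at h
  rw [coeff_one_Th, coeff_zero_Th] at h
  linear_combination h

theorem polyP_even {k : ℕ} (hk : Even k) : polyP k = 0 := by
  induction k using Nat.strong_induction_on with
  | _ k ih =>
    rw [polyP_eq, sinhCoeff_even hk, Finset.sum_eq_zero]
    · simp [polyInvSq]
    · intro i hi
      have hik := Finset.mem_range.1 hi
      rcases Nat.even_or_odd i with h | h
      · rw [ih i hik h, mul_zero]
      · rw [coeff_odd_Fz (Nat.Even.sub_odd hik.le hk h), map_zero, zero_mul]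

theorem coeff_polyP_even (k : ℕ) {j : ℕ} (hj : Even j) : (polyP k).coeff j = 0 := by
  induction k using Nat.strong_induction_on generalizing j with
  | _ k ih =>
    rw [polyP_eq, Polynomial.coeff_add, Polynomial.coeff_monomial, Polynomial.coeff_X_pow_mul']
    have h1 : (if k = j then C (sinhCoeff k) else 0 : ℚ⟦X⟧) = 0 := by
      split_ifs with h
      · rw [sinhCoeff_even (h ▸ hj), map_zero]
      · rfl
    rw [h1, zero_add]
    split_ifs with h
    · rw [coeff_polyInvSq, Polynomial.finsetSum_coeff, Finset.sum_eq_zero, map_zero]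
      intro i hi
      rw [Polynomial.coeff_C_mul, ih i (Finset.mem_range.1 hi)
        ((Nat.even_sub h).2 (iff_of_true hj even_two)), mul_zero]
    · rfl

/-- F starts in degree z², so each factor u² in the recursion is paid for by raising k by at least
two. -/
theorem coeff_polyP_of_lt (k : ℕ) {j : ℕ} (hj : k < j) : (polyP k).coeff j = 0 := by
  induction k using Nat.strong_induction_on generalizing j with
  | _ k ih =>
    rw [polyP_eq, Polynomial.coeff_add, Polynomial.coeff_monomial, Polynomial.coeff_X_pow_mul',
      if_neg hj.ne, zero_add]
    split_ifs with h
    · rw [coeff_polyInvSq, Polynomial.finsetSum_coeff, Finset.sum_eq_zero, map_zero]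
      intro i hi
      have hik := Finset.mem_range.1 hi
      rw [Polynomial.coeff_C_mul]
      rcases eq_or_ne (i + 1) k with hk | hk
      · rw [show k - i = 1 by omega, coeff_odd_Fz odd_one, zero_mul]
      · rw [ih i hik (by omega), mul_zero]
    · rfl

theorem polyP_one : polyP 1 = Polynomial.X := by
  rw [polyP_eq, Finset.sum_range_one, polyP_even Even.zero, mul_zero]
  norm_num [polyInvSq, sinhCoeff, Polynomial.monomial_one_one_eq_X]

/-- For k ≥ 2 neither the monomial u^k nor the part divisible by u² has a linear term, and the even
coefficients vanish. -/
theorem X_pow_three_dvd_polyP {k : ℕ} (hk : 2 ≤ k) : Polynomial.X ^ 3 ∣ polyP k := by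
  rw [Polynomial.X_pow_dvd_iff]
  intro d hd
  interval_cases d
  · exact coeff_polyP_even k Even.zero
  · rw [polyP_eq, Polynomial.coeff_add, Polynomial.coeff_monomial, Polynomial.coeff_X_pow_mul',
      if_neg (by omega), if_neg (by omega), add_zero]
  · exact coeff_polyP_even k even_two

theorem comp_neg_X_of_coeff_even {A : Type*} [CommRing A] {p : Polynomial A}
    (hp : ∀ j, Even j → p.coeff j = 0) : p.comp (-Polynomial.X) = -p := by
  ext1 j
  rw [show (-Polynomial.X : Polynomial A) = Polynomial.C (-1) * Polynomial.X by simp,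
    Polynomial.comp_C_mul_X_coeff, Polynomial.coeff_neg]
  rcases Nat.even_or_odd j with h | h
  · rw [hp j h, zero_mul, neg_zero]
  · rw [h.neg_one_pow, mul_neg_one]

theorem polyP_comp_neg (k : ℕ) : (polyP k).comp (-Polynomial.X) = -polyP k :=
  comp_neg_X_of_coeff_even fun _ hj => coeff_polyP_even k hj

/-- The differential equation and the value at q = 0 are all that enters, so zero and negative m are
covered too. -/
theorem eval_polyP (k : ℕ) (m : ℤ) : (polyP k).eval (m : ℚ⟦X⟧) = coeff k (zHom (phi m)) := by
  induction k using Nat.strong_induction_on with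
  | _ k ih =>
    have h := congrArg (coeff k) (DV_DV_zHom_phi m)
    rw [DV, coeff_coeffDer, coeff_coeffDer, mul_assoc, ← Int.cast_pow, intCast_mul_eq_smul,
      coeff_smul, mul_comm Fz, coeff_mul,
      Nat.sum_antidiagonal_eq_sum_range_succ (fun i j => coeff i (zHom (phi m)) * coeff j Fz),
      Finset.sum_range_succ, Nat.sub_self, coeff_zero_Fz, mul_zero, add_zero] at h
    have hc : constantCoeff (coeff k (zHom (phi m))) = sinhCoeff k * (m : ℚ) ^ k := by
      have := congrArg (coeff k) (qZero_zHom_phi m)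
      rw [qZero, coeff_map, map_sub, coeff_expo, coeff_expo] at this
      rw [this, sinhCoeff, show -((m : ℚ) / 2) = -(1 / 2) * m by ring,
        show (m : ℚ) / 2 = 1 / 2 * m by ring, mul_pow, mul_pow]
      ring
    rw [eq_add_invSq (coeff k (zHom (phi m))), h, hc, map_smul, polyP_eq, Polynomial.eval_add,
      Polynomial.eval_monomial, Polynomial.eval_mul, Polynomial.eval_pow, Polynomial.eval_X,
      eval_polyInvSq, Polynomial.eval_finsetSum, ← Int.cast_pow, ← Int.cast_pow,
      intCast_mul_eq_smul, map_mul, map_pow, map_intCast, Int.cast_pow]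
    congr 3
    refine Finset.sum_congr rfl fun i hi => ?_
    rw [Polynomial.eval_mul, Polynomial.eval_C, ih i (Finset.mem_range.1 hi), mul_comm]

theorem coeff_polyP_mem {k : ℕ} (hk : 1 ≤ k) (j : ℕ) : (polyP k).coeff j ∈ QMod (k - 1) := by
  refine coeff_mem_of_eval_mem _ _ (fun n => ?_) j
  have h := eval_polyP k ((n + 1 : ℕ) : ℤ)
  rw [zHom_phi_eq_residue, Int.cast_natCast] at h
  rw [h, ← QZ_natCast]
  have := residue_mem n k
  rwa [show (-1 : ℤ) + k = ((k - 1 : ℕ) : ℤ) by omega] at this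

end

end KanekoZagierJacobi

theorem mainTheorem8 :
    ∃ P : ℕ → Polynomial (PowerSeries ℚ),
      (∀ k : ℕ, 1 ≤ k →
        (P k).comp (-Polynomial.X) = -(P k) ∧
        (P k).natDegree ≤ k ∧
        ∀ j : ℕ, (P k).coeff j ∈ KanekoZagierJacobi.QMod (k - 1)) ∧
      (∀ m : ℤ,
        KanekoZagierJacobi.zExpansion (KanekoZagierJacobi.phi m) =
          PowerSeries.mk fun k : ℕ =>
            if Odd k then (P k).eval (m : PowerSeries ℚ) else 0) ∧
      P 1 = Polynomial.X ∧
      ∀ k : ℕ, 2 ≤ k → Polynomial.X ^ 3 ∣ P k := by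
  refine ⟨KanekoZagierJacobi.polyP, fun k hk => ⟨KanekoZagierJacobi.polyP_comp_neg k,
    Polynomial.natDegree_le_iff_coeff_eq_zero.2 fun j hj =>
      KanekoZagierJacobi.coeff_polyP_of_lt k hj,
    KanekoZagierJacobi.coeff_polyP_mem hk⟩, fun m => ?_, KanekoZagierJacobi.polyP_one,
    fun k hk => KanekoZagierJacobi.X_pow_three_dvd_polyP hk⟩
  rw [KanekoZagierJacobi.zExpansion_eq_zHom]
  ext1 k
  rw [PowerSeries.coeff_mk, ← KanekoZagierJacobi.eval_polyP]
  split_ifs with h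
  · rfl
  · rw [KanekoZagierJacobi.polyP_even (Nat.not_odd_iff_even.1 h), Polynomial.eval_zero]
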